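/- Let $d\ge 1$ be an integer. For an algebraic number $a$ let $H(a)$ be its height, that is, the maximum of the absolute values of the relatively prime integer coefficients of its minimal defining polynomial. For $\psi:(0,\infty)\to(0,\infty)$ decreasing, let $K_d(\psi)$ be the set of $\xi\in[0,1]$ such that $|\xi-a|<\psi(H(a))$ for infinitely many algebraic numbers $a$ of degree at most $d$. (Everything below holds both when $a$ ranges over the real and when $a$ ranges over all complex algebraic numbers of degree at most $d$.) For $\tau>0$ write $K_d(\tau)$ for $K_d(\psi)$ with $\psi(r)=r^{-(d+1)\tau}$. A dimension function is an increasing continuous function $f:(0,\infty)\to(0,\infty)$ with $f(r)\to0$ as $r\to0$. The Hausdorff $f$-measure of a set $F$ is $\mathcal H^f(F)=\sup_{\rho>0}\inf\sum_i f(r_i)$, the infimum being over all countable covers of $F$ by balls of radii $r_i\le\rho$; $\mathcal H^s$ denotes $\mathcal H^f$ with $f(r)=r^s$. "Increasing" and "decreasing" are understood in the weak sense. 1. Let $f$ be a dimension function such that $r^{-1}f(r)\to\infty$ as $r\to0$ and $r^{-1}f(r)$ is decreasing, and let $\psi:(0,\infty)\to(0,\infty)$ be decreasing. Then $$\mathcal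 H^f(K_d(\psi))=\begin{cases}0&\text{if }\sum_{r=1}^\infty f(\psi(r))\,r^d<\infty,\\ \infty&\text{if }\sum_{r=1}^\infty f(\psi(r))\,r^d=\infty.\end{cases}$$ 2. (Baker–Schmidt) For every real $\tau\ge1$, the Hausdorff dimension of $K_d(\tau)$ is $1/\tau$. 3. For every real $\tau>1$, $\mathcal H^{1/\tau}(K_d(\tau))=\infty$. -/

import Mathlib

open Set Filter Topology Polynomial
open scoped ENNReal

/-- A dimension function `f : (0, ∞) → (0, ∞)`: increasing, continuous, and `f r → 0` as `r → 0⁺`.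
It is represented by a function on `ℝ` of which only the values on `(0, ∞)` matter. -/
structure IsDimensionFunction (f : ℝ → ℝ) : Prop where
  pos : ∀ r, 0 < r → 0 < f r
  monotoneOn : MonotoneOn f (Ioi 0)
  continuousOn : ContinuousOn f (Ioi 0)
  tendsto_zero : Tendsto f (𝓝[>] 0) (𝓝 0)

/-- An approximating function `ψ : (0, ∞) → (0, ∞)`: positive and decreasing.
It is represented by a function on `ℝ` of which only the values on `(0, ∞)` matter. -/
structure IsApproximatingFunction (ψ : ℝ → ℝ) : Prop where
  pos : ∀ r, 0 < r → 0 < ψ r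
  antitoneOn : AntitoneOn ψ (Ioi 0)

/-- A `ρ`-cover of `F`: a countable collection of balls, given by their centres and radii, with
radii in `(0, ρ]`, whose union contains `F`. -/
structure IsBallCover {X : Type*} [PseudoMetricSpace X] (ρ : ℝ) (F : Set X) (S : Set (X × ℝ)) :
    Prop where
  countable : S.Countable
  radius_pos : ∀ b ∈ S, 0 < b.2
  radius_le : ∀ b ∈ S, b.2 ≤ ρ
  subset : F ⊆ ⋃ b ∈ S, Metric.ball b.1 b.2

/-- The infimum of `∑ f (rᵢ)` over all `ρ`-covers of `F` by balls of radii `rᵢ`. -/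
noncomputable def hausdorffPre {X : Type*} [PseudoMetricSpace X] (f : ℝ → ℝ) (ρ : ℝ)
    (F : Set X) : ℝ≥0∞ :=
  ⨅ (S : Set (X × ℝ)) (_ : IsBallCover ρ F S), ∑' b : S, ENNReal.ofReal (f b.1.2)

/-- The Hausdorff `f`-measure of `F`: the supremum over `ρ > 0`, i.e. the limit as `ρ → 0`, of
the quantities `hausdorffPre f ρ F`. -/
noncomputable def hausdorffF {X : Type*} [PseudoMetricSpace X] (f : ℝ → ℝ) (F : Set X) : ℝ≥0∞ :=
  ⨆ (ρ : ℝ) (_ : 0 < ρ), hausdorffPre f ρ F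

/-- The minimal defining polynomial of an algebraic number over `ℤ`: the primitive integer
polynomial (unique up to sign) proportional to the minimal polynomial over `ℚ`. -/
noncomputable def intMinpoly {K : Type*} [Field K] [CharZero K] (a : K) : ℤ[X] :=
  (IsLocalization.integerNormalization (nonZeroDivisors ℤ) (minpoly ℚ a)).primPart

/-- The height `H(a)` of an algebraic number: the maximum of the absolute values of the coefficients
of its minimal defining polynomial over `ℤ`. -/
noncomputable def algHeight {K : Type*} [Field K] [CharZero K] (a : K) : ℕ :=
  (intMinpoly a).support.sup fun i => ((intMinpoly a).coeff i).natAbs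

/-- The algebraic numbers in `K` of degree at most `d`. -/
def algNumbers (K : Type*) [Field K] [CharZero K] (d : ℕ) : Set K :=
  {a | IsAlgebraic ℚ a ∧ (minpoly ℚ a).natDegree ≤ d}

/-- The set `K_d(ψ)` of the `ξ ∈ [0, 1]` with `|ξ - a| < ψ(H(a))` for infinitely many algebraic
numbers `a ∈ 𝕜` of degree at most `d`, where `𝕜` is `ℝ` or `ℂ`. -/
def algApprox (𝕜 : Type*) [RCLike 𝕜] (d : ℕ) (ψ : ℝ → ℝ) : Set ℝ :=
  {ξ | ξ ∈ Icc (0 : ℝ) 1 ∧ {a : 𝕜 | a ∈ algNumbers 𝕜 d ∧ ‖(ξ : 𝕜) - a‖ < ψ (algHeight a)}.Infinite}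

/-- The approximating function `r ↦ r ^ (-(d + 1) τ)`. -/
noncomputable def powerApprox (d : ℕ) (τ : ℝ) : ℝ → ℝ :=
  fun r => r ^ (-(((d : ℝ) + 1) * τ))

/-! Convergence is a direct covering argument. The algebraic numbers of height `n` and degree at
most `d` number at most a constant times `n ^ d`, so balls of radius `ψ n` about their real parts,
over all `n` beyond a given height, cover the set at a cost bounded by a tail of the series
(`hausdorffF_algApprox_eq_zero`).

Divergence has an arithmetic half and a measure half. The arithmetic half shows that real algebraic
numbers are evenly distributed: for large `X` every interval `I` in `[0, 1]` contains at least `c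
|I| X ^ (d + 1)` of them with height at most `X` and mutual distances at least `X ^ (-(d + 1))`
(`exists_separated_algNumbers`). Quantitative nondivergence for the Veronese curve, in the manner of
Kleinbock and Margulis (`exists_volume_small_vector_le`), says that for most `x` no nonzero integer
polynomial of degree at most `d` has both coefficients much smaller than `Q` and value at `x` much
smaller than `Q ^ (-d)`. At such an `x` a double pigeonhole (`exists_vector_of_forall_le_norm`)
gives a polynomial with value `O(Q ^ (-d))`, coefficients `O(Q)` and derivative at least `Q`. It has
a real root within `O(Q ^ (-(d + 1)))` of `x`, and by Gelfond's inequality that root has height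
`O(Q)`.

The measure half shows directly that no cheap cover exists. Suppose countably many intervals of
finite total `f`-cost leave a set of positive measure uncovered in an open set `O`. Then some
approximation ball inside `O`, of arbitrarily high level, also keeps positive uncovered measure
(`IsBallSystem.exists_ball`). Otherwise each such ball of radius `r` would cost at least `f r / 2`
to cover almost entirely; after discarding a small proportion of balls at each level, a covering
interval serves at most three of the rest, so the divergent series would force too large a cost.
Iterating gives nested balls whose common point lies off the cover and near infinitely many
algebraic numbers. Hence every cover with radii at most `ρ ≤ 1` costs at least `f ρ / (2 ρ)`, which
tends to infinity as `ρ → 0` (`IsBallSystem.le_hausdorffPre`).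

For the dimension take `f r = r ^ s`. The measure by balls and Mathlib's `μH[s]` have the same null
sets for `0 < s ≤ 1`, and the endpoint `τ = 1` follows from `τ > 1` by monotonicity in `τ`. -/

/-! ### Integral minimal polynomials and heights -/

section Heights

variable {K : Type*} [Field K] [CharZero K]

theorem exists_map_intMinpoly {a : K} (ha : IsAlgebraic ℚ a) :
    ∃ q : ℚ, q ≠ 0 ∧ (intMinpoly a).map (algebraMap ℤ ℚ) = C q * minpoly ℚ a := by
  obtain ⟨b, hbM, hb⟩ := IsLocalization.integerNormalization_spec (nonZeroDivisors ℤ)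
    (minpoly ℚ a)
  set p := IsLocalization.integerNormalization (nonZeroDivisors ℤ) (minpoly ℚ a) with hp
  have hm : minpoly ℚ a ≠ 0 := minpoly.ne_zero ha.isIntegral
  have hb0 : (b : ℚ) ≠ 0 := by
    exact_mod_cast nonZeroDivisors.ne_zero hbM
  have hb' : p.map (algebraMap ℤ ℚ) = C (b : ℚ) * minpoly ℚ a := by
    rw [hb]
    ext i
    simp
  have hp0 : p ≠ 0 := by
    intro h
    rw [h, Polynomial.map_zero] at hb'
    exact mul_ne_zero (C_ne_zero.2 hb0) hm hb'.symm
  have hc : p.content ≠ 0 := by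
    rwa [Ne, content_eq_zero_iff]
  have hc' : (p.content : ℚ) ≠ 0 := by exact_mod_cast hc
  refine ⟨(p.content : ℚ)⁻¹ * (b : ℚ), mul_ne_zero (inv_ne_zero hc') hb0, ?_⟩
  have h2 : p.map (algebraMap ℤ ℚ) = C (p.content : ℚ) * p.primPart.map (algebraMap ℤ ℚ) := by
    conv_lhs => rw [p.eq_C_content_mul_primPart]
    rw [Polynomial.map_mul, Polynomial.map_C]
    rfl
  have h3 : intMinpoly a = p.primPart := rfl
  rw [h3, C_mul, mul_assoc, ← hb', h2, ← mul_assoc, ← C_mul, inv_mul_cancel₀ hc', C_1, one_mul]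

theorem intMinpoly_isPrimitive (a : K) : (intMinpoly a).IsPrimitive :=
  isPrimitive_primPart _

theorem intMinpoly_ne_zero (a : K) : intMinpoly a ≠ 0 :=
  (intMinpoly_isPrimitive a).ne_zero

theorem natDegree_intMinpoly {a : K} (ha : IsAlgebraic ℚ a) :
    (intMinpoly a).natDegree = (minpoly ℚ a).natDegree := by
  obtain ⟨q, hq, h⟩ := exists_map_intMinpoly ha
  rw [← natDegree_C_mul (p := minpoly ℚ a) hq, ← h,
    natDegree_map_eq_of_injective (algebraMap ℤ ℚ).injective_int]

theorem aeval_intMinpoly {a : K} (ha : IsAlgebraic ℚ a) : aeval a (intMinpoly a) = 0 := by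
  obtain ⟨q, hq, h⟩ := exists_map_intMinpoly ha
  rw [← aeval_map_algebraMap ℚ, h, map_mul, minpoly.aeval, mul_zero]

/-- Gauss's lemma: a primitive polynomial that divides over `ℚ` divides over `ℤ`. -/
theorem intMinpoly_dvd {a : K} {P : ℤ[X]} (hP : P ≠ 0) (h : aeval a P = 0) :
    intMinpoly a ∣ P := by
  have ha : IsAlgebraic ℚ a := by
    refine ⟨P.map (algebraMap ℤ ℚ), ?_, by rw [aeval_map_algebraMap, h]⟩
    exact (Polynomial.map_ne_zero_iff (algebraMap ℤ ℚ).injective_int).2 hP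
  obtain ⟨q, hq, hm⟩ := exists_map_intMinpoly ha
  rw [IsPrimitive.Int.dvd_iff_map_cast_dvd_map_cast _ _ (intMinpoly_isPrimitive a)]
  have : (intMinpoly a).map (Int.castRingHom ℚ) = C q * minpoly ℚ a := hm
  rw [this]
  have h2 : minpoly ℚ a ∣ P.map (Int.castRingHom ℚ) := by
    refine minpoly.dvd ℚ a ?_
    exact (aeval_map_algebraMap ℚ a P).trans h
  have hu : IsUnit (C q : ℚ[X]) := isUnit_C.2 hq.isUnit
  exact (hu.mul_left_dvd).2 h2

theorem natAbs_coeff_le_algHeight (a : K) (i : ℕ) :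
    ((intMinpoly a).coeff i).natAbs ≤ algHeight a := by
  by_cases h : i ∈ (intMinpoly a).support
  · exact Finset.le_sup (f := fun i => ((intMinpoly a).coeff i).natAbs) h
  · rw [notMem_support_iff.1 h]; simp

theorem exists_natAbs_coeff_eq_algHeight (a : K) :
    ∃ i ∈ (intMinpoly a).support, ((intMinpoly a).coeff i).natAbs = algHeight a := by
  obtain ⟨i, hi, h⟩ := Finset.exists_mem_eq_sup (intMinpoly a).support
    (nonempty_support_iff.2 (intMinpoly_ne_zero a))
    (fun i => ((intMinpoly a).coeff i).natAbs)
  exact ⟨i, hi, h.symm⟩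

theorem one_le_algHeight (a : K) : 1 ≤ algHeight a := by
  obtain ⟨i, hi, h⟩ := exists_natAbs_coeff_eq_algHeight a
  rw [← h]
  exact Nat.one_le_iff_ne_zero.2 (Int.natAbs_ne_zero.2 (mem_support_iff.1 hi))

theorem one_le_mahlerMeasure_intCast {P : ℤ[X]} (hP : P ≠ 0) :
    1 ≤ (P.map (Int.castRingHom ℂ)).mahlerMeasure :=
  one_le_mahlerMeasure_of_ne_zero hP

/-- Gelfond's inequality: an integer factor of an integer polynomial has comparable height. -/
theorem norm_coeff_le_of_dvd {R P : ℤ[X]} (hP : P ≠ 0) (hRP : R ∣ P) {d : ℕ}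
    (hd : P.natDegree ≤ d) {H : ℝ} (hH : ∀ i, |(P.coeff i : ℝ)| ≤ H) (i : ℕ) :
    |(R.coeff i : ℝ)| ≤ 2 ^ d * ((d + 1) * H) := by
  obtain ⟨S, rfl⟩ := hRP
  have hR : R ≠ 0 := left_ne_zero_of_mul hP
  have hS : S ≠ 0 := right_ne_zero_of_mul hP
  have hH0 : 0 ≤ H := (abs_nonneg _).trans (hH 0)
  have hinj : Function.Injective (Int.castRingHom ℂ) := (Int.castRingHom ℂ).injective_int
  have hRd : R.natDegree ≤ d := by
    rw [natDegree_mul hR hS] at hd; omega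
  have h1 := norm_coeff_le_choose_mul_mahlerMeasure i (R.map (Int.castRingHom ℂ))
  have hcR : ‖(R.map (Int.castRingHom ℂ)).coeff i‖ = |(R.coeff i : ℝ)| := by
    rw [coeff_map, eq_intCast, Complex.norm_intCast]
  -- The Mahler measure is multiplicative and at least 1 on nonzero integer polynomials, so dropping
  -- the cofactor cannot increase it.
  have h2 : (R.map (Int.castRingHom ℂ)).mahlerMeasure ≤
      ((R * S).map (Int.castRingHom ℂ)).mahlerMeasure := by
    rw [Polynomial.map_mul, mahlerMeasure_mul]
    exact le_mul_of_one_le_right (mahlerMeasure_nonneg _) (one_le_mahlerMeasure_intCast hS)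
  have h3 : ((R * S).map (Int.castRingHom ℂ)).mahlerMeasure ≤ (d + 1) * H := by
    refine (mahlerMeasure_le_sum_norm_coeff _).trans ?_
    rw [Polynomial.sum_over_range' _ (by simp) (d + 1) (by
      rw [natDegree_map_eq_of_injective hinj]; omega)]
    calc _ ≤ ∑ i ∈ Finset.range (d + 1), H := by
          refine Finset.sum_le_sum fun i _ => ?_
          rw [coeff_map, eq_intCast, Complex.norm_intCast]
          exact hH i
      _ = _ := by simp
  have h4 : (((R.map (Int.castRingHom ℂ)).natDegree.choose i : ℕ) : ℝ) ≤ 2 ^ d := by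
    rw [natDegree_map_eq_of_injective hinj]
    calc ((R.natDegree.choose i : ℕ) : ℝ) ≤ ((2 ^ R.natDegree : ℕ) : ℝ) := by
          exact_mod_cast Nat.choose_le_two_pow _ _
      _ ≤ 2 ^ d := by
          push_cast
          exact pow_le_pow_right₀ (by norm_num) hRd
  rw [← hcR]
  refine h1.trans (mul_le_mul h4 (h2.trans h3) (mahlerMeasure_nonneg _) (by positivity))

theorem algHeight_le_of_aeval_eq_zero {a : K} {P : ℤ[X]} (hP : P ≠ 0) (h : aeval a P = 0) {d : ℕ}
    (hd : P.natDegree ≤ d) {H : ℝ} (hH : ∀ i, |(P.coeff i : ℝ)| ≤ H) :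
    a ∈ algNumbers K d ∧ (algHeight a : ℝ) ≤ 2 ^ d * ((d + 1) * H) := by
  have hdvd := intMinpoly_dvd hP h
  have ha : IsAlgebraic ℚ a := by
    refine ⟨P.map (algebraMap ℤ ℚ), ?_, by rw [aeval_map_algebraMap, h]⟩
    exact (Polynomial.map_ne_zero_iff (algebraMap ℤ ℚ).injective_int).2 hP
  refine ⟨⟨ha, ?_⟩, ?_⟩
  · rw [← natDegree_intMinpoly ha]
    exact (natDegree_le_of_dvd hdvd hP).trans hd
  · obtain ⟨i, -, hi⟩ := exists_natAbs_coeff_eq_algHeight a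
    rw [← hi, Nat.cast_natAbs, Int.cast_abs]
    exact norm_coeff_le_of_dvd hP hdvd hd hH i

end Heights

/-! ### Real algebraic numbers inside `𝕜` -/

section RealEmbedding

variable (𝕜 : Type*) [RCLike 𝕜]

theorem minpoly_ofReal (a : ℝ) : minpoly ℚ (a : 𝕜) = minpoly ℚ a :=
  minpoly.algHom_eq ((RCLike.ofRealAm (K := 𝕜)).restrictScalars ℚ) RCLike.ofReal_injective a

theorem algHeight_ofReal (a : ℝ) : algHeight (a : 𝕜) = algHeight a := by
  simp only [algHeight, intMinpoly, minpoly_ofReal]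

theorem ofReal_mem_algNumbers {a : ℝ} {d : ℕ} (ha : a ∈ algNumbers ℝ d) :
    (a : 𝕜) ∈ algNumbers 𝕜 d := by
  refine ⟨?_, by rw [minpoly_ofReal]; exact ha.2⟩
  exact ha.1.algHom ((RCLike.ofRealAm (K := 𝕜)).restrictScalars ℚ)

end RealEmbedding

/-! ### Counting algebraic numbers of given height -/

section Count

variable {K : Type*} [Field K] [CharZero K]

/-- Integer coefficient vectors with entries bounded by `n`, one of which is `± n`. -/
noncomputable def coeffVectors (d n : ℕ) : Finset (Fin (d + 1) → ℤ) :=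
  Finset.univ.biUnion fun i => Fintype.piFinset fun j =>
    if j = i then {(n : ℤ), -(n : ℤ)} else Finset.Icc (-(n : ℤ)) n

/-- One coordinate is pinned to two values, which lowers the exponent from `d + 1` to `d`, the power
occurring in the series. -/
theorem card_coeffVectors_le (d n : ℕ) :
    (coeffVectors d n).card ≤ (d + 1) * (2 * (2 * n + 1) ^ d) := by
  refine (Finset.card_biUnion_le_card_mul _ _ (2 * (2 * n + 1) ^ d) fun i _ => ?_).trans (by simp)
  rw [Fintype.card_piFinset, ← Finset.mul_prod_erase _ _ (Finset.mem_univ i), if_pos rfl]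
  refine Nat.mul_le_mul Finset.card_le_two ?_
  rw [Finset.prod_congr rfl (g := fun _ => 2 * n + 1)]
  · simp
  · intro j hj
    rw [if_neg (Finset.ne_of_mem_erase hj), Int.card_Icc]
    omega

/-- The polynomial with the given coefficient vector. -/
noncomputable def polyOfVec {d : ℕ} (v : Fin (d + 1) → ℤ) : ℤ[X] :=
  ∑ i : Fin (d + 1), C (v i) * X ^ (i : ℕ)

theorem coeff_polyOfVec {d : ℕ} (v : Fin (d + 1) → ℤ) (i : Fin (d + 1)) :
    (polyOfVec v).coeff i = v i := by
  simp only [polyOfVec, finsetSum_coeff, coeff_C_mul, coeff_X_pow]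
  rw [Finset.sum_eq_single i] <;> simp +contextual [Fin.ext_iff, eq_comm]

theorem natDegree_polyOfVec_le {d : ℕ} (v : Fin (d + 1) → ℤ) : (polyOfVec v).natDegree ≤ d := by
  refine natDegree_sum_le_of_forall_le _ _ fun i _ => ?_
  exact (natDegree_C_mul_X_pow_le _ _).trans (by omega)

theorem polyOfVec_coeff {d : ℕ} {P : ℤ[X]} (hP : P.natDegree ≤ d) :
    polyOfVec (fun i : Fin (d + 1) => P.coeff i) = P := by
  rw [polyOfVec, Fin.sum_univ_eq_sum_range (fun i => C (P.coeff i) * X ^ i) (d + 1)]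
  exact (P.as_sum_range_C_mul_X_pow' (by omega)).symm

theorem polyOfVec_ne_zero {d : ℕ} {v : Fin (d + 1) → ℤ} (hv : v ≠ 0) : polyOfVec v ≠ 0 := by
  obtain ⟨i, hi⟩ := Function.ne_iff.1 hv
  intro h
  apply hi
  rw [← coeff_polyOfVec v i, h]
  simp

open Classical in
theorem algNumbers_height_eq_subset (d n : ℕ) :
    {a : K | a ∈ algNumbers K d ∧ algHeight a = n} ⊆
      ⋃ v ∈ coeffVectors d n, (((polyOfVec v).map (algebraMap ℤ K)).roots.toFinset : Set K) := by
  rintro a ⟨⟨ha, hd⟩, rfl⟩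
  have hP := intMinpoly_ne_zero a
  rw [← natDegree_intMinpoly ha] at hd
  simp only [mem_iUnion]
  refine ⟨fun i => (intMinpoly a).coeff i, ?_, ?_⟩
  · simp only [coeffVectors, Finset.mem_biUnion, Finset.mem_univ, true_and, Fintype.mem_piFinset]
    obtain ⟨i, hi, h⟩ := exists_natAbs_coeff_eq_algHeight a
    refine ⟨⟨i, by have := le_natDegree_of_mem_supp i hi; omega⟩, fun j => ?_⟩
    have hj := natAbs_coeff_le_algHeight a j
    split_ifs with hji
    · subst hji
      simp only [Finset.mem_insert, Finset.mem_singleton]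
      simp only at hj
      omega
    · rw [Finset.mem_Icc]
      omega
  · rw [polyOfVec_coeff hd, SetLike.mem_coe, Multiset.mem_toFinset, mem_roots
      ((Polynomial.map_ne_zero_iff (algebraMap ℤ K).injective_int).2 hP), IsRoot.def,
      eval_map_algebraMap]
    exact aeval_intMinpoly ha

theorem finite_algNumbers_height_eq (d n : ℕ) :
    {a : K | a ∈ algNumbers K d ∧ algHeight a = n}.Finite := by
  classical
  refine Set.Finite.subset ?_ (algNumbers_height_eq_subset d n)
  exact (Finset.finite_toSet _).biUnion fun v _ => Finset.finite_toSet _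

theorem ncard_algNumbers_height_eq_le (d n : ℕ) :
    {a : K | a ∈ algNumbers K d ∧ algHeight a = n}.ncard ≤
      ((d + 1) * (2 * (2 * n + 1) ^ d)) * d := by
  classical
  have hsub := algNumbers_height_eq_subset (K := K) d n
  set T : Finset K := (coeffVectors d n).biUnion
    fun v => ((polyOfVec v).map (algebraMap ℤ K)).roots.toFinset
  have hT : {a : K | a ∈ algNumbers K d ∧ algHeight a = n} ⊆ (T : Set K) := by
    rw [Finset.coe_biUnion]; exact hsub
  refine (Set.ncard_le_ncard hT T.finite_toSet).trans ?_
  rw [Set.ncard_coe_finset]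
  refine (Finset.card_biUnion_le_card_mul _ _ d fun v _ => ?_).trans
    (Nat.mul_le_mul_right _ (card_coeffVectors_le d n))
  refine (Multiset.toFinset_card_le _).trans ((card_roots' _).trans ?_)
  exact (natDegree_map_le).trans (natDegree_polyOfVec_le v)

theorem finite_algNumbers_height_le (d n : ℕ) :
    {a : K | a ∈ algNumbers K d ∧ algHeight a ≤ n}.Finite := by
  refine Set.Finite.subset ((Finset.range (n + 1)).finite_toSet.biUnion
    fun m _ => finite_algNumbers_height_eq (K := K) d m) ?_
  rintro a ⟨ha, hn⟩
  simp only [mem_iUnion]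
  exact ⟨algHeight a, by simpa using Nat.lt_succ_of_le hn, ha, rfl⟩

end Count

/-! ### Sublevel sets of polynomials -/

section Good

open MeasureTheory

/-- A set of measure larger than `2 N δ` contains `N + 1` points which are `δ`-separated. -/
theorem exists_separated_of_lt_volume {Z : Set ℝ} {δ : ℝ} (hδ : 0 < δ) :
    ∀ N : ℕ, ENNReal.ofReal (2 * N * δ) < volume Z →
      ∃ T : Finset ℝ, T.card = N + 1 ∧ (T : Set ℝ) ⊆ Z ∧
        ∀ x ∈ T, ∀ y ∈ T, x ≠ y → δ ≤ |x - y|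
  | 0, h => by
    have : Z.Nonempty := by
      by_contra h0
      rw [not_nonempty_iff_eq_empty.1 h0] at h
      simp at h
    obtain ⟨z, hz⟩ := this
    exact ⟨{z}, by simp, by simpa using hz, by simp +contextual⟩
  | N + 1, h => by
    have hlt : ENNReal.ofReal (2 * N * δ) < volume Z := by
      refine lt_of_le_of_lt (ENNReal.ofReal_le_ofReal ?_) h
      push_cast; nlinarith
    obtain ⟨T, hc, hT, hs⟩ := exists_separated_of_lt_volume hδ N hlt
    have hU : volume (⋃ x ∈ T, Metric.ball x δ) < volume Z := by
      refine lt_of_le_of_lt ((measure_biUnion_finset_le _ _).trans ?_) h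
      simp only [Real.volume_ball, Finset.sum_const, hc, nsmul_eq_mul]
      rw [← ENNReal.ofReal_natCast, ← ENNReal.ofReal_mul (by positivity)]
      exact ENNReal.ofReal_le_ofReal (by push_cast; linarith)
    have : (Z \ ⋃ x ∈ T, Metric.ball x δ).Nonempty := by
      by_contra h0
      rw [not_nonempty_iff_eq_empty, sdiff_eq_empty] at h0
      exact absurd (measure_mono h0) (not_le.2 hU)
    obtain ⟨z, hz, hz'⟩ := this
    simp only [mem_iUnion, Metric.mem_ball, not_exists, not_lt, Real.dist_eq] at hz'
    have hzT : z ∉ T := fun hz0 => by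
      have := hz' z hz0; simp at this; linarith
    refine ⟨insert z T, by rw [Finset.card_insert_of_notMem hzT, hc], ?_, ?_⟩
    · rw [Finset.coe_insert]; exact insert_subset hz hT
    · intro x hx y hy hxy
      rw [Finset.mem_insert] at hx hy
      rcases hx with rfl | hx <;> rcases hy with rfl | hy
      · exact absurd rfl hxy
      · exact hz' y hy
      · rw [abs_sub_comm]; exact hz' x hx
      · exact hs x hx y hy hxy

/-- Lagrange interpolation bound. -/
theorem abs_eval_le_of_separated {p : ℝ[X]} {N : ℕ} (hp : p.natDegree ≤ N) {T : Finset ℝ}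
    (hT : T.card = N + 1) {δ R ε : ℝ} (hδ : 0 < δ) (hs : ∀ x ∈ T, ∀ y ∈ T, x ≠ y → δ ≤ |x - y|)
    (hε : ∀ x ∈ T, |p.eval x| ≤ ε) {z : ℝ} (hz : ∀ x ∈ T, |z - x| ≤ R) :
    |p.eval z| ≤ (N + 1) * (ε * (R / δ) ^ N) := by
  classical
  have hdeg : p.degree < T.card := by
    rw [hT]
    exact lt_of_le_of_lt degree_le_natDegree (by exact_mod_cast Nat.lt_succ_of_le hp)
  have hinj : Set.InjOn (id : ℝ → ℝ) T := Function.injective_id.injOn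
  have h := Lagrange.eq_interpolate hinj hdeg
  rw [h, Lagrange.interpolate_apply, eval_finsetSum]
  refine (Finset.abs_sum_le_sum_abs _ _).trans ?_
  have : ∀ x ∈ T, |eval z (C (eval (id x) p) * Lagrange.basis T id x)| ≤ ε * (R / δ) ^ N := by
    intro x hx
    rw [eval_mul, eval_C, abs_mul]
    refine mul_le_mul (hε x hx) ?_ (abs_nonneg _) ((abs_nonneg _).trans (hε x hx))
    rw [Lagrange.basis, eval_prod, Finset.abs_prod]
    have hc : (T.erase x).card = N := by rw [Finset.card_erase_of_mem hx, hT]; rfl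
    rw [← hc, ← Finset.prod_const]
    refine Finset.prod_le_prod (fun _ _ => abs_nonneg _) fun y hy => ?_
    have hy' := Finset.mem_of_mem_erase hy
    have hne := Finset.ne_of_mem_erase hy
    simp only [Lagrange.basisDivisor, id, eval_mul, eval_C, eval_sub, eval_X, abs_mul, abs_inv]
    rw [inv_mul_eq_div]
    have h1 := hs x hx y hy' hne.symm
    exact div_le_div₀ ((abs_nonneg _).trans (hz y hy')) (hz y hy') hδ h1
  refine (Finset.sum_le_sum this).trans ?_
  simp [hT]

/-- `g` is good with respect to `(ε, η)`: on a ball containing a point where `g ≥ 1`, the set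
where `g < ε` has proportion at most `η`. -/
def IsGoodAt (ε η : ℝ) (g : ℝ → ℝ) : Prop :=
  ∀ x r y₀ : ℝ, 0 < r → y₀ ∈ Metric.closedBall x r → 1 ≤ g y₀ →
    volume {y | y ∈ Metric.closedBall x r ∧ g y < ε} ≤ ENNReal.ofReal (η * r)

/-- A large sublevel set would contain `N + 1` points separated by a fixed fraction of `r`;
interpolation from them would make the polynomial at most `1 / 2` at `y₀`. The argument is scale
invariant, so `ε` depends only on `N` and `η`. -/
theorem exists_isGoodAt_polynomial (N : ℕ) {η : ℝ} (hη : 0 < η) :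
    ∃ ε : ℝ, 0 < ε ∧ ε ≤ 1 ∧ ∀ p : ℝ[X], p.natDegree ≤ N →
      IsGoodAt ε η (fun y => |p.eval y|) := by
  set δ := η / (2 * (N + 1)) with hδ
  have hδ0 : 0 < δ := by positivity
  set A : ℝ := (N + 1) * (2 / δ) ^ N
  have hA : 0 < A := by positivity
  refine ⟨min 1 (1 / (2 * A)), by positivity, min_le_left _ _, ?_⟩
  intro p hp x r y₀ hr hy₀ h1
  by_contra! hlt
  have hlt' : ENNReal.ofReal (2 * N * (δ * r)) <
      volume {y | y ∈ Metric.closedBall x r ∧ |p.eval y| < min 1 (1 / (2 * A))} := by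
    refine lt_of_le_of_lt (ENNReal.ofReal_le_ofReal ?_) hlt
    have : 2 * N * δ ≤ η := by
      rw [hδ, mul_div_assoc', div_le_iff₀ (by positivity)]
      nlinarith
    nlinarith
  obtain ⟨T, hT, hTs, hsep⟩ := exists_separated_of_lt_volume (by positivity) N hlt'
  have hb := abs_eval_le_of_separated hp hT (by positivity) hsep
    (ε := 1 / (2 * A)) (fun y hy => ((hTs hy).2.trans_le (min_le_right _ _)).le) (z := y₀)
    (R := 2 * r) (fun y hy => by
      have h1 := (hTs hy).1
      rw [Metric.mem_closedBall, Real.dist_eq] at h1 hy₀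
      rw [abs_le] at *
      constructor <;> linarith)
  have h2 : 2 * r / (δ * r) = 2 / δ := by field_simp
  rw [h2] at hb
  have h3 : ((N : ℝ) + 1) * (1 / (2 * A) * (2 / δ) ^ N) = 1 / 2 := by
    have : ((N : ℝ) + 1) * (1 / (2 * A) * (2 / δ) ^ N) = A * (1 / (2 * A)) := by
      simp only [A]; ring
    rw [this]; field_simp
  linarith

end Good

/-! ### Abstract quantitative nondivergence -/

section Nondivergence

open MeasureTheory

variable {α : Type*}

/-- The point `x` is marked when some pairwise comparable family `F` satisfies `ε ≤ ψ s x ≤ 1` for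
`s ∈ F` and `1 ≤ ψ s x` for the other `s ∈ S` comparable to all of `F`. -/
def IsMarked (R : α → α → Prop) (ψ : α → ℝ → ℝ) (ε : ℝ) (S : Finset α) (x : ℝ) : Prop :=
  ∃ F : Finset α, F ⊆ S ∧ (∀ s ∈ F, ∀ t ∈ F, R s t) ∧ (∀ s ∈ F, ε ≤ ψ s x ∧ ψ s x ≤ 1) ∧
    ∀ s ∈ S, s ∉ F → (∀ t ∈ F, R s t) → 1 ≤ ψ s x

theorem sum_radius_le_of_disjoint {β : Type*} {s : Set β} {c : β → ℝ} {ρ : β → ℝ}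
    (hρ : ∀ j, 0 < ρ j) (hd : s.PairwiseDisjoint fun j => Metric.closedBall (c j) (ρ j))
    {x r : ℝ} (hsub : ∀ j ∈ s, Metric.closedBall (c j) (ρ j) ⊆ Metric.closedBall x r) :
    s.Countable ∧ ∑' j : s, ENNReal.ofReal (ρ j) ≤ ENNReal.ofReal r := by
  have hc : s.Countable := by
    refine hd.countable_of_nonempty_interior fun j _ => ?_
    exact (Metric.nonempty_ball.2 (hρ j)).mono Metric.ball_subset_interior_closedBall
  refine ⟨hc, ?_⟩
  have h1 := measure_biUnion (μ := volume) hc hd (fun j _ => measurableSet_closedBall)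
  have h2 : volume (⋃ j ∈ s, Metric.closedBall (c j) (ρ j)) ≤ volume (Metric.closedBall x r) :=
    measure_mono (iUnion₂_subset hsub)
  rw [h1] at h2
  simp only [Real.volume_closedBall, ENNReal.ofReal_mul (zero_le_two (α := ℝ))] at h2
  rw [ENNReal.tsum_mul_left] at h2
  exact (ENNReal.mul_le_mul_iff_right (by simp) (by simp)).1 h2

/-- One step of the induction: cover the set where some `ψ s < 1` by balls on which one of the
functions stays below `1` while all of them reach `1` on the closed ball. -/
theorem exists_ball_of_lt_one {S : Finset α} {ψ : α → ℝ → ℝ} (hc : ∀ s ∈ S, Continuous (ψ s))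
    {x r : ℝ} (h1 : ∀ s ∈ S, ∃ y ∈ Metric.closedBall x r, 1 ≤ ψ s y) {z : ℝ}
    (hz : z ∈ Metric.closedBall x r) (hz1 : ∃ s ∈ S, ψ s z < 1) :
    ∃ s ∈ S, ∃ ρ : ℝ, 0 < ρ ∧ ρ ≤ 2 * r ∧ (∀ y ∈ Metric.ball z ρ, ψ s y < 1) ∧
      ∀ t ∈ S, ∃ y ∈ Metric.closedBall z ρ, 1 ≤ ψ t y := by
  classical
  obtain ⟨s₀, hs₀, hs₀z⟩ := hz1
  set G : α → Set ℝ := fun s => {y | 1 ≤ ψ s y}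
  have hcl : ∀ s ∈ S, IsClosed (G s) := fun s hs => isClosed_le continuous_const (hc s hs)
  have hne : ∀ s ∈ S, (G s).Nonempty := fun s hs => by
    obtain ⟨y, -, hy⟩ := h1 s hs; exact ⟨y, hy⟩
  -- The radius is the largest of the distances from `z` to the sets `1 ≤ ψ s`. The maximising
  -- function stays below 1 inside the ball, and every other one has already reached 1 on the closed
  -- ball.
  obtain ⟨s, hsS, hmax⟩ := S.exists_max_image (fun s => Metric.infDist z (G s)) ⟨s₀, hs₀⟩
  have hpos : 0 < Metric.infDist z (G s) := by
    refine lt_of_lt_of_le ?_ (hmax s₀ hs₀)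
    exact ((hcl s₀ hs₀).notMem_iff_infDist_pos (hne s₀ hs₀)).1 (by simpa [G] using hs₀z)
  refine ⟨s, hsS, Metric.infDist z (G s), hpos, ?_, ?_, ?_⟩
  · obtain ⟨y, hy, hy1⟩ := h1 s hsS
    refine (Metric.infDist_le_dist_of_mem (show y ∈ G s from hy1)).trans ?_
    have := dist_triangle_right z y x
    rw [Metric.mem_closedBall] at hy hz
    linarith
  · intro y hy
    by_contra! h
    have := Metric.infDist_le_dist_of_mem (x := z) (show y ∈ G s from h)
    rw [Metric.mem_ball, dist_comm] at hy
    linarith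
  · intro t ht
    obtain ⟨y, hy, hyd⟩ := (hcl t ht).exists_infDist_eq_dist (hne t ht) z
    refine ⟨y, ?_, hy⟩
    rw [Metric.mem_closedBall, dist_comm, ← hyd]
    exact hmax t ht

/-- Induction on the number of dimensions still available. Near an unmarked point one `ψ s` is below
1. On the ball built around that point, the remaining members comparable to `s` avoid its dimension,
so the induction hypothesis applies to them. Besicovitch covering adds up the local bounds at the
cost of a factor `3 * N`. -/
theorem exists_volume_unmarked_le :
    ∃ M : ℕ, ∀ {α : Type*} (R : α → α → Prop) (_ : ∀ s, R s s) (_ : ∀ s t, R s t → R t s)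
      (dim : α → ℕ) (_ : ∀ s t, R s t → dim s = dim t → s = t) (ψ : α → ℝ → ℝ) (ε η : ℝ)
      (_ : 0 ≤ η) (_ : ε ≤ 1) (n : ℕ) (D : Finset ℕ) (_ : D.card ≤ n) (S : Finset α)
      (_ : ∀ s ∈ S, dim s ∈ D) (_ : ∀ s ∈ S, Continuous (ψ s))
      (_ : ∀ s ∈ S, IsGoodAt ε η (ψ s)) (x r : ℝ) (_ : 0 < r)
      (_ : ∀ s ∈ S, ∃ y ∈ Metric.closedBall x r, 1 ≤ ψ s y),
      volume {y | y ∈ Metric.closedBall x r ∧ ¬ IsMarked R ψ ε S y} ≤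
        ENNReal.ofReal (((M + 1 : ℕ) : ℝ) ^ n * n * η * r) := by
  classical
  obtain ⟨N, τ, hτ, hN⟩ := HasBesicovitchCovering.no_satelliteConfig (α := ℝ)
  refine ⟨3 * N, ?_⟩
  intro α R hR hRs dim hdim ψ ε η hη hε n
  induction n with
  | zero =>
    intro D hD S hS _ _ x r hr _
    have hS0 : S = ∅ := by
      rw [Finset.eq_empty_iff_forall_notMem]
      intro s hs
      have := hS s hs
      rw [Finset.card_eq_zero.1 (Nat.le_zero.1 hD)] at this
      simp at this
    have : {y | y ∈ Metric.closedBall x r ∧ ¬ IsMarked R ψ ε S y} = ∅ := by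
      rw [eq_empty_iff_forall_notMem]
      rintro y ⟨-, hy⟩
      exact hy ⟨∅, by simp, by simp, by simp, by simp [hS0]⟩
    rw [this]; simp
  | succ n ih =>
    intro D hD S hS hc hg x r hr h1
    set U : Set ℝ := {y | y ∈ Metric.closedBall x r ∧ ¬ IsMarked R ψ ε S y}
    have hU : ∀ z ∈ U, ∃ s ∈ S, ψ s z < 1 := by
      rintro z ⟨hz, hzm⟩
      by_contra! h
      exact hzm ⟨∅, by simp, by simp, by simp, fun s hs _ _ => h s hs⟩
    have key : ∀ z : U, ∃ s ∈ S, ∃ ρ : ℝ, 0 < ρ ∧ ρ ≤ 2 * r ∧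
        (∀ y ∈ Metric.ball (z : ℝ) ρ, ψ s y < 1) ∧
        ∀ t ∈ S, ∃ y ∈ Metric.closedBall (z : ℝ) ρ, 1 ≤ ψ t y :=
      fun z => exists_ball_of_lt_one hc h1 z.2.1 (hU z z.2)
    choose σ hσ ρ hρ0 hρr hρ1 hρ2 using key
    set A : ℝ := ((3 * N + 1 : ℕ) : ℝ) ^ n * n + 1 with hA
    have hA0 : 0 ≤ A := by positivity
    have hball : ∀ z : U, volume (U ∩ Metric.ball (z : ℝ) (ρ z)) ≤
        ENNReal.ofReal (A * η) * ENNReal.ofReal (ρ z) := by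
      intro z
      set S' := S.filter fun t => R t (σ z) ∧ t ≠ σ z with hS'
      -- A family marking `y` for `S'`, enlarged by `σ z`, marks `y` for `S` as soon as `ψ (σ z) y`
      -- is at least `ε`.
      have hsub : U ∩ Metric.ball (z : ℝ) (ρ z) ⊆
          {y | y ∈ Metric.closedBall (z : ℝ) (ρ z) ∧ ¬ IsMarked R ψ ε S' y} ∪
          {y | y ∈ Metric.closedBall (z : ℝ) (ρ z) ∧ ψ (σ z) y < ε} := by
        rintro y ⟨hyU, hyb⟩
        by_contra hy
        simp only [mem_union, mem_ofPred_eq, not_or, not_and, not_not, not_lt] at hy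
        have hyc := Metric.ball_subset_closedBall hyb
        obtain ⟨F, hFS, hFR, hF1, hF2⟩ := hy.1 hyc
        have hσε := hy.2 hyc
        refine hyU.2 ⟨insert (σ z) F, ?_, ?_, ?_, ?_⟩
        · exact Finset.insert_subset (hσ z) (hFS.trans (Finset.filter_subset _ _))
        · intro s hs t ht
          rw [Finset.mem_insert] at hs ht
          rcases hs with rfl | hs <;> rcases ht with rfl | ht
          · exact hR _
          · exact hRs _ _ (Finset.mem_filter.1 (hFS ht)).2.1
          · exact (Finset.mem_filter.1 (hFS hs)).2.1
          · exact hFR s hs t ht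
        · intro s hs
          rw [Finset.mem_insert] at hs
          rcases hs with rfl | hs
          · exact ⟨hσε, (hρ1 z y hyb).le⟩
          · exact hF1 s hs
        · intro s hs hsF hst
          rw [Finset.mem_insert, not_or] at hsF
          refine hF2 s ?_ hsF.2 fun t ht => hst t (Finset.mem_insert_of_mem ht)
          exact Finset.mem_filter.2 ⟨hs, hst _ (Finset.mem_insert_self _ _), hsF.1⟩
      have hi := ih (D.erase (dim (σ z))) (by
          rw [Finset.card_erase_of_mem (hS _ (hσ z))]; omega) S' (by
          intro t ht
          obtain ⟨htS, htR, htne⟩ := Finset.mem_filter.1 ht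
          exact Finset.mem_erase.2 ⟨fun h => htne (hdim _ _ htR h), hS t htS⟩)
        (fun t ht => hc t (Finset.mem_filter.1 ht).1) (fun t ht => hg t (Finset.mem_filter.1 ht).1)
        z (ρ z) (hρ0 z) (fun t ht => hρ2 z t (Finset.mem_filter.1 ht).1)
      obtain ⟨y₀, hy₀, hy₀1⟩ := hρ2 z _ (hσ z)
      have hg' := hg _ (hσ z) z (ρ z) y₀ (hρ0 z) hy₀ hy₀1
      refine (measure_mono hsub).trans ((measure_union_le _ _).trans ((add_le_add hi hg').trans ?_))
      have hρz := hρ0 z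
      rw [← ENNReal.ofReal_add (by positivity) (by positivity),
        ← ENNReal.ofReal_mul (by positivity)]
      exact ENNReal.ofReal_le_ofReal (by rw [hA]; nlinarith)
    let q : Besicovitch.BallPackage U ℝ :=
      { c := fun z => z, r := ρ, rpos := hρ0, r_bound := 2 * r, r_le := hρr }
    obtain ⟨s, hsd, hscov⟩ := Besicovitch.exist_disjoint_covering_families hτ hN q
    -- The centres lie in the ball of radius `r` and the radii are at most `2 * r`, whence the
    -- radius `3 * r`.
    have hsum : ∀ i, (s i).Countable ∧
        ∑' j : s i, ENNReal.ofReal (ρ j) ≤ ENNReal.ofReal (3 * r) := by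
      intro i
      refine sum_radius_le_of_disjoint (c := fun z : U => (z : ℝ)) (x := x) hρ0 (hsd i) ?_
      intro j _
      refine Metric.closedBall_subset_closedBall' ?_
      have := j.2.1
      rw [Metric.mem_closedBall] at this
      have := hρr j
      linarith
    have hcov : U ⊆ ⋃ i, ⋃ j ∈ s i, (U ∩ Metric.ball (j : ℝ) (ρ j)) := by
      intro z hz
      have hz' : z ∈ range q.c := ⟨⟨z, hz⟩, rfl⟩
      have := hscov hz'
      simp only [mem_iUnion] at this ⊢
      obtain ⟨i, j, hj, hzj⟩ := this
      exact ⟨i, j, hj, hz, hzj⟩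
    refine (measure_mono hcov).trans ?_
    refine (measure_iUnion_le _).trans ?_
    have hi : ∀ i, volume (⋃ j ∈ s i, (U ∩ Metric.ball (j : ℝ) (ρ j))) ≤
        ENNReal.ofReal (A * η) * ENNReal.ofReal (3 * r) := by
      intro i
      refine (measure_biUnion_le _ (hsum i).1 _).trans ?_
      refine (ENNReal.tsum_le_tsum fun j : s i => hball j).trans ?_
      rw [ENNReal.tsum_mul_left]
      gcongr
      exact (hsum i).2
    refine (ENNReal.tsum_le_tsum hi).trans ?_
    rw [tsum_fintype, Finset.sum_const, Finset.card_univ, Fintype.card_fin, nsmul_eq_mul,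
      ← ENNReal.ofReal_mul (by positivity), ← ENNReal.ofReal_natCast,
      ← ENNReal.ofReal_mul (by positivity)]
    refine ENNReal.ofReal_le_ofReal ?_
    have hpow : (1 : ℝ) ≤ ((3 * N + 1 : ℕ) : ℝ) ^ n := one_le_pow₀ (by push_cast; linarith [(Nat.cast_nonneg N : (0:ℝ) ≤ N)])
    have hηr : 0 ≤ η * r := by positivity
    have hN0 : (0 : ℝ) ≤ N := Nat.cast_nonneg N
    set B : ℝ := ((3 * N + 1 : ℕ) : ℝ) ^ n with hB
    have hA2 : A ≤ B * (n + 1) := by rw [hA]; nlinarith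
    have e1 : (N : ℝ) * (A * η * (3 * r)) = (3 * N * A) * (η * r) := by ring
    have e2 : ((3 * N + 1 : ℕ) : ℝ) ^ (n + 1) * ((n + 1 : ℕ) : ℝ) * η * r =
        ((3 * N + 1) * (B * (n + 1))) * (η * r) := by
      rw [hB]; push_cast; ring
    rw [e1, e2]
    refine mul_le_mul_of_nonneg_right ?_ hηr
    have : 3 * (N : ℝ) * A ≤ 3 * N * (B * (n + 1)) := by gcongr
    have hBn : 0 ≤ B * (n + 1) := hA0.trans hA2
    linarith

end Nondivergence

/-! ### Maximal minors as a substitute for covolume -/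

section Minors

variable {m n : ℕ}

theorem exists_fin_linearIndependent {ι V : Type*} [Finite ι] [AddCommGroup V] [Module ℝ V]
    (v : ι → V) : ∃ J : Fin (Module.finrank ℝ (Submodule.span ℝ (range v))) → ι,
      Submodule.span ℝ (range (v ∘ J)) = Submodule.span ℝ (range v) ∧
        LinearIndependent ℝ (v ∘ J) := by
  obtain ⟨κ, a, ha, hs, hl⟩ := exists_linearIndependent' ℝ v
  have : Finite κ := Finite.of_injective a ha
  have := Fintype.ofFinite κ
  have hcard : Fintype.card κ = Module.finrank ℝ (Submodule.span ℝ (range v)) := by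
    rw [← hs, finrank_span_eq_card hl]
  let e : Fin (Module.finrank ℝ (Submodule.span ℝ (range v))) ≃ κ :=
    (finCongr hcard.symm).trans (Fintype.equivFin κ).symm
  refine ⟨a ∘ e, ?_, ?_⟩
  · rw [← Function.comp_assoc, e.surjective.range_comp, hs]
  · rw [← Function.comp_assoc]
    exact hl.comp e e.injective

/-- The vector of all maximal minors of the matrix with rows `T (b i)`. -/
noncomputable def minorsVec (T : (Fin n → ℝ) →ₗ[ℝ] (Fin n → ℝ)) (b : Fin m → Fin n → ℝ) :
    (Fin m → Fin n) → ℝ :=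
  fun J => (Matrix.of fun i j => T (b i) (J j)).det

/-- The supremum norm of the vector of all maximal minors. -/
noncomputable def minorNorm (T : (Fin n → ℝ) →ₗ[ℝ] (Fin n → ℝ)) (b : Fin m → Fin n → ℝ) : ℝ :=
  ‖minorsVec T b‖

theorem minorNorm_comb (T : (Fin n → ℝ) →ₗ[ℝ] (Fin n → ℝ)) {b b' : Fin m → Fin n → ℝ}
    (A : Matrix (Fin m) (Fin m) ℝ) (h : ∀ i, ∑ k, A i k • b k = b' i) :
    minorNorm T b' = |A.det| * minorNorm T b := by
  have : minorsVec T b' = A.det • minorsVec T b := by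
    ext J
    rw [Pi.smul_apply, smul_eq_mul, minorsVec, minorsVec, ← Matrix.det_mul]
    congr 1
    ext i j
    simp [← h i, Matrix.mul_apply]
  rw [minorNorm, this, norm_smul, Real.norm_eq_abs, minorNorm]

/-- Laplace expansion along the new row; this plays the role of submultiplicativity of norms of
exterior products. -/
theorem minorNorm_cons_le (T : (Fin n → ℝ) →ₗ[ℝ] (Fin n → ℝ)) (v : Fin n → ℝ)
    (b : Fin m → Fin n → ℝ) :
    minorNorm T (Fin.cons v b : Fin (m + 1) → Fin n → ℝ) ≤ (m + 1) * (‖T v‖ * minorNorm T b) := by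
  refine (pi_norm_le_iff_of_nonneg (by positivity [norm_nonneg (minorsVec T b)])).2 fun J => ?_
  rw [minorsVec, Matrix.det_succ_row_zero, Real.norm_eq_abs]
  refine (Finset.abs_sum_le_sum_abs _ _).trans ?_
  calc _ ≤ ∑ _j : Fin (m + 1), ‖T v‖ * minorNorm T b := by
        refine Finset.sum_le_sum fun j _ => ?_
        rw [abs_mul, abs_mul, abs_pow, abs_neg, abs_one, one_pow, one_mul]
        refine mul_le_mul ?_ ?_ (abs_nonneg _) (norm_nonneg _)
        · simpa using norm_le_pi_norm (T v) (J j)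
        · exact norm_le_pi_norm (minorsVec T b) (J ∘ j.succAbove)
    _ = _ := by simp

/-- Row rank equals column rank, so `m` of the columns are independent. -/
theorem exists_minor_ne_zero {b : Fin m → Fin n → ℝ} (hb : LinearIndependent ℝ b) :
    ∃ J : Fin m → Fin n, (Matrix.of fun i j => b i (J j)).det ≠ 0 := by
  set M : Matrix (Fin m) (Fin n) ℝ := Matrix.of b
  have hr : M.rank = m := by
    have : LinearIndependent ℝ M.row := hb
    simpa using this.rank_matrix
  rw [Matrix.rank_eq_finrank_span_cols] at hr
  obtain ⟨J, -, hJ⟩ := exists_fin_linearIndependent M.col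
  let J' : Fin m → Fin n := J ∘ Fin.cast hr.symm
  have hJ' : LinearIndependent ℝ (M.col ∘ J') := by
    rw [← Function.comp_assoc]
    exact hJ.comp _ (Fin.cast_injective _)
  refine ⟨J', ?_⟩
  have h2 : LinearIndependent ℝ (Matrix.of fun i j => b i (J' j)).col := hJ'
  rw [Matrix.linearIndependent_cols_iff_isUnit, Matrix.isUnit_iff_isUnit_det] at h2
  exact h2.ne_zero

theorem minorNorm_id_pos {b : Fin m → Fin n → ℝ} (hb : LinearIndependent ℝ b) :
    0 < minorNorm LinearMap.id b := by
  obtain ⟨J, hJ⟩ := exists_minor_ne_zero hb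
  refine norm_pos_iff.2 fun h => hJ ?_
  exact congrFun h J

end Minors

/-! ### Chains of subspaces and short vectors -/

section Flags

variable {n : ℕ}

/-- `b` is a tuple of vectors of `V` that is a basis of `W`. -/
structure IsBasisTuple (V : Finset (Fin n → ℝ)) (W : Submodule ℝ (Fin n → ℝ)) {m : ℕ}
    (b : Fin m → Fin n → ℝ) : Prop where
  mem : ∀ i, b i ∈ V
  linearIndependent : LinearIndependent ℝ b
  span_eq : Submodule.span ℝ (range b) = W

theorem IsBasisTuple.finrank_eq {V : Finset (Fin n → ℝ)} {W : Submodule ℝ (Fin n → ℝ)} {m : ℕ}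
    {b : Fin m → Fin n → ℝ} (hb : IsBasisTuple V W b) : m = Module.finrank ℝ W := by
  rw [← hb.span_eq, finrank_span_eq_card hb.linearIndependent, Fintype.card_fin]

/-- The subspaces spanned by subsets of `V`. -/
noncomputable def spanFamily (V : Finset (Fin n → ℝ)) : Finset (Submodule ℝ (Fin n → ℝ)) :=
  open Classical in V.powerset.image fun A : Finset (Fin n → ℝ) => Submodule.span ℝ (A : Set (Fin n → ℝ))

theorem bot_mem_spanFamily (V : Finset (Fin n → ℝ)) : ⊥ ∈ spanFamily V := by
  classical
  exact Finset.mem_image.2 ⟨∅, by simp, by simp⟩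

theorem sup_span_mem_spanFamily {V : Finset (Fin n → ℝ)} {W : Submodule ℝ (Fin n → ℝ)}
    (hW : W ∈ spanFamily V) {v : Fin n → ℝ} (hv : v ∈ V) :
    Submodule.span ℝ {v} ⊔ W ∈ spanFamily V := by
  classical
  obtain ⟨A, hA, rfl⟩ := Finset.mem_image.1 hW
  refine Finset.mem_image.2 ⟨insert v A, ?_, ?_⟩
  · rw [Finset.mem_powerset] at hA ⊢
    exact Finset.insert_subset hv hA
  · rw [Finset.coe_insert, Submodule.span_insert]

theorem exists_isBasisTuple {V : Finset (Fin n → ℝ)} {W : Submodule ℝ (Fin n → ℝ)}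
    (hW : W ∈ spanFamily V) :
    ∃ b : Fin (Module.finrank ℝ W) → Fin n → ℝ, IsBasisTuple V W b := by
  classical
  obtain ⟨A, hA, rfl⟩ := Finset.mem_image.1 hW
  obtain ⟨J, hJ, hl⟩ := exists_fin_linearIndependent (fun a : A => (a : Fin n → ℝ))
  have hr : range (fun a : A => (a : Fin n → ℝ)) = (A : Set (Fin n → ℝ)) := Subtype.range_coe
  replace hJ := hJ.trans (congrArg (Submodule.span ℝ) hr)
  have hc : Module.finrank ℝ (Submodule.span ℝ (A : Set (Fin n → ℝ))) =
      Module.finrank ℝ (Submodule.span ℝ (range fun a : A => (a : Fin n → ℝ))) := by rw [hr]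
  refine ⟨(fun a : A => (a : Fin n → ℝ)) ∘ J ∘ Fin.cast hc, ?_, ?_, ?_⟩
  · intro i
    exact Finset.mem_powerset.1 hA (J (Fin.cast hc i)).2
  · rw [← Function.comp_assoc]
    exact hl.comp _ (Fin.cast_injective _)
  · refine Eq.trans ?_ hJ
    rw [← Function.comp_assoc]
    exact congrArg (Submodule.span ℝ) ((finCongr hc).surjective.range_comp _)

/-- A change of basis multiplies the minor norm by `|det|` for every `T` alike. A tuple that is
minimal for the identity is therefore minimal for all `T` at once, and can replace a lattice basis
of `W`. -/
theorem exists_minimal_isBasisTuple {V : Finset (Fin n → ℝ)} {W : Submodule ℝ (Fin n → ℝ)}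
    (hW : W ∈ spanFamily V) :
    ∃ b : Fin (Module.finrank ℝ W) → Fin n → ℝ, IsBasisTuple V W b ∧
      ∀ (T : (Fin n → ℝ) →ₗ[ℝ] (Fin n → ℝ)) (m : ℕ) (b' : Fin m → Fin n → ℝ),
        IsBasisTuple V W b' → minorNorm T b ≤ minorNorm T b' := by
  classical
  have hfin : {b : Fin (Module.finrank ℝ W) → Fin n → ℝ | IsBasisTuple V W b}.Finite := by
    refine Set.Finite.subset (Finset.finite_toSet (Fintype.piFinset fun _ => V)) ?_
    intro b hb
    rw [SetLike.mem_coe, Fintype.mem_piFinset]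
    exact hb.mem
  obtain ⟨b, hb, hmin⟩ := Set.exists_min_image _ (fun b => minorNorm LinearMap.id b) hfin
    (exists_isBasisTuple hW)
  refine ⟨b, hb, ?_⟩
  intro T m b' hb'
  have hm := hb'.finrank_eq
  subst hm
  have hA : ∀ i, ∃ c : Fin (Module.finrank ℝ W) → ℝ, ∑ k, c k • b k = b' i := by
    intro i
    refine (Submodule.mem_span_range_iff_exists_fun ℝ).1 ?_
    rw [hb.span_eq, ← hb'.span_eq]
    exact Submodule.subset_span (mem_range_self i)
  choose A hA using hA
  rw [minorNorm_comb T (Matrix.of A) hA]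
  have h1 := hmin b' hb'
  simp only [minorNorm_comb LinearMap.id (Matrix.of A) hA] at h1
  have h2 := minorNorm_id_pos hb.linearIndependent
  have h3 : 1 ≤ |(Matrix.of A).det| := by
    by_contra! h
    nlinarith
  exact le_mul_of_one_le_left (norm_nonneg _) h3

/-- If `x` is marked then no vector of `V` is contracted too much. -/
theorem le_norm_of_isMarked {V : Finset (Fin n → ℝ)} {T : ℝ → (Fin n → ℝ) →ₗ[ℝ] (Fin n → ℝ)}
    {ψ : Submodule ℝ (Fin n → ℝ) → ℝ → ℝ} (hbot : ∀ x, ψ ⊥ x = 1)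
    (hψ : ∀ W ∈ spanFamily V, ∀ v ∈ V, v ∉ W → ∀ x,
      ψ (Submodule.span ℝ {v} ⊔ W) x ≤ n * (‖T x v‖ * ψ W x))
    {ε x : ℝ} (hε : ε ≤ 1)
    (hx : IsMarked (fun W W' => W ≤ W' ∨ W' ≤ W) ψ ε (spanFamily V) x) {v : Fin n → ℝ}
    (hv : v ∈ V) (hv0 : v ≠ 0) : ε ≤ n * ‖T x v‖ := by
  classical
  obtain ⟨F, hFS, hFR, hF1, hF2⟩ := hx
  -- `W` is the last member of the chain, with `⊥` adjoined, that misses `v`. Then `span v ⊔ W` is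
  -- comparable to all of `F`, so marking bounds its `ψ` below by `ε`, while `ψ W x ≤ 1` bounds it
  -- above by `n * ‖T x v‖`.
  obtain ⟨W, hW, hWmax⟩ := (insert ⊥ (F.filter fun W => v ∉ W)).exists_maximal
    ⟨⊥, Finset.mem_insert_self _ _⟩
  have hW' : W = ⊥ ∨ W ∈ F := by
    rcases Finset.mem_insert.1 hW with h | h
    · exact Or.inl h
    · exact Or.inr (Finset.mem_filter.1 h).1
  have hvW : v ∉ W := by
    rcases Finset.mem_insert.1 hW with rfl | h
    · simpa using hv0
    · exact (Finset.mem_filter.1 h).2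
  have hWS : W ∈ spanFamily V := by
    rcases hW' with rfl | h
    · exact bot_mem_spanFamily V
    · exact hFS h
  have hψW : ψ W x ≤ 1 := by
    rcases hW' with rfl | h
    · rw [hbot]
    · exact (hF1 W h).2
  have hcompW : ∀ U ∈ F, W ≤ U ∨ U ≤ W := by
    intro U hU
    rcases hW' with rfl | h
    · exact Or.inl bot_le
    · exact hFR W h U hU
  have hbound : ψ (Submodule.span ℝ {v} ⊔ W) x ≤ n * ‖T x v‖ := by
    refine (hψ W hWS v hv hvW x).trans ?_
    gcongr
    exact mul_le_of_le_one_right (norm_nonneg _) hψW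
  refine le_trans ?_ hbound
  by_cases hmem : Submodule.span ℝ {v} ⊔ W ∈ F
  · exact (hF1 _ hmem).1
  · refine hε.trans (hF2 _ (sup_span_mem_spanFamily hWS hv) hmem ?_)
    intro U hU
    by_cases hvU : v ∈ U
    · left
      refine sup_le ((Submodule.span_singleton_le_iff_mem v U).2 hvU) ?_
      rcases hcompW U hU with h | h
      · exact h
      · exact absurd (h hvU) hvW
    · right
      refine le_trans ?_ le_sup_right
      rcases hcompW U hU with h | h
      · exact hWmax (Finset.mem_insert_of_mem (Finset.mem_filter.2 ⟨hU, hvU⟩)) h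
      · exact h

end Flags

/-! ### The Veronese curve -/

section Curve

variable {d m : ℕ}

/-- The linear map `y ↦ (Q ^ d * ∑ yᵢ xⁱ, y₁ / Q, …, y_d / Q)`. -/
noncomputable def curveMap (d : ℕ) (Q x : ℝ) : (Fin (d + 1) → ℝ) →ₗ[ℝ] (Fin (d + 1) → ℝ) where
  toFun y := Fin.cons (Q ^ d * ∑ i, y i * x ^ (i : ℕ)) fun i : Fin d => y i.succ * Q⁻¹
  map_add' y z := by
    ext i
    refine Fin.cases ?_ (fun i => ?_) i
    · simp [add_mul, Finset.sum_add_distrib, mul_add]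
    · simp [add_mul]
  map_smul' c y := by
    ext i
    refine Fin.cases ?_ (fun i => ?_) i
    · simp only [Fin.cons_zero, Pi.smul_apply, smul_eq_mul, RingHom.id_apply, mul_assoc,
        ← Finset.mul_sum]
      ring
    · simp [mul_assoc]

theorem curveMap_zero (Q x : ℝ) (y : Fin (d + 1) → ℝ) :
    curveMap d Q x y 0 = Q ^ d * ∑ i, y i * x ^ (i : ℕ) := rfl

theorem curveMap_succ (Q x : ℝ) (y : Fin (d + 1) → ℝ) (i : Fin d) :
    curveMap d Q x y i.succ = y i.succ * Q⁻¹ := rfl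

theorem curveMap_of_ne_zero (Q x : ℝ) (y : Fin (d + 1) → ℝ) {i : Fin (d + 1)} (hi : i ≠ 0) :
    curveMap d Q x y i = y i * Q⁻¹ := by
  obtain ⟨j, rfl⟩ := Fin.exists_succ_eq.2 hi
  rfl

theorem exists_polynomial_minorsVec (Q : ℝ) (b : Fin m → Fin (d + 1) → ℝ)
    (J : Fin m → Fin (d + 1)) :
    ∃ p : ℝ[X], p.natDegree ≤ m * d ∧ ∀ x, minorsVec (curveMap d Q x) b J = p.eval x := by
  let P : Fin m → Fin (d + 1) → ℝ[X] := fun i => Fin.cons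
    (C (Q ^ d) * ∑ l, C (b i l) * X ^ (l : ℕ)) fun k : Fin d => C (b i k.succ * Q⁻¹)
  have hP : ∀ i c x, (P i c).eval x = curveMap d Q x (b i) c := by
    intro i c x
    refine Fin.cases ?_ (fun k => ?_) c
    · simp [P, curveMap_zero, eval_finsetSum]
    · simp [P, curveMap_succ]
  have hd : ∀ i c, (P i c).natDegree ≤ d := by
    intro i c
    refine Fin.cases ?_ (fun k => ?_) c
    · simp only [P, Fin.cons_zero]
      refine (natDegree_C_mul_le _ _).trans (natDegree_sum_le_of_forall_le _ _ fun l _ => ?_)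
      exact (natDegree_C_mul_X_pow_le _ _).trans (by omega)
    · simp only [P, Fin.cons_succ, natDegree_C, zero_le]
  refine ⟨(Matrix.of fun i j => P i (J j)).det, ?_, ?_⟩
  · rw [Matrix.det_apply]
    refine natDegree_sum_le_of_forall_le _ _ fun σ _ => ?_
    refine (natDegree_smul_le _ _).trans ((natDegree_prod_le _ _).trans ?_)
    refine (Finset.sum_le_sum fun i _ => hd _ _).trans ?_
    simp
  · intro x
    rw [minorsVec, ← coe_evalRingHom, RingHom.map_det]
    congr 1
    ext i j
    simp [hP]

theorem continuous_minorNorm_curveMap (Q : ℝ) (b : Fin m → Fin (d + 1) → ℝ) :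
    Continuous fun x => minorNorm (curveMap d Q x) b := by
  refine Continuous.norm (continuous_pi fun J => ?_)
  obtain ⟨p, -, hp⟩ := exists_polynomial_minorsVec Q b J
  simp only [hp]
  exact p.continuous

/-- A single minor already reaches 1 at `y₀`; it is a polynomial in `x`, and its sublevel set
contains that of the sup norm. -/
theorem isGoodAt_minorNorm {ε η Q : ℝ} {N : ℕ} (hN : m * d ≤ N)
    (hg : ∀ p : ℝ[X], p.natDegree ≤ N → IsGoodAt ε η (fun y => |p.eval y|))
    (b : Fin m → Fin (d + 1) → ℝ) :
    IsGoodAt ε η fun x => minorNorm (curveMap d Q x) b := by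
  intro x r y₀ hr hy₀ h1
  obtain ⟨J, hJ⟩ : ∃ J, 1 ≤ ‖minorsVec (curveMap d Q y₀) b J‖ := by
    by_contra! h
    exact absurd ((pi_norm_lt_iff one_pos).2 h) (not_lt.2 h1)
  obtain ⟨p, hpd, hp⟩ := exists_polynomial_minorsVec Q b J
  rw [hp, Real.norm_eq_abs] at hJ
  refine le_trans (MeasureTheory.measure_mono ?_) (hg p (hpd.trans hN) x r y₀ hr hy₀ hJ)
  rintro y ⟨hy, hyε⟩
  refine ⟨hy, lt_of_le_of_lt ?_ hyε⟩
  simp only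
  rw [← Real.norm_eq_abs, ← hp]
  exact norm_le_pi_norm (minorsVec (curveMap d Q y) b) J

/-- Putting column 0 in place `j₀` makes the minor a polynomial in `x` whose coefficients are minors
of `b`, hence integers when `b` is integral. -/
theorem minorsVec_curveMap_update (Q x : ℝ) (b : Fin (m + 1) → Fin (d + 1) → ℝ)
    (J : Fin (m + 1) → Fin (d + 1)) (j₀ : Fin (m + 1)) (hJ : ∀ j, j ≠ j₀ → J j ≠ 0) :
    minorsVec (curveMap d Q x) b (Function.update J j₀ 0) = (Q ^ d * Q⁻¹ ^ m) *
      ∑ l, Matrix.cramer (Matrix.of fun i j => b i (J j)) (fun i => b i l) j₀ * x ^ (l : ℕ) := by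
  set B : Matrix (Fin (m + 1)) (Fin (m + 1)) ℝ := Matrix.of fun i j => b i (J j) with hB
  have h1 : (Matrix.of fun i j => curveMap d Q x (b i) (Function.update J j₀ 0 j)) =
      Matrix.of fun i j => (Function.update (fun _ => Q⁻¹) j₀ (Q ^ d) : Fin (m + 1) → ℝ) j *
        (B.updateCol j₀ fun i => ∑ l, b i l * x ^ (l : ℕ)) i j := by
    ext i j
    simp only [Matrix.of_apply, Matrix.updateCol_apply, Function.update_apply]
    split_ifs with h
    · rw [curveMap_zero]
    · rw [curveMap_of_ne_zero _ _ _ (hJ j h), mul_comm, hB, Matrix.of_apply]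
  rw [minorsVec, h1, Matrix.det_mul_row, ← Matrix.cramer_apply]
  congr 1
  · rw [Finset.prod_update_of_mem (Finset.mem_univ _)]
    simp [Finset.card_sdiff]
  · have : (fun i => ∑ l, b i l * x ^ (l : ℕ)) =
        ∑ l : Fin (d + 1), x ^ (l : ℕ) • fun i => b i l := by
      ext i
      simp [Finset.sum_apply, mul_comm]
    rw [this, map_sum, Finset.sum_apply]
    refine Finset.sum_congr rfl fun l _ => ?_
    rw [map_smul, Pi.smul_apply, smul_eq_mul, mul_comm]

/-- Inverting the Vandermonde matrix of `d + 1` nodes in the ball bounds all coefficients by the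
values at the nodes. -/
theorem exists_le_abs_sum_of_one_le_coeff (d : ℕ) {r : ℝ} (x : ℝ) (hr : 0 < r) :
    ∃ c : ℝ, 0 < c ∧ ∀ q : Fin (d + 1) → ℝ, (∃ l, 1 ≤ |q l|) →
      ∃ y ∈ Metric.closedBall x r, c ≤ |∑ l, q l * y ^ (l : ℕ)| := by
  set t : Fin (d + 1) → ℝ := fun k => x + r * (k / (d + 1)) with ht
  have hinj : Function.Injective t := by
    intro k l hkl
    have hd : (d : ℝ) + 1 ≠ 0 := by positivity
    simp only [ht, add_right_inj, mul_right_inj' hr.ne', div_left_inj' hd, Nat.cast_inj] at hkl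
    exact Fin.ext hkl
  have htm : ∀ k, t k ∈ Metric.closedBall x r := by
    intro k
    rw [Metric.mem_closedBall, Real.dist_eq, ht]
    simp only [add_sub_cancel_left]
    rw [abs_of_nonneg (by positivity)]
    refine mul_le_of_le_one_right hr.le ?_
    rw [div_le_one (by positivity)]
    exact_mod_cast (Nat.lt_succ_iff.1 (k.2.trans_le (Nat.le_succ _)))
  set Vm : Matrix (Fin (d + 1)) (Fin (d + 1)) ℝ := Matrix.vandermonde t
  have hdet : IsUnit Vm.det := (Matrix.det_vandermonde_ne_zero_iff.2 hinj).isUnit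
  set A : ℝ := ∑ l, ∑ k, |Vm⁻¹ l k| + 1 with hA
  have hA1 : 0 < A := by positivity
  refine ⟨1 / A, by positivity, ?_⟩
  rintro q ⟨l, hl⟩
  by_contra! h
  have hq : q = Vm⁻¹.mulVec (Vm.mulVec q) := by
    rw [Matrix.mulVec_mulVec, Matrix.nonsing_inv_mul _ hdet, Matrix.one_mulVec]
  have hval : ∀ k, |Vm.mulVec q k| ≤ 1 / A := by
    intro k
    refine le_of_eq_of_le ?_ (h (t k) (htm k)).le
    simp [Vm, Matrix.mulVec, dotProduct, Matrix.vandermonde_apply, mul_comm]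
  have : |q l| ≤ (∑ k, |Vm⁻¹ l k|) * (1 / A) := by
    rw [hq, Matrix.mulVec, dotProduct, Finset.sum_mul]
    refine (Finset.abs_sum_le_sum_abs _ _).trans (Finset.sum_le_sum fun k _ => ?_)
    rw [abs_mul]
    exact mul_le_mul_of_nonneg_left (hval k) (abs_nonneg _)
  have h2 : ∑ k, |Vm⁻¹ l k| < A := by
    rw [hA]
    have := Finset.single_le_sum (f := fun l => ∑ k, |Vm⁻¹ l k|) (fun i _ => by positivity)
      (Finset.mem_univ l)
    linarith
  have h3 : (∑ k, |Vm⁻¹ l k|) * (1 / A) < 1 := by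
    rw [mul_one_div, div_lt_one hA1]; exact h2
  linarith

/-- Supplies the points where each `ψ` reaches 1, with a threshold `Q₀` that does not depend on the
subspace. Integrality gives a coefficient of absolute value at least 1 in a suitable minor. -/
theorem exists_one_le_minorNorm_curveMap (d : ℕ) {r : ℝ} (x : ℝ) (hr : 0 < r) :
    ∃ Q₀ : ℝ, 1 ≤ Q₀ ∧ ∀ Q, Q₀ ≤ Q → ∀ (m : ℕ) (b : Fin m → Fin (d + 1) → ℤ),
      LinearIndependent ℝ (fun i j => (b i j : ℝ)) →
      ∃ y ∈ Metric.closedBall x r, 1 ≤ minorNorm (curveMap d Q y) fun i j => (b i j : ℝ) := by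
  obtain ⟨c, hc, hpoly⟩ := exists_le_abs_sum_of_one_le_coeff d x hr
  refine ⟨max 1 (1 / c), le_max_left _ _, ?_⟩
  intro Q hQ m b hb
  have hQ1 : 1 ≤ Q := (le_max_left _ _).trans hQ
  have hQc : 1 ≤ Q * c := by
    have := (le_max_right _ _).trans hQ
    rwa [div_le_iff₀ hc] at this
  have hxm : x ∈ Metric.closedBall x r := Metric.mem_closedBall_self hr.le
  rcases m with _ | m
  · refine ⟨x, hxm, le_trans ?_ (norm_le_pi_norm _ (fun i => i.elim0))⟩
    simp [minorsVec]
  obtain ⟨J, hJ⟩ := exists_minor_ne_zero hb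
  have hJinj : Function.Injective J := by
    intro i j hij
    by_contra hne
    exact hJ (Matrix.det_zero_of_column_eq hne fun k => by simp [hij])
  obtain ⟨j₀, hj₀⟩ : ∃ j₀, ∀ j, j ≠ j₀ → J j ≠ 0 := by
    by_cases h : ∃ j, J j = 0
    · obtain ⟨j₀, h0⟩ := h
      exact ⟨j₀, fun j hj h => hj (hJinj (h.trans h0.symm))⟩
    · push Not at h
      exact ⟨0, fun j _ => h j⟩
  set b' : Fin (m + 1) → Fin (d + 1) → ℝ := fun i j => (b i j : ℝ) with hb'
  set q : Fin (d + 1) → ℝ :=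
    fun l => Matrix.cramer (Matrix.of fun i j => b' i (J j)) (fun i => b' i l) j₀ with hq
  have hint : ∀ l, ∃ z : ℤ, q l = z := by
    intro l
    refine ⟨Matrix.cramer (Matrix.of fun i j => b i (J j)) (fun i => b i l) j₀, ?_⟩
    simp only [hq, Matrix.cramer_apply]
    rw [← eq_intCast (Int.castRingHom ℝ), RingHom.map_det]
    congr 1
    ext i j
    simp only [Matrix.updateCol_apply, Matrix.of_apply, RingHom.mapMatrix_apply, Matrix.map_apply,
      hb']
    split_ifs <;> simp
  have hne : q (J j₀) ≠ 0 := by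
    simp only [hq, Matrix.cramer_apply]
    convert hJ using 2
    ext i j
    simp only [Matrix.updateCol_apply, Matrix.of_apply]
    split_ifs with h
    · rw [h]
    · rfl
  have hone : 1 ≤ |q (J j₀)| := by
    obtain ⟨z, hz⟩ := hint (J j₀)
    rw [hz] at hne ⊢
    have : z ≠ 0 := by exact_mod_cast hne
    exact_mod_cast Int.one_le_abs this
  have key : ∀ y, (Q ^ d * Q⁻¹ ^ m) * |∑ l, q l * y ^ (l : ℕ)| ≤ minorNorm (curveMap d Q y) b' := by
    intro y
    have h1 := norm_le_pi_norm (minorsVec (curveMap d Q y) b') (Function.update J j₀ 0)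
    rw [minorsVec_curveMap_update Q y b' J j₀ hj₀, norm_mul, Real.norm_eq_abs, Real.norm_eq_abs,
      abs_of_nonneg (by positivity)] at h1
    exact h1
  have hmd : m ≤ d := by
    have := Fintype.card_le_of_injective J hJinj
    simpa using this
  -- Below full rank the factor `Q ^ (d - m)` is at least `Q` and absorbs the small constant `c`. In
  -- full rank the factor is 1, but all nonconstant coefficients vanish and the minor is a nonzero
  -- integer.
  rcases hmd.lt_or_eq with hlt | rfl
  · obtain ⟨y, hy, hcy⟩ := hpoly q ⟨_, hone⟩
    refine ⟨y, hy, le_trans ?_ (key y)⟩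
    have h1 : Q ≤ Q ^ d * Q⁻¹ ^ m := by
      rw [inv_pow, ← pow_sub₀ _ (by positivity) hlt.le]
      exact le_self_pow₀ hQ1 (by omega)
    calc 1 ≤ Q * c := hQc
      _ ≤ _ := mul_le_mul h1 hcy hc.le (by positivity)
  · refine ⟨x, hxm, le_trans ?_ (key x)⟩
    have hbij : Function.Bijective J := (Fintype.bijective_iff_injective_and_card J).2 ⟨hJinj, rfl⟩
    have hJ0 : J j₀ = 0 := by
      obtain ⟨j, hj⟩ := hbij.2 0
      by_cases h : j = j₀
      · rw [← h, hj]
      · exact absurd hj (hj₀ j h)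
    have hzero : ∀ l, l ≠ 0 → q l = 0 := by
      intro l hl
      obtain ⟨j, rfl⟩ := hbij.2 l
      have hjj : j ≠ j₀ := fun h => hl (by rw [h, hJ0])
      simp only [hq, Matrix.cramer_apply]
      refine Matrix.det_zero_of_column_eq hjj fun k => ?_
      simp [hjj]
    rw [Finset.sum_eq_single 0 (fun l _ hl => by rw [hzero l hl, zero_mul]) (by simp), inv_pow,
      mul_inv_cancel₀ (by positivity), one_mul]
    rw [hJ0] at hone
    simpa using hone

end Curve

/-! ### Nondivergence along the Veronese curve -/

section CurveNondivergence

open MeasureTheory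

variable {d : ℕ}

/-- The vector with real entries underlying an integer vector. -/
def castVec {n : ℕ} (v : Fin n → ℤ) : Fin n → ℝ := fun i => v i

theorem castVec_eq_zero {n : ℕ} {v : Fin n → ℤ} : castVec v = 0 ↔ v = 0 := by
  simp [funext_iff, castVec]

/-- Quantitative nondivergence for a finite set of integer vectors. -/
theorem exists_volume_finset_le (d : ℕ) {κ : ℝ} (hκ : 0 < κ) :
    ∃ ε : ℝ, 0 < ε ∧ ∀ x r : ℝ, 0 < r → ∃ Q₀ : ℝ, 1 ≤ Q₀ ∧ ∀ Q, Q₀ ≤ Q →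
      ∀ A : Finset (Fin (d + 1) → ℤ),
        volume {y | y ∈ Metric.closedBall x r ∧
          ∃ v ∈ A, v ≠ 0 ∧ ‖curveMap d Q y (castVec v)‖ < ε} ≤ ENNReal.ofReal (κ * r) := by
  classical
  obtain ⟨M, hM⟩ := exists_volume_unmarked_le
  -- Subspaces of a space of dimension `d + 1` have `d + 2` possible dimensions.
  set c : ℝ := ((M + 1 : ℕ) : ℝ) ^ (d + 2) * ((d + 2 : ℕ) : ℝ) with hc
  have hc0 : 0 < c := by positivity
  obtain ⟨ε, hε0, hε1, hg⟩ := exists_isGoodAt_polynomial ((d + 1) * d) (div_pos hκ hc0)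
  refine ⟨ε / (d + 1), by positivity, ?_⟩
  intro x r hr
  obtain ⟨Q₀, hQ₀, hlow⟩ := exists_one_le_minorNorm_curveMap d x hr
  refine ⟨Q₀, hQ₀, ?_⟩
  intro Q hQ A
  set V : Finset (Fin (d + 1) → ℝ) := A.image castVec with hV
  have hbas : ∀ W : Submodule ℝ (Fin (d + 1) → ℝ), ∃ b : Fin (Module.finrank ℝ W) →
      Fin (d + 1) → ℝ, W ∈ spanFamily V → (IsBasisTuple V W b ∧
      ∀ (T : (Fin (d + 1) → ℝ) →ₗ[ℝ] (Fin (d + 1) → ℝ)) (m : ℕ) (b' : Fin m → Fin (d + 1) → ℝ),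
        IsBasisTuple V W b' → minorNorm T b ≤ minorNorm T b') := by
    intro W
    by_cases hW : W ∈ spanFamily V
    · obtain ⟨b, hb⟩ := exists_minimal_isBasisTuple hW
      exact ⟨b, fun _ => hb⟩
    · exact ⟨fun _ => 0, fun h => absurd h hW⟩
  choose b hb using hbas
  set ψ : Submodule ℝ (Fin (d + 1) → ℝ) → ℝ → ℝ :=
    fun W y => minorNorm (curveMap d Q y) (b W) with hψ
  have hdim : ∀ W : Submodule ℝ (Fin (d + 1) → ℝ), Module.finrank ℝ W ≤ d + 1 := by
    intro W
    simpa using Submodule.finrank_le W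
  have hone : ∀ W ∈ spanFamily V, ∃ y ∈ Metric.closedBall x r, 1 ≤ ψ W y := by
    intro W hW
    have hbW := (hb W hW).1
    have : ∀ i, ∃ v : Fin (d + 1) → ℤ, castVec v = b W i := by
      intro i
      obtain ⟨v, -, hv⟩ := Finset.mem_image.1 (hbW.mem i)
      exact ⟨v, hv⟩
    choose v hv using this
    have hbv : b W = fun i j => (v i j : ℝ) := by
      ext i j
      rw [← hv i]; rfl
    have hli := hbW.linearIndependent
    rw [hbv] at hli
    obtain ⟨y, hy, h⟩ := hlow Q hQ _ v hli
    exact ⟨y, hy, by simp only [hψ]; rw [hbv]; exact h⟩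
  have hη : 0 ≤ κ / c := by positivity
  have main := hM (α := Submodule ℝ (Fin (d + 1) → ℝ)) (fun W W' => W ≤ W' ∨ W' ≤ W)
    (fun _ => Or.inl le_rfl) (fun _ _ => Or.symm) (fun W => Module.finrank ℝ W)
    (fun W W' h hd => h.elim (fun h => Submodule.eq_of_le_of_finrank_eq h hd)
      (fun h => (Submodule.eq_of_le_of_finrank_eq h hd.symm).symm)) ψ ε (κ / c) hη hε1 (d + 2)
    (Finset.range (d + 2)) (by simp) (spanFamily V)
    (fun W _ => Finset.mem_range.2 (Nat.lt_succ_of_le (hdim W)))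
    (fun W _ => continuous_minorNorm_curveMap Q (b W))
    (fun W _ => isGoodAt_minorNorm (Nat.mul_le_mul_right d (hdim W)) hg (b W)) x r hr hone
  refine (measure_mono ?_).trans (main.trans (ENNReal.ofReal_le_ofReal ?_))
  · rintro y ⟨hy, v, hvA, hv0, hvε⟩
    refine ⟨hy, fun hmark => ?_⟩
    have hbot : ∀ y, ψ ⊥ y = 1 := by
      intro y
      have h0 : Module.finrank ℝ (⊥ : Submodule ℝ (Fin (d + 1) → ℝ)) = 0 := finrank_bot ℝ _
      have : IsEmpty (Fin (Module.finrank ℝ (⊥ : Submodule ℝ (Fin (d + 1) → ℝ)))) := by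
        rw [h0]; infer_instance
      have : minorsVec (curveMap d Q y) (b ⊥) = fun _ => 1 := by
        ext J
        rw [minorsVec, Matrix.det_isEmpty]
      simp only [hψ, minorNorm]
      rw [this, pi_norm_const, norm_one]
    have hsub : ∀ W ∈ spanFamily V, ∀ v ∈ V, v ∉ W → ∀ y,
        ψ (Submodule.span ℝ {v} ⊔ W) y ≤ ((d + 1 : ℕ) : ℝ) * (‖curveMap d Q y v‖ * ψ W y) := by
      intro W hW v hv hvW y
      have hbW := (hb W hW).1
      have hcons : IsBasisTuple V (Submodule.span ℝ {v} ⊔ W)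
          (Fin.cons v (b W) : Fin (Module.finrank ℝ W + 1) → Fin (d + 1) → ℝ) := by
        refine ⟨fun i => Fin.cases hv hbW.mem i, ?_, ?_⟩
        · rw [linearIndependent_finCons, hbW.span_eq]
          exact ⟨hbW.linearIndependent, hvW⟩
        · rw [Fin.range_cons, Submodule.span_insert, hbW.span_eq]
      refine ((hb _ (sup_span_mem_spanFamily hW hv)).2 _ _ _ hcons).trans ?_
      refine (minorNorm_cons_le _ _ _).trans ?_
      refine mul_le_mul_of_nonneg_right ?_ (mul_nonneg (norm_nonneg _) (norm_nonneg _))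
      have := hcons.finrank_eq.trans_le (hdim _)
      exact_mod_cast this
    have hfin := le_norm_of_isMarked hbot hsub hε1 hmark (Finset.mem_image_of_mem castVec hvA)
      (fun h => hv0 (castVec_eq_zero.1 h))
    rw [lt_div_iff₀ (by positivity)] at hvε
    push_cast at hfin
    linarith
  · rw [hc]
    apply le_of_eq
    field_simp

/-- Quantitative nondivergence for the Veronese curve. -/
theorem exists_volume_small_vector_le (d : ℕ) {κ : ℝ} (hκ : 0 < κ) :
    ∃ ε : ℝ, 0 < ε ∧ ∀ x r : ℝ, 0 < r → ∃ Q₀ : ℝ, 1 ≤ Q₀ ∧ ∀ Q, Q₀ ≤ Q →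
        volume {y | y ∈ Metric.closedBall x r ∧
          ∃ v : Fin (d + 1) → ℤ, v ≠ 0 ∧ ‖curveMap d Q y (castVec v)‖ < ε} ≤
            ENNReal.ofReal (κ * r) := by
  classical
  obtain ⟨ε, hε, h⟩ := exists_volume_finset_le d hκ
  refine ⟨ε, hε, fun x r hr => ?_⟩
  obtain ⟨Q₀, hQ₀, h⟩ := h x r hr
  refine ⟨Q₀, hQ₀, fun Q hQ => ?_⟩
  -- The bound is uniform in the finite set `A`, so it survives the directed union over all `A`.
  set s : Finset (Fin (d + 1) → ℤ) → Set ℝ := fun A => {y | y ∈ Metric.closedBall x r ∧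
          ∃ v ∈ A, v ≠ 0 ∧ ‖curveMap d Q y (castVec v)‖ < ε}
  have hs : Monotone s := by
    rintro A B hAB y ⟨hy, v, hv, hv'⟩
    exact ⟨hy, v, hAB hv, hv'⟩
  have : {y | y ∈ Metric.closedBall x r ∧
          ∃ v : Fin (d + 1) → ℤ, v ≠ 0 ∧ ‖curveMap d Q y (castVec v)‖ < ε} ⊆ ⋃ A, s A := by
    rintro y ⟨hy, v, hv⟩
    exact mem_iUnion.2 ⟨{v}, hy, v, by simp, hv⟩
  refine (measure_mono this).trans ?_
  rw [hs.measure_iUnion]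
  exact iSup_le fun A => h Q hQ A

end CurveNondivergence

/-! ### Integer polynomials with large derivative -/

section Pigeonhole

/-- If no nonzero integer vector is contracted by `curveMap`, then some integer polynomial with
small value at `x` and bounded coefficients has a large derivative at `x`. -/
theorem exists_vector_of_forall_le_norm {d : ℕ} (hd : 1 ≤ d) {ε : ℝ} (hε : 0 < ε) :
    ∃ K : ℕ, 1 ≤ K ∧ ∀ Q : ℕ, 1 ≤ Q → ∀ x ∈ Icc (0 : ℝ) 1,
      (∀ v : Fin (d + 1) → ℤ, v ≠ 0 → ε ≤ ‖curveMap d Q x (castVec v)‖) →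
      ∃ v : Fin (d + 1) → ℤ, |∑ i, (v i : ℝ) * x ^ (i : ℕ)| * (Q : ℝ) ^ d ≤ K ∧
        (∀ i, i ≠ 0 → |(v i : ℝ)| ≤ K * Q) ∧
        (Q : ℝ) ≤ |∑ i : Fin (d + 1), (i : ℝ) * (v i : ℝ) * x ^ ((i : ℕ) - 1)| := by
  classical
  obtain ⟨e, rfl⟩ : ∃ e, d = e + 1 := ⟨d - 1, by omega⟩
  obtain ⟨L, hL⟩ := exists_nat_gt (((e + 1 : ℝ) * (e + 1) + 1) / ε)
  have hL0 : (0 : ℝ) < L := lt_trans (by positivity) hL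
  have hL1 : 1 ≤ L := by exact_mod_cast hL0
  have hLε : ((e + 1 : ℝ) * (e + 1) + 1) / L < ε := by
    rw [div_lt_iff₀ hε] at hL
    rw [div_lt_iff₀ hL0]; linarith
  -- `K` has to beat the number of cells in the second pigeonhole, which grows only like `K ^ e`,
  -- against more than `K ^ (e + 1)` vectors.
  set K : ℕ := (2 * L + 1) ^ 2 * (3 * L) ^ e + 1 with hK
  have hK1 : 1 ≤ K := by omega
  have hcardK : (2 * L + 1) * ((2 * L + 1) * (2 * (K * L) + 1) ^ e) < K ^ (e + 1) := by
    have h1 : 2 * (K * L) + 1 ≤ K * (3 * L) := by nlinarith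
    calc (2 * L + 1) * ((2 * L + 1) * (2 * (K * L) + 1) ^ e)
        ≤ (2 * L + 1) * ((2 * L + 1) * (K * (3 * L)) ^ e) := by gcongr
      _ = ((2 * L + 1) ^ 2 * (3 * L) ^ e) * K ^ e := by rw [mul_pow]; ring
      _ < K * K ^ e := Nat.mul_lt_mul_of_pos_right (by omega) (by positivity)
      _ = K ^ (e + 1) := by ring
  refine ⟨K, hK1, ?_⟩
  intro Q hQ x hx hsmall
  have hQ0 : (0 : ℝ) < Q := by exact_mod_cast hQ
  by_contra! hcon
  set val : (Fin (e + 1) → ℤ) → ℝ := fun w => ∑ i, (w i : ℝ) * x ^ ((i : ℕ) + 1) with hval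
  set der : (Fin (e + 1) → ℤ) → ℝ := fun w => ∑ i : Fin (e + 1), ((i : ℝ) + 1) * (w i : ℝ) * x ^ (i : ℕ)
    with hder
  -- With this constant coefficient the polynomial takes the fractional part of `val w` as its value
  -- at `x`.
  set full : (Fin (e + 1) → ℤ) → (Fin (e + 2) → ℤ) := fun w => Fin.cons (-⌊val w⌋) w with hfull
  have hfull_val : ∀ w w', ∑ i, (((full w - full w') i : ℤ) : ℝ) * x ^ (i : ℕ) =
      Int.fract (val w) - Int.fract (val w') := by
    intro w w'
    rw [Fin.sum_univ_succ]
    simp only [hfull, Pi.sub_apply, Fin.cons_zero, Fin.cons_succ, Fin.val_zero, pow_zero,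
      Fin.val_succ, Int.cast_sub, sub_mul, Finset.sum_sub_distrib, Int.fract, Int.cast_neg]
    change _ + (val w - val w') = _
    ring
  have hfull_der : ∀ w w', ∑ i : Fin (e + 2), (i : ℝ) * (((full w - full w') i : ℤ) : ℝ) *
      x ^ ((i : ℕ) - 1) = der w - der w' := by
    intro w w'
    rw [Fin.sum_univ_succ]
    simp only [hfull, Pi.sub_apply, Fin.cons_succ, Fin.val_zero, Nat.cast_zero, zero_mul, zero_add,
      Fin.val_succ, Int.cast_sub, hder, ← Finset.sum_sub_distrib]
    refine Finset.sum_congr rfl fun i _ => ?_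
    push_cast
    ring
  -- first pigeonhole
  set W : Finset (Fin (e + 1) → ℤ) := Fintype.piFinset fun _ => Finset.Icc (0 : ℤ) (K * Q : ℕ)
    with hW
  have hWcard : W.card = (K * Q + 1) ^ (e + 1) := by
    rw [hW, Fintype.card_piFinset]
    simp only [Int.card_Icc, Finset.prod_const, Finset.card_univ, Fintype.card_fin]
    congr 1
  have hmaps : ∀ w ∈ W, ⌊Int.fract (val w) * (Q : ℝ) ^ (e + 1)⌋ ∈
      Finset.Ico (0 : ℤ) ((Q ^ (e + 1) : ℕ) : ℤ) := by
    intro w _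
    have h0 := Int.fract_nonneg (val w)
    have h1 := Int.fract_lt_one (val w)
    have hQe : (0 : ℝ) < (Q : ℝ) ^ (e + 1) := by positivity
    rw [Finset.mem_Ico, Int.floor_nonneg, Int.floor_lt]
    refine ⟨by positivity, ?_⟩
    push_cast
    nlinarith
  obtain ⟨y, -, hy⟩ := Finset.exists_lt_card_fiber_of_mul_lt_card_of_maps_to hmaps
    (n := K ^ (e + 1)) (by
      rw [hWcard]
      simp only [Int.card_Ico, sub_zero, Int.toNat_natCast]
      rw [← mul_pow, mul_comm Q K]
      exact Nat.pow_lt_pow_left (Nat.lt_succ_self _) (by omega))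
  set Fb := W.filter fun w => ⌊Int.fract (val w) * (Q : ℝ) ^ (e + 1)⌋ = y with hFb
  obtain ⟨w₀, hw₀⟩ : Fb.Nonempty := Finset.card_pos.1 (lt_of_le_of_lt (Nat.zero_le _) hy)
  have hcoord : ∀ w ∈ Fb, ∀ i, |((w i - w₀ i : ℤ) : ℝ)| ≤ K * Q := by
    intro w hw i
    have h1 := Finset.mem_Icc.1 (Fintype.mem_piFinset.1 (Finset.mem_filter.1 hw).1 i)
    have h2 := Finset.mem_Icc.1 (Fintype.mem_piFinset.1 (Finset.mem_filter.1 hw₀).1 i)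
    have h3 : |w i - w₀ i| ≤ (K * Q : ℕ) := by
      rw [abs_le]; constructor <;> linarith [h1.1, h1.2, h2.1, h2.2]
    exact_mod_cast h3
  have hvalsmall : ∀ w ∈ Fb, |Int.fract (val w) - Int.fract (val w₀)| * (Q : ℝ) ^ (e + 1) < 1 := by
    intro w hw
    have h1 := (Finset.mem_filter.1 hw).2
    have h2 := (Finset.mem_filter.1 hw₀).2
    have := Int.abs_sub_lt_one_of_floor_eq_floor (h1.trans h2.symm)
    rwa [← sub_mul, abs_mul, abs_of_pos (by positivity : (0 : ℝ) < (Q : ℝ) ^ (e + 1))] at this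
  have hdersmall : ∀ w ∈ Fb, |der w - der w₀| < Q := by
    intro w hw
    have := hcon (full w - full w₀) (by
      rw [hfull_val]
      exact (hvalsmall w hw).le.trans (by exact_mod_cast hK1)) (by
      intro i hi
      obtain ⟨j, rfl⟩ := Fin.exists_succ_eq.2 hi
      simpa [hfull] using hcoord w hw j)
    rwa [hfull_der] at this
  -- second pigeonhole
  set key : (Fin (e + 1) → ℤ) → ℤ × (Fin (e + 1) → ℤ) := fun w =>
    (⌊(Int.fract (val w) - Int.fract (val w₀)) * (Q : ℝ) ^ (e + 1) * L⌋,
      Fin.cons ⌊(der w - der w₀) / Q * L⌋ fun i : Fin e => ⌊((w i.succ - w₀ i.succ : ℤ) : ℝ) / Q * L⌋)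
    with hkey
  -- The coordinate `w 0` is replaced by the derivative, which the contrary assumption confines to
  -- an interval without the factor `K`. This saves one power of `K`.
  set B : Finset (ℤ × (Fin (e + 1) → ℤ)) := Finset.Icc (-(L : ℤ)) L ×ˢ Fintype.piFinset
    (Fin.cons (Finset.Icc (-(L : ℤ)) L) fun _ : Fin e => Finset.Icc (-((K * L : ℕ) : ℤ)) (K * L : ℕ) :
      Fin (e + 1) → Finset ℤ) with hB
  have hBcard : B.card = (2 * L + 1) * ((2 * L + 1) * (2 * (K * L) + 1) ^ e) := by
    rw [hB, Finset.card_product, Fintype.card_piFinset, Fin.prod_univ_succ]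
    simp only [Fin.cons_zero, Fin.cons_succ, Int.card_Icc, Finset.prod_const, Finset.card_univ,
      Fintype.card_fin]
    congr 1
    · omega
    · congr 1
      · omega
      · congr 1; omega
  have hfloor : ∀ (t : ℝ) (N : ℕ), |t| ≤ N → ⌊t * L⌋ ∈
      Finset.Icc (-((N * L : ℕ) : ℤ)) (N * L : ℕ) := by
    intro t N ht
    rw [abs_le] at ht
    rw [Finset.mem_Icc, Int.le_floor]
    refine ⟨by push_cast; nlinarith [ht.1], ?_⟩
    rw [← Int.lt_add_one_iff, Int.floor_lt]
    push_cast; nlinarith [ht.2]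
  have hkeyB : ∀ w ∈ Fb, key w ∈ B := by
    intro w hw
    rw [hB, Finset.mem_product, Fintype.mem_piFinset]
    refine ⟨?_, fun i => ?_⟩
    · have := hfloor ((Int.fract (val w) - Int.fract (val w₀)) * (Q : ℝ) ^ (e + 1)) 1 (by
        rw [abs_mul, abs_of_pos (by positivity : (0 : ℝ) < (Q : ℝ) ^ (e + 1))]
        simpa using (hvalsmall w hw).le)
      simpa only [one_mul] using this
    · refine Fin.cases ?_ (fun i => ?_) i
      · have := hfloor ((der w - der w₀) / Q) 1 (by
          rw [abs_div, abs_of_pos hQ0, div_le_iff₀ hQ0]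
          simpa using (hdersmall w hw).le)
        rw [one_mul] at this
        exact this
      · refine hfloor _ K ?_
        rw [abs_div, abs_of_pos hQ0, div_le_iff₀ hQ0]
        exact hcoord w hw i.succ
  obtain ⟨w, hw, w', hw', hne, heq⟩ := Finset.exists_ne_map_eq_of_card_lt_of_maps_to
    (by rw [hBcard]; exact hcardK.trans hy) hkeyB
  have hab : ∀ s t : ℝ, ⌊s * L⌋ = ⌊t * L⌋ → |s - t| < 1 / L := by
    intro s t hst
    have := Int.abs_sub_lt_one_of_floor_eq_floor hst
    rw [← sub_mul, abs_mul, abs_of_pos hL0] at this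
    rwa [lt_div_iff₀ hL0]
  have e1 := hab _ _ (congrArg Prod.fst heq)
  have e2 := hab _ _ (congrFun (congrArg Prod.snd heq) 0)
  have e3 : ∀ i : Fin e, |((w i.succ - w' i.succ : ℤ) : ℝ) / Q| < 1 / L := by
    intro i
    have := hab _ _ (congrFun (congrArg Prod.snd heq) i.succ)
    rw [← sub_div] at this
    convert this using 3
    push_cast; ring
  have e2' : |(der w - der w') / Q| < 1 / L := by
    convert e2 using 2
    ring
  have hdd : (der w - der w') / Q = ((w 0 - w' 0 : ℤ) : ℝ) / Q +
      ∑ i : Fin e, (((i : ℝ) + 1 + 1) * x ^ ((i : ℕ) + 1)) * (((w i.succ - w' i.succ : ℤ) : ℝ) / Q) := by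
    simp only [hder, ← Finset.sum_sub_distrib]
    rw [Fin.sum_univ_succ, add_div, Finset.sum_div]
    congr 1
    · simp
    · refine Finset.sum_congr rfl fun i _ => ?_
      simp only [Fin.val_succ]
      push_cast; ring
  -- The omitted coordinate is recovered from the derivative and the other coordinates. Now the
  -- whole difference vector is contracted below `ε`, against `hsmall`.
  have e4 : |((w 0 - w' 0 : ℤ) : ℝ) / Q| < ((e + 1 : ℝ) * (e + 1) + 1) / L := by
    have hsum : |∑ i : Fin e, (((i : ℝ) + 1 + 1) * x ^ ((i : ℕ) + 1)) *
        (((w i.succ - w' i.succ : ℤ) : ℝ) / Q)| ≤ ∑ _i : Fin e, (e + 1 : ℝ) * (1 / L) := by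
      refine (Finset.abs_sum_le_sum_abs _ _).trans (Finset.sum_le_sum fun i _ => ?_)
      rw [abs_mul]
      refine mul_le_mul ?_ (e3 i).le (abs_nonneg _) (by positivity)
      have hxp : x ^ ((i : ℕ) + 1) ≤ 1 := pow_le_one₀ hx.1 hx.2
      have hxp0 : 0 ≤ x ^ ((i : ℕ) + 1) := pow_nonneg hx.1 _
      rw [abs_of_nonneg (by positivity)]
      have hie : (i : ℝ) + 1 + 1 ≤ e + 1 := by
        have : (i : ℕ) + 1 ≤ e := i.2
        have : ((i : ℕ) : ℝ) + 1 ≤ e := by exact_mod_cast this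
        linarith
      calc ((i : ℝ) + 1 + 1) * x ^ ((i : ℕ) + 1) ≤ ((i : ℝ) + 1 + 1) * 1 := by gcongr
        _ ≤ _ := by linarith
    simp only [Finset.sum_const, Finset.card_univ, Fintype.card_fin, nsmul_eq_mul] at hsum
    have h5 : ((w 0 - w' 0 : ℤ) : ℝ) / Q = (der w - der w') / Q -
      ∑ i : Fin e, (((i : ℝ) + 1 + 1) * x ^ ((i : ℕ) + 1)) *
        (((w i.succ - w' i.succ : ℤ) : ℝ) / Q) := by rw [hdd]; ring
    rw [h5]
    refine lt_of_le_of_lt (abs_sub _ _) (lt_of_lt_of_le (add_lt_add_of_lt_of_le e2' hsum) ?_)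
    rw [div_eq_mul_one_div ((e + 1 : ℝ) * (e + 1) + 1)]
    have : (0 : ℝ) ≤ 1 / L := by positivity
    have he0 : (0 : ℝ) ≤ e := Nat.cast_nonneg e
    nlinarith
  have h1L : 1 / (L : ℝ) < ε := by
    refine lt_of_le_of_lt ?_ hLε
    gcongr
    nlinarith [(Nat.cast_nonneg e : (0 : ℝ) ≤ e)]
  refine absurd (hsmall (full w - full w') ?_) (not_le.2 ?_)
  · intro h
    apply hne
    ext i
    have := congrFun h i.succ
    simp only [hfull, Pi.sub_apply, Fin.cons_succ, Pi.zero_apply] at this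
    omega
  · rw [pi_norm_lt_iff hε]
    intro i
    refine Fin.cases ?_ (fun i => ?_) i
    · rw [curveMap_zero, Real.norm_eq_abs]
      have : ∑ i, castVec (full w - full w') i * x ^ (i : ℕ) =
        Int.fract (val w) - Int.fract (val w') := hfull_val w w'
      rw [this]
      refine lt_of_eq_of_lt (congrArg _ ?_) (e1.trans h1L)
      ring
    · have : curveMap (e + 1) Q x (castVec (full w - full w')) i.succ =
          ((w i - w' i : ℤ) : ℝ) / Q := by
        rw [curveMap_succ, div_eq_mul_inv]; rfl
      rw [this, Real.norm_eq_abs]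
      refine Fin.cases ?_ (fun i => ?_) i
      · exact e4.trans hLε
      · exact (e3 i).trans h1L

end Pigeonhole

/-! ### Even distribution of real algebraic numbers -/

section Ubiquity

open MeasureTheory

theorem abs_eval_le_of_abs_coeff_le {q : ℝ[X]} {d : ℕ} (hd : q.natDegree ≤ d) {H y : ℝ}
    (hH : ∀ i, |q.coeff i| ≤ H) (hy : |y| ≤ 2) : |q.eval y| ≤ (d + 1) * H * 2 ^ d := by
  have hH0 : 0 ≤ H := (abs_nonneg _).trans (hH 0)
  rw [eval_eq_sum_range' (Nat.lt_succ_of_le hd)]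
  refine (Finset.abs_sum_le_sum_abs _ _).trans ?_
  calc _ ≤ ∑ _i ∈ Finset.range (d + 1), H * 2 ^ d := by
        refine Finset.sum_le_sum fun i hi => ?_
        rw [abs_mul, abs_pow]
        refine mul_le_mul (hH i) ?_ (by positivity) hH0
        calc |y| ^ i ≤ 2 ^ i := pow_le_pow_left₀ (abs_nonneg _) hy i
          _ ≤ 2 ^ d := pow_le_pow_right₀ (by norm_num) (by simpa [Nat.lt_succ_iff] using hi)
    _ = _ := by simp; ring

theorem abs_coeff_derivative_le {q : ℝ[X]} {d : ℕ} (hd : q.natDegree ≤ d) {H : ℝ}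
    (hH : ∀ i, |q.coeff i| ≤ H) (i : ℕ) : |q.derivative.coeff i| ≤ (d + 1) * H := by
  have hH0 : 0 ≤ H := (abs_nonneg _).trans (hH 0)
  rw [coeff_derivative]
  by_cases hi : i + 1 ≤ d
  · rw [abs_mul, mul_comm]
    have h1 : |(i : ℝ) + 1| ≤ d + 1 := by
      rw [abs_of_nonneg (by positivity)]
      have : (i : ℝ) + 1 ≤ d := by exact_mod_cast hi
      linarith
    exact mul_le_mul h1 (hH _) (abs_nonneg _) (by positivity)
  · rw [coeff_eq_zero_of_natDegree_lt (by omega), zero_mul, abs_zero]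
    positivity

/-- A polynomial with a small value and a large derivative at a point has a root nearby. -/
theorem exists_root_near {p : ℝ[X]} {d : ℕ} (hd : p.natDegree ≤ d) {H x D ρ : ℝ}
    (hH : ∀ i, |p.coeff i| ≤ H) (hx : x ∈ Icc (0 : ℝ) 1) (hρ0 : 0 < ρ) (hρ1 : ρ ≤ 1)
    (hD : D ≤ |p.derivative.eval x|) (hρ : (d + 1) ^ 3 * 2 ^ d * H * ρ ≤ D / 2)
    (hpx : |p.eval x| ≤ ρ * (D / 2)) : ∃ a, p.eval a = 0 ∧ |x - a| ≤ ρ := by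
  wlog hpos : 0 ≤ p.derivative.eval x generalizing p
  · obtain ⟨a, ha, hax⟩ := this (p := -p) (by rwa [natDegree_neg]) (by simpa using hH)
      (by simpa using hD) (by simpa using hpx) (by simp; linarith)
    exact ⟨a, by simpa using ha, hax⟩
  rw [abs_of_nonneg hpos] at hD
  have hd1 : p.derivative.natDegree ≤ d := (natDegree_derivative_le p).trans (by omega)
  have hd2 : p.derivative.derivative.natDegree ≤ d :=
    (natDegree_derivative_le _).trans (by omega)
  have hH2 : ∀ i, |p.derivative.derivative.coeff i| ≤ (d + 1) * ((d + 1) * H) :=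
    abs_coeff_derivative_le hd1 (abs_coeff_derivative_le hd hH)
  have hsub : ∀ y ∈ Icc (x - ρ) (x + ρ), |y| ≤ 2 := by
    intro y hy
    rw [abs_le]
    constructor <;> linarith [hy.1, hy.2, hx.1, hx.2]
  -- The second derivative cannot lower the slope by more than `D / 2` over a distance `ρ`, so `p`
  -- moves by at least `ρ * (D / 2)` on each side of `x` and changes sign.
  have hlow : ∀ y ∈ Icc (x - ρ) (x + ρ), D / 2 ≤ p.derivative.eval y := by
    intro y hy
    have h := Convex.norm_image_sub_le_of_norm_deriv_le (f := fun y => p.derivative.eval y)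
      (C := (d + 1) * ((d + 1) * ((d + 1) * H)) * 2 ^ d) (s := Icc (x - ρ) (x + ρ)) (x := x) (y := y)
      (fun y _ => p.derivative.differentiable.differentiableAt)
      (fun z hz => by
        rw [Polynomial.deriv, Real.norm_eq_abs]
        exact abs_eval_le_of_abs_coeff_le hd2 hH2 (hsub z hz))
      (convex_Icc _ _) ⟨by linarith, by linarith⟩ hy
    rw [Real.norm_eq_abs, Real.norm_eq_abs] at h
    have hyx : |y - x| ≤ ρ := by rw [abs_le]; constructor <;> linarith [hy.1, hy.2]
    have hH0 : 0 ≤ H := (abs_nonneg _).trans (hH 0)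
    have h2 : ((d : ℝ) + 1) * ((d + 1) * ((d + 1) * H)) * 2 ^ d * |y - x| ≤ D / 2 := by
      refine le_trans (mul_le_mul_of_nonneg_left hyx (by positivity)) ?_
      refine le_trans (le_of_eq ?_) hρ
      ring
    have h3 := (abs_le.1 (h.trans h2)).1
    linarith
  have hmono : ∀ y ∈ Icc (x - ρ) (x + ρ), ∀ z ∈ Icc (x - ρ) (x + ρ), y ≤ z →
      D / 2 * (z - y) ≤ p.eval z - p.eval y :=
    (convex_Icc (x - ρ) (x + ρ)).mul_sub_le_image_sub_of_le_deriv (f := fun y => p.eval y)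
      p.continuous.continuousOn p.differentiable.differentiableOn
      (fun y hy => by rw [Polynomial.deriv]; exact hlow y (interior_subset hy))
  have hxm : x ∈ Icc (x - ρ) (x + ρ) := ⟨by linarith, by linarith⟩
  have h1 := hmono (x - ρ) ⟨le_rfl, by linarith⟩ x hxm (by linarith)
  have h2 := hmono x hxm (x + ρ) ⟨by linarith, le_rfl⟩ (by linarith)
  rw [abs_le] at hpx
  obtain ⟨a, ha, ha0⟩ := intermediate_value_Icc (by linarith : x - ρ ≤ x + ρ)
    (p.continuous.continuousOn) (show (0 : ℝ) ∈ Icc (p.eval (x - ρ)) (p.eval (x + ρ)) from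
      ⟨by linarith [hpx.2], by linarith [hpx.1]⟩)
  exact ⟨a, ha0, by rw [abs_le]; constructor <;> linarith [ha.1, ha.2]⟩

/-- A vector as produced by `exists_vector_of_forall_le_norm` yields a nearby algebraic number. -/
theorem exists_algNumber_near {d K Q : ℕ} (hK : 1 ≤ K)
    (hQ : 4 * (d + 1) ^ 4 * 2 ^ d * K ^ 2 ≤ Q) {x : ℝ} (hx : x ∈ Icc (0 : ℝ) 1)
    {v : Fin (d + 1) → ℤ} (h0 : |∑ i, (v i : ℝ) * x ^ (i : ℕ)| * (Q : ℝ) ^ d ≤ K)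
    (h1 : ∀ i, i ≠ 0 → |(v i : ℝ)| ≤ K * Q)
    (h2 : (Q : ℝ) ≤ |∑ i : Fin (d + 1), (i : ℝ) * (v i : ℝ) * x ^ ((i : ℕ) - 1)|) :
    ∃ a ∈ algNumbers ℝ d, algHeight a ≤ 2 ^ d * (d + 1) ^ 2 * K * Q ∧
      |x - a| ≤ 2 * K / (Q : ℝ) ^ (d + 1) := by
  have hK' : (1 : ℝ) ≤ K := by exact_mod_cast hK
  have hQ' : 4 * ((d : ℝ) + 1) ^ 4 * 2 ^ d * K ^ 2 ≤ Q := by exact_mod_cast hQ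
  have hbig : (1 : ℝ) ≤ (d + 1) ^ 4 * 2 ^ d := by
    have h3 : (1 : ℝ) ≤ ((d : ℝ) + 1) ^ 4 := one_le_pow₀ (by linarith [(Nat.cast_nonneg d : (0 : ℝ) ≤ d)])
    have h4 : (1 : ℝ) ≤ 2 ^ d := one_le_pow₀ (by norm_num)
    nlinarith
  have h2K : 2 * (K : ℝ) ≤ Q := by
    refine le_trans ?_ hQ'
    nlinarith [mul_le_mul hbig (show (K : ℝ) ≤ K ^ 2 by nlinarith) (by positivity) (by positivity)]
  have hQ1 : (1 : ℝ) ≤ Q := by linarith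
  have hQ0 : (0 : ℝ) < Q := by linarith
  have hQd1 : (Q : ℝ) ≤ (Q : ℝ) ^ (d + 1) := le_self_pow₀ hQ1 (by omega)
  set P : ℤ[X] := polyOfVec v with hP
  set p : ℝ[X] := P.map (algebraMap ℤ ℝ) with hp
  have heval : ∀ y, p.eval y = ∑ i, (v i : ℝ) * y ^ (i : ℕ) := by
    intro y
    simp [hp, hP, polyOfVec, Polynomial.map_sum, eval_finsetSum]
  have hder : p.derivative.eval x =
      ∑ i : Fin (d + 1), (i : ℝ) * (v i : ℝ) * x ^ ((i : ℕ) - 1) := by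
    simp only [hp, hP, polyOfVec, Polynomial.map_sum, derivative_sum, eval_finsetSum]
    refine Finset.sum_congr rfl fun i _ => ?_
    simp [derivative_X_pow]
    ring
  have hv : v ≠ 0 := by
    rintro rfl
    simp only [Pi.zero_apply, Int.cast_zero, mul_zero, zero_mul, Finset.sum_const_zero,
      abs_zero] at h2
    linarith
  have hPne : P ≠ 0 := polyOfVec_ne_zero hv
  have hPd : P.natDegree ≤ d := natDegree_polyOfVec_le v
  have hpd : p.natDegree ≤ d := natDegree_map_le.trans hPd
  -- The constant coefficient is not bounded by hypothesis; it is estimated from the value at `x`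
  -- and the other coefficients.
  set H : ℝ := (d + 1) * (K * Q) with hH
  have hvH : ∀ i, |(v i : ℝ)| ≤ H := by
    intro i
    by_cases hi : i = 0
    · subst hi
      have h3 : |∑ i, (v i : ℝ) * x ^ (i : ℕ)| ≤ K := by
        refine le_trans (le_mul_of_one_le_right (abs_nonneg _) (one_le_pow₀ hQ1)) h0
      rw [Fin.sum_univ_succ] at h3
      have h4 : |∑ i : Fin d, (v i.succ : ℝ) * x ^ (i.succ : ℕ)| ≤ ∑ _i : Fin d, (K : ℝ) * Q := by
        refine (Finset.abs_sum_le_sum_abs _ _).trans (Finset.sum_le_sum fun i _ => ?_)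
        rw [abs_mul]
        refine (mul_le_of_le_one_right (abs_nonneg _) ?_).trans (h1 _ (Fin.succ_ne_zero i))
        rw [abs_of_nonneg (pow_nonneg hx.1 _)]
        exact pow_le_one₀ hx.1 hx.2
      simp only [Finset.sum_const, Finset.card_univ, Fintype.card_fin, nsmul_eq_mul,
        Fin.val_zero, pow_zero, mul_one] at h3 h4
      have h5 : |(v 0 : ℝ)| ≤ K + d * (K * Q) := by
        rw [abs_le] at h3 h4 ⊢
        constructor <;> linarith [h3.1, h3.2, h4.1, h4.2]
      rw [hH]
      nlinarith
    · refine (h1 i hi).trans ?_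
      rw [hH]
      exact le_mul_of_one_le_left (by positivity) (by linarith [(Nat.cast_nonneg d : (0 : ℝ) ≤ d)])
  have hPH : ∀ i, |(P.coeff i : ℝ)| ≤ H := by
    intro i
    by_cases hi : i < d + 1
    · have := coeff_polyOfVec v ⟨i, hi⟩
      simp only at this
      rw [hP, this]
      exact hvH _
    · rw [coeff_eq_zero_of_natDegree_lt (by omega)]
      simp; positivity
  have hpH : ∀ i, |p.coeff i| ≤ H := by
    intro i
    rw [hp, coeff_map]
    exact hPH i
  -- With these choices `ρ * (D / 2)` equals `K / Q ^ d`, the available bound for the value.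
  obtain ⟨a, ha, hax⟩ := exists_root_near hpd hpH hx (ρ := 2 * K / (Q : ℝ) ^ (d + 1)) (D := Q)
    (by positivity) (by rw [div_le_one (by positivity)]; linarith) (by rwa [hder]) (by
      rw [mul_div_assoc', div_le_iff₀ (by positivity), hH]
      have : 4 * ((d : ℝ) + 1) ^ 4 * 2 ^ d * K ^ 2 ≤ (Q : ℝ) ^ (d + 1) := hQ'.trans hQd1
      nlinarith) (by
      rw [heval]
      rw [← le_div_iff₀ (by positivity)] at h0
      refine h0.trans (le_of_eq ?_)
      rw [pow_succ]
      field_simp)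
  have hroot : aeval a P = 0 := by
    rw [aeval_def, ← eval_map]; exact ha
  obtain ⟨hmem, hheight⟩ := algHeight_le_of_aeval_eq_zero hPne hroot hPd hPH
  refine ⟨a, hmem, ?_, hax⟩
  have : (algHeight a : ℝ) ≤ ((2 ^ d * (d + 1) ^ 2 * K * Q : ℕ) : ℝ) := by
    refine hheight.trans (le_of_eq ?_)
    rw [hH]; push_cast; ring
  exact_mod_cast this

/-- Local ubiquity of the real algebraic numbers. -/
theorem exists_volume_far_le {d : ℕ} (hd : 1 ≤ d) :
    ∃ C₁ : ℕ, 1 ≤ C₁ ∧ ∃ C₀ : ℝ, 0 < C₀ ∧ ∀ u w : ℝ, 0 ≤ u → u < w → w ≤ 1 →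
      ∃ Q₀ : ℕ, ∀ Q : ℕ, Q₀ ≤ Q → volume {y | y ∈ Icc u w ∧ ¬ ∃ a ∈ algNumbers ℝ d,
        algHeight a ≤ C₁ * Q ∧ |y - a| ≤ C₀ / (Q : ℝ) ^ (d + 1)} ≤
          ENNReal.ofReal ((w - u) / 4) := by
  obtain ⟨ε, hε, hvol⟩ := exists_volume_small_vector_le d (κ := 1 / 2) (by norm_num)
  obtain ⟨K, hK, hpig⟩ := exists_vector_of_forall_le_norm hd hε
  refine ⟨2 ^ d * (d + 1) ^ 2 * K, Nat.one_le_iff_ne_zero.2 (by positivity), 2 * K,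
    by have : (0 : ℝ) < K := by exact_mod_cast hK
       positivity, ?_⟩
  intro u w hu huw hw
  obtain ⟨Q₀, hQ₀, hQ⟩ := hvol ((u + w) / 2) ((w - u) / 2) (by linarith)
  refine ⟨max (4 * (d + 1) ^ 4 * 2 ^ d * K ^ 2) ⌈Q₀⌉₊, fun Q hQQ => ?_⟩
  have hQ1 : Q₀ ≤ Q := (Nat.le_ceil _).trans (by exact_mod_cast (le_max_right _ _).trans hQQ)
  have hQ2 := (le_max_left _ _).trans hQQ
  have hQ3 : 1 ≤ Q := by exact_mod_cast hQ₀.trans hQ1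
  refine (measure_mono ?_).trans ((hQ Q hQ1).trans (ENNReal.ofReal_le_ofReal (by linarith)))
  rintro y ⟨hy, hno⟩
  refine ⟨?_, ?_⟩
  · rw [Real.closedBall_eq_Icc]
    constructor <;> linarith [hy.1, hy.2]
  · by_contra! hcon
    have hy01 : y ∈ Icc (0 : ℝ) 1 := ⟨hu.trans hy.1, hy.2.trans hw⟩
    obtain ⟨v, h0, h1, h2⟩ := hpig Q hQ3 y hy01 hcon
    exact hno (exists_algNumber_near hK hQ2 hy01 h0 h1 h2)

theorem exists_maximal_separated (G : Finset ℝ) {ρ : ℝ} (hρ : 0 < ρ) :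
    ∃ A ⊆ G, (∀ a ∈ A, ∀ b ∈ A, a ≠ b → ρ ≤ |a - b|) ∧ ∀ g ∈ G, ∃ a ∈ A, |g - a| < ρ := by
  classical
  obtain ⟨A, hA, hmax⟩ := (G.powerset.filter fun A : Finset ℝ =>
    ∀ a ∈ A, ∀ b ∈ A, a ≠ b → ρ ≤ |a - b|).exists_maximal ⟨∅, by simp⟩
  obtain ⟨hAG, hsep⟩ := Finset.mem_filter.1 hA
  rw [Finset.mem_powerset] at hAG
  refine ⟨A, hAG, hsep, fun g hg => ?_⟩
  by_contra! hcon
  have hgA : g ∉ A := fun h => by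
    have := hcon g h
    simp at this; linarith
  have : insert g A ≤ A := hmax (Finset.mem_filter.2 ⟨Finset.mem_powerset.2
    (Finset.insert_subset hg hAG), by
      intro a ha b hb hab
      rw [Finset.mem_insert] at ha hb
      rcases ha with rfl | ha <;> rcases hb with rfl | hb
      · exact absurd rfl hab
      · exact hcon b hb
      · rw [abs_sub_comm]; exact hcon a ha
      · exact hsep a ha b hb hab⟩) (Finset.subset_insert g A)
  exact hgA (this (Finset.mem_insert_self g A))

/-- Every interval contains many well separated real algebraic numbers of bounded height. -/
theorem exists_separated_algNumbers {d : ℕ} (hd : 1 ≤ d) :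
    ∃ c : ℝ, 0 < c ∧ ∀ u w : ℝ, 0 ≤ u → u < w → w ≤ 1 → ∃ X₀ : ℕ, ∀ X : ℕ, X₀ ≤ X →
      ∃ A : Finset ℝ, (∀ a ∈ A, a ∈ Icc u w ∧ a ∈ algNumbers ℝ d ∧ algHeight a ≤ X) ∧
        (∀ a ∈ A, ∀ b ∈ A, a ≠ b → 1 / (X : ℝ) ^ (d + 1) ≤ |a - b|) ∧
        c * (w - u) * (X : ℝ) ^ (d + 1) ≤ A.card := by
  classical
  obtain ⟨C₁, hC₁, C₀, hC₀, hub⟩ := exists_volume_far_le hd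
  have hC₁' : (0 : ℝ) < C₁ := by exact_mod_cast hC₁
  set C₂ : ℝ := C₀ * (2 * C₁) ^ (d + 1) with hC₂
  have hC₂0 : 0 < C₂ := by positivity
  refine ⟨1 / (8 * (C₂ + 1)), by positivity, ?_⟩
  intro u w hu huw hw
  -- Working in the middle half keeps the approximating numbers themselves inside `[u, w]`.
  obtain ⟨Q₀, hQ₀⟩ := hub (u + (w - u) / 4) (w - (w - u) / 4) (by linarith) (by linarith)
    (by linarith)
  obtain ⟨Q₁, hQ₁⟩ := exists_nat_gt (C₀ / ((w - u) / 4))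
  refine ⟨C₁ * (max Q₀ (max Q₁ 1)), fun X hX => ?_⟩
  set Q := X / C₁ with hQ
  have hQmax : max Q₀ (max Q₁ 1) ≤ Q := by
    rw [hQ, Nat.le_div_iff_mul_le (by omega), mul_comm]; exact hX
  have hQ0 : Q₀ ≤ Q := (le_max_left _ _).trans hQmax
  have hQ1 : Q₁ ≤ Q := (le_max_left _ _).trans ((le_max_right _ _).trans hQmax)
  have hQ2 : 1 ≤ Q := (le_max_right _ _).trans ((le_max_right _ _).trans hQmax)
  have hQX : C₁ * Q ≤ X := Nat.mul_div_le X C₁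
  have hXQ : X ≤ 2 * C₁ * Q := by
    have h1 : X < C₁ * (Q + 1) := Nat.lt_mul_div_succ X (by omega)
    nlinarith
  have hQpos : (0 : ℝ) < Q := by exact_mod_cast hQ2
  have hXpos : (0 : ℝ) < X := by
    have : 0 < X := lt_of_lt_of_le (by positivity) hQX
    exact_mod_cast this
  set ρ : ℝ := 1 / (X : ℝ) ^ (d + 1) with hρ
  have hρ0 : 0 < ρ := by positivity
  have hR : C₀ / (Q : ℝ) ^ (d + 1) ≤ C₂ * ρ := by
    have hXQ' : (X : ℝ) ≤ 2 * C₁ * Q := by exact_mod_cast hXQ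
    rw [hρ, mul_one_div, div_le_div_iff₀ (by positivity) (by positivity), hC₂, mul_assoc, ← mul_pow]
    gcongr
  have hR2 : C₀ / (Q : ℝ) ^ (d + 1) ≤ (w - u) / 4 := by
    have h1 : C₀ / ((w - u) / 4) ≤ Q := hQ₁.le.trans (by exact_mod_cast hQ1)
    rw [div_le_iff₀ (by linarith)] at h1
    rw [div_le_iff₀ (by positivity)]
    have h2 : (Q : ℝ) ≤ (Q : ℝ) ^ (d + 1) := le_self_pow₀ (by exact_mod_cast hQ2) (by omega)
    nlinarith
  have hfin : {a : ℝ | (a ∈ algNumbers ℝ d ∧ algHeight a ≤ X) ∧ a ∈ Icc u w}.Finite :=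
    (finite_algNumbers_height_le (K := ℝ) d X).subset fun a ha => ha.1
  obtain ⟨A, hAG, hsep, hcov⟩ := exists_maximal_separated hfin.toFinset hρ0
  refine ⟨A, ?_, hsep, ?_⟩
  · intro a ha
    have := hfin.mem_toFinset.1 (hAG ha)
    exact ⟨this.2, this.1⟩
  set J := Icc (u + (w - u) / 4) (w - (w - u) / 4) with hJ
  set bad := {y | y ∈ J ∧ ¬ ∃ a ∈ algNumbers ℝ d,
        algHeight a ≤ C₁ * Q ∧ |y - a| ≤ C₀ / (Q : ℝ) ^ (d + 1)}
  have hsub : J ⊆ bad ∪ ⋃ a ∈ A, Metric.closedBall a ((C₂ + 1) * ρ) := by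
    intro y hy
    by_cases hb : ∃ a ∈ algNumbers ℝ d,
        algHeight a ≤ C₁ * Q ∧ |y - a| ≤ C₀ / (Q : ℝ) ^ (d + 1)
    · right
      obtain ⟨a, ha, haH, hya⟩ := hb
      have hya2 := abs_le.1 (hya.trans hR2)
      have hmem : a ∈ hfin.toFinset := by
        rw [hfin.mem_toFinset]
        refine ⟨⟨ha, haH.trans hQX⟩, ?_, ?_⟩ <;> linarith [hy.1, hy.2, hya2.1, hya2.2]
      obtain ⟨a', ha', haa'⟩ := hcov a hmem
      simp only [mem_iUnion]
      refine ⟨a', ha', ?_⟩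
      rw [Metric.mem_closedBall, Real.dist_eq]
      have := abs_sub_le y a a'
      have := hya.trans hR
      linarith
    · exact Or.inl ⟨hy, hb⟩
  have hmeas := (measure_mono hsub).trans (measure_union_le (μ := volume) _ _)
  have hbad := hQ₀ Q hQ0
  have hun : volume (⋃ a ∈ A, Metric.closedBall a ((C₂ + 1) * ρ)) ≤
      ENNReal.ofReal (A.card * (2 * ((C₂ + 1) * ρ))) := by
    refine (measure_biUnion_finset_le _ _).trans ?_
    simp only [Real.volume_closedBall, Finset.sum_const, nsmul_eq_mul]
    rw [← ENNReal.ofReal_natCast, ← ENNReal.ofReal_mul (by positivity)]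
  rw [hJ, Real.volume_Icc] at hmeas
  have hfinal := hmeas.trans (add_le_add hbad hun)
  rw [← ENNReal.ofReal_add (by linarith) (by positivity),
    ENNReal.ofReal_le_ofReal_iff (add_nonneg (by linarith) (by positivity))] at hfinal
  have h1 : (w - u) / 4 ≤ A.card * (2 * ((C₂ + 1) * ρ)) := by linarith
  rw [hρ] at h1
  have hXd : (0 : ℝ) < (X : ℝ) ^ (d + 1) := by positivity
  have h2 : (w - u) / 4 * (X : ℝ) ^ (d + 1) ≤ A.card * (2 * (C₂ + 1)) := by
    have := mul_le_mul_of_nonneg_right h1 hXd.le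
    refine this.trans (le_of_eq ?_)
    field_simp
  rw [one_div_mul_eq_div, div_mul_eq_mul_div, div_le_iff₀ (by positivity)]
  linarith

end Ubiquity

/-! ### Places where a cover is sparse -/

section Density

open MeasureTheory

/-- A finite `ρ`-separated set in an interval of length `ℓ` has at most `ℓ / ρ + 1` points. -/
theorem card_le_of_separated {A : Finset ℝ} {u w ρ : ℝ} (hρ : 0 < ρ) (huw : u ≤ w)
    (hA : ∀ a ∈ A, a ∈ Icc u w) (hsep : ∀ a ∈ A, ∀ b ∈ A, a ≠ b → ρ ≤ |a - b|) :
    (A.card : ℝ) ≤ (w - u) / ρ + 1 := by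
  have hdisj : (A : Set ℝ).PairwiseDisjoint fun a => Metric.ball a (ρ / 2) := by
    intro a ha b hb hab
    refine Metric.ball_disjoint_ball ?_
    rw [Real.dist_eq]
    linarith [hsep a ha b hb hab]
  have h1 := measure_biUnion_finset (μ := volume) hdisj fun a _ => measurableSet_ball
  have h2 : (⋃ a ∈ A, Metric.ball a (ρ / 2)) ⊆ Icc (u - ρ / 2) (w + ρ / 2) := by
    refine iUnion₂_subset fun a ha y hy => ?_
    rw [Metric.mem_ball, Real.dist_eq, abs_lt] at hy
    have := hA a ha
    constructor <;> linarith [this.1, this.2, hy.1, hy.2]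
  have h3 := measure_mono (μ := volume) h2
  rw [h1] at h3
  simp only [Real.volume_ball, Real.volume_Icc, Finset.sum_const, nsmul_eq_mul] at h3
  rw [← ENNReal.ofReal_natCast, ← ENNReal.ofReal_mul (by positivity),
    ENNReal.ofReal_le_ofReal_iff (by linarith)] at h3
  rw [div_add_one hρ.ne', le_div_iff₀ hρ]
  linarith

variable {ι : Type*}

/-- Around almost every uncovered point the covering intervals that meet a small interval have
small total length. -/
theorem exists_interval_small_cover [Countable ι] {x s : ι → ℝ} (hs0 : ∀ i, 0 < s i)
    (hs : Summable s) {O : Set ℝ} (hO : IsOpen O)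
    (hU : volume (O \ ⋃ i, Metric.ball (x i) (s i)) ≠ 0) {η : ℝ} (hη : 0 < η) :
    ∃ u w : ℝ, u < w ∧ Icc u w ⊆ O ∧ ∀ T : Finset ι,
      (∀ i ∈ T, (Metric.ball (x i) (s i) ∩ Icc u w).Nonempty) →
        ∑ i ∈ T, 2 * s i ≤ η * (w - u) := by
  classical
  -- Differentiating the multiplicity function, rather than the indicator of the union, controls the
  -- sum of the lengths and not only the measure of the union.
  set F : ℝ → ℝ≥0∞ := fun y => ∑' i, (Metric.ball (x i) (s i)).indicator (fun _ => 1) y with hF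
  have hmeas : ∀ i, Measurable ((Metric.ball (x i) (s i)).indicator (fun _ => (1 : ℝ≥0∞))) :=
    fun i => measurable_const.indicator measurableSet_ball
  have hFm : Measurable F := Measurable.tsum hmeas
  have hint : ∀ B : Set ℝ, ∫⁻ y in B, F y = ∑' i, volume (Metric.ball (x i) (s i) ∩ B) := by
    intro B
    rw [hF, lintegral_tsum fun i => (hmeas i).aemeasurable]
    refine tsum_congr fun i => ?_
    rw [lintegral_indicator_const measurableSet_ball, one_mul,
      Measure.restrict_apply measurableSet_ball]
  have hFfin : ∫⁻ y, F y ≠ ∞ := by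
    have h := hint univ
    rw [Measure.restrict_univ] at h
    rw [h]
    simp only [inter_univ, Real.volume_ball]
    exact (hs.mul_left 2).tsum_ofReal_ne_top
  have hae := (Besicovitch.vitaliFamily (volume : Measure ℝ)).ae_tendsto_lintegral_div
    hFm.aemeasurable hFfin
  set η' : ℝ := min (η / 4) (1 / 8) with hη'
  have hη'0 : 0 < η' := by positivity
  obtain ⟨z, hzO, hz⟩ : ∃ z ∈ O \ ⋃ i, Metric.ball (x i) (s i),
      Tendsto (fun a => (∫⁻ y in a, F y) / volume a)
        ((Besicovitch.vitaliFamily (volume : Measure ℝ)).filterAt z) (𝓝 (F z)) := by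
    by_contra! hcon
    refine hU (measure_mono_null ?_ hae)
    intro z hz
    exact hcon z hz
  have hFz : F z = 0 := by
    simp only [hF, ENNReal.tsum_eq_zero]
    intro i
    rw [indicator_of_notMem]
    intro h
    exact hzO.2 (mem_iUnion.2 ⟨i, h⟩)
  rw [hFz] at hz
  have hz2 := hz.comp (Besicovitch.tendsto_filterAt (volume : Measure ℝ) z)
  have hev1 : ∀ᶠ r in 𝓝[>] (0 : ℝ), (∫⁻ y in Metric.closedBall z r, F y) /
      volume (Metric.closedBall z r) < ENNReal.ofReal η' :=
    hz2.eventually_lt_const (by simpa using hη'0)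
  have hev2 : ∀ᶠ r in 𝓝[>] (0 : ℝ), Metric.closedBall z r ⊆ O := by
    obtain ⟨δ, hδ, hsub⟩ := Metric.nhds_basis_closedBall.mem_iff.1 (hO.mem_nhds hzO.1)
    filter_upwards [Ioc_mem_nhdsGT hδ] with r hr
    exact (Metric.closedBall_subset_closedBall hr.2).trans hsub
  obtain ⟨r, hr1, hr2, hr0⟩ := (hev1.and (hev2.and self_mem_nhdsWithin)).exists
  replace hr0 : 0 < r := hr0
  have htotal : ∑' i, volume (Metric.ball (x i) (s i) ∩ Metric.closedBall z r) ≤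
      ENNReal.ofReal (η' * (2 * r)) := by
    rw [← hint, ENNReal.ofReal_mul hη'0.le, ← Real.volume_closedBall]
    refine (ENNReal.div_le_iff ?_ ?_).1 hr1.le
    · rw [Real.volume_closedBall]; simpa using hr0
    · rw [Real.volume_closedBall]; exact ENNReal.ofReal_ne_top
  -- A covering interval that meets the inner half but leaves the ball would overlap it in length at
  -- least `r / 2`, more than the total `2 * η' * r ≤ r / 4`. So those meeting it lie inside the
  -- ball and count in full.
  refine ⟨z - r / 2, z + r / 2, by linarith, ?_, ?_⟩
  · refine Subset.trans ?_ hr2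
    rw [Real.closedBall_eq_Icc]
    exact Icc_subset_Icc (by linarith) (by linarith)
  intro T hT
  have hin : ∀ i ∈ T, Metric.ball (x i) (s i) ⊆ Metric.closedBall z r := by
    intro i hi
    obtain ⟨y, hyb, hyI⟩ := hT i hi
    by_contra hnot
    have hbig : ENNReal.ofReal (r / 2) ≤
        volume (Metric.ball (x i) (s i) ∩ Metric.closedBall z r) := by
      rw [Real.ball_eq_Ioo, Real.closedBall_eq_Icc] at *
      by_cases h1 : x i - s i < z - r
      · have : Ioo (z - r) y ⊆ Ioo (x i - s i) (x i + s i) ∩ Icc (z - r) (z + r) := by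
          intro t ht
          refine ⟨⟨?_, ?_⟩, ?_, ?_⟩ <;> linarith [ht.1, ht.2, hyb.1, hyb.2, hyI.1, hyI.2]
        refine le_trans ?_ (measure_mono this)
        rw [Real.volume_Ioo]
        exact ENNReal.ofReal_le_ofReal (by linarith [hyI.1])
      by_cases h2 : z + r < x i + s i
      · have : Ioo y (z + r) ⊆ Ioo (x i - s i) (x i + s i) ∩ Icc (z - r) (z + r) := by
          intro t ht
          refine ⟨⟨?_, ?_⟩, ?_, ?_⟩ <;> linarith [ht.1, ht.2, hyb.1, hyb.2, hyI.1, hyI.2]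
        refine le_trans ?_ (measure_mono this)
        rw [Real.volume_Ioo]
        exact ENNReal.ofReal_le_ofReal (by linarith [hyI.2])
      · exact absurd (Ioo_subset_Icc_self.trans (Icc_subset_Icc (not_lt.1 h1) (not_lt.1 h2))) hnot
    have hle := hbig.trans ((ENNReal.le_tsum i).trans htotal)
    rw [ENNReal.ofReal_le_ofReal_iff (by positivity)] at hle
    have : η' ≤ 1 / 8 := min_le_right _ _
    nlinarith
  have hsum := (ENNReal.sum_le_tsum T).trans htotal
  rw [Finset.sum_congr rfl fun i hi => by
      rw [inter_eq_left.2 (hin i hi), Real.volume_ball],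
    ← ENNReal.ofReal_sum_of_nonneg fun i _ => by linarith [hs0 i],
    ENNReal.ofReal_le_ofReal_iff (by positivity)] at hsum
  refine hsum.trans ?_
  have : η' ≤ η / 4 := min_le_left _ _
  nlinarith

end Density

/-! ### Cost of covering a ball -/

section Cost

open MeasureTheory

variable {ι : Type*}

/-- If almost all of an interval of radius `r` is covered, then the `f`-cost of finitely many of the
covering intervals that meet it is at least `f r / 2`. -/
theorem exists_finset_cost [Countable ι] {f : ℝ → ℝ} (hf0 : ∀ r, 0 < r → 0 < f r)
    (hfm : MonotoneOn f (Ioi 0)) (hfa : AntitoneOn (fun r : ℝ => r⁻¹ * f r) (Ioi 0))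
    {x s : ι → ℝ} (hs0 : ∀ i, 0 < s i) {a r : ℝ} (hr : 0 < r)
    (hcov : volume (Metric.closedBall a r \ ⋃ i, Metric.ball (x i) (s i)) = 0) :
    ∃ T : Finset ι, (∀ i ∈ T, (Metric.ball (x i) (s i) ∩ Metric.closedBall a r).Nonempty) ∧
      f r / 2 ≤ ∑ i ∈ T, f (s i) := by
  classical
  have h1 : ENNReal.ofReal (2 * r) ≤
      ∑' i, volume (Metric.ball (x i) (s i) ∩ Metric.closedBall a r) := by
    rw [← Real.volume_closedBall (a := a)]
    have hsub : Metric.closedBall a r ⊆ (Metric.closedBall a r \ ⋃ i, Metric.ball (x i) (s i)) ∪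
        ⋃ i, (Metric.ball (x i) (s i) ∩ Metric.closedBall a r) := by
      intro y hy
      by_cases h : y ∈ ⋃ i, Metric.ball (x i) (s i)
      · right
        obtain ⟨i, hi⟩ := mem_iUnion.1 h
        exact mem_iUnion.2 ⟨i, hi, hy⟩
      · exact Or.inl ⟨hy, h⟩
    refine (measure_mono hsub).trans ((measure_union_le _ _).trans ?_)
    rw [hcov, zero_add]
    exact measure_iUnion_le _
  have h2 : ENNReal.ofReal r < ∑' i, volume (Metric.ball (x i) (s i) ∩ Metric.closedBall a r) :=
    lt_of_lt_of_le ((ENNReal.ofReal_lt_ofReal_iff (by linarith)).2 (by linarith)) h1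
  rw [ENNReal.tsum_eq_iSup_sum] at h2
  obtain ⟨T, hT⟩ := lt_iSup_iff.1 h2
  set T' := T.filter fun i => (Metric.ball (x i) (s i) ∩ Metric.closedBall a r).Nonempty
  refine ⟨T', fun i hi => (Finset.mem_filter.1 hi).2, ?_⟩
  have h3 : r < ∑ i ∈ T', 2 * s i := by
    rw [← ENNReal.ofReal_lt_ofReal_iff_of_nonneg hr.le,
      ENNReal.ofReal_sum_of_nonneg fun i _ => by linarith [hs0 i]]
    refine lt_of_lt_of_le hT ?_
    rw [← Finset.sum_filter_add_sum_filter_not T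
      (fun i => (Metric.ball (x i) (s i) ∩ Metric.closedBall a r).Nonempty)]
    rw [Finset.sum_eq_zero (s := T.filter fun i => ¬ _) (fun i hi => by
      rw [not_nonempty_iff_eq_empty.1 (Finset.mem_filter.1 hi).2, measure_empty]), add_zero]
    refine Finset.sum_le_sum fun i _ => ?_
    rw [← Real.volume_ball]
    exact measure_mono inter_subset_left
  have hfr := hf0 r hr
  -- One interval at least as long as the ball pays by monotonicity of `f`. If all are shorter, each
  -- has `f (s i) / s i ≥ f r / r` and the total length pays.
  by_cases hbig : ∃ i ∈ T', r ≤ s i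
  · obtain ⟨i, hi, hri⟩ := hbig
    have h4 : f (s i) ≤ ∑ i ∈ T', f (s i) :=
      Finset.single_le_sum (f := fun i => f (s i)) (fun j _ => (hf0 _ (hs0 j)).le) hi
    have h5 := hfm (mem_Ioi.2 hr) (mem_Ioi.2 (hs0 i)) hri
    linarith
  · push Not at hbig
    have h4 : ∑ i ∈ T', 2 * s i * (f r / r / 2) ≤ ∑ i ∈ T', f (s i) := by
      refine Finset.sum_le_sum fun i hi => ?_
      have h5 := hfa (mem_Ioi.2 (hs0 i)) (mem_Ioi.2 hr) (hbig i hi).le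
      simp only at h5
      rw [inv_mul_eq_div, inv_mul_eq_div, le_div_iff₀ (hs0 i)] at h5
      linarith
    rw [← Finset.sum_mul] at h4
    refine le_trans ?_ h4
    have : f r / 2 = r * (f r / r / 2) := by field_simp
    rw [this]
    exact mul_le_mul_of_nonneg_right h3.le (by positivity)

/-- Double counting. -/
theorem sum_sum_le_mul_sum {P : Type*} (S : Finset P) (T : P → Finset ι) {g : ι → ℝ}
    (hg : ∀ i, 0 ≤ g i) (hsum : Summable g) {m : ℝ}
    (hm : ∀ i, (Set.ncard {p | p ∈ S ∧ i ∈ T p} : ℝ) ≤ m) :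
    ∑ p ∈ S, ∑ i ∈ T p, g i ≤ m * ∑' i, g i := by
  classical
  set V := S.biUnion T
  have h1 : ∑ p ∈ S, ∑ i ∈ T p, g i = ∑ p ∈ S, ∑ i ∈ V, if i ∈ T p then g i else 0 := by
    refine Finset.sum_congr rfl fun p hp => ?_
    rw [← Finset.sum_filter]
    refine Finset.sum_congr ?_ fun _ _ => rfl
    ext i
    rw [Finset.mem_filter]
    exact ⟨fun h => ⟨Finset.mem_biUnion.2 ⟨p, hp, h⟩, h⟩, fun h => h.2⟩
  rw [h1, Finset.sum_comm]
  have h2 : ∀ i ∈ V, (∑ p ∈ S, if i ∈ T p then g i else 0) ≤ m * g i := by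
    intro i _
    rw [← Finset.sum_filter, Finset.sum_const, nsmul_eq_mul]
    refine mul_le_mul_of_nonneg_right ?_ (hg i)
    refine le_trans (le_of_eq ?_) (hm i)
    rw [← Set.ncard_coe_finset]
    congr 2
    ext p
    simp
  refine (Finset.sum_le_sum h2).trans ?_
  rw [← Finset.mul_sum]
  by_cases hV : V.Nonempty
  · obtain ⟨i, _⟩ := hV
    exact mul_le_mul_of_nonneg_left (hsum.sum_le_tsum V fun i _ => hg i)
      ((Nat.cast_nonneg _).trans (hm i))
  · rw [Finset.not_nonempty_iff_eq_empty.1 hV, Finset.sum_empty, mul_zero]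
    by_cases hι : Nonempty ι
    · obtain ⟨i⟩ := hι
      exact mul_nonneg ((Nat.cast_nonneg _).trans (hm i)) (tsum_nonneg hg)
    · rw [not_nonempty_iff] at hι
      simp

end Cost

/-! ### Approximation balls that resist a cover -/

section BallSystem

open MeasureTheory

variable {ι : Type*}

theorem card_filter_near_le {A : Finset ℝ} {N : ℝ} (hN : 0 < N)
    (hsep : ∀ a ∈ A, ∀ b ∈ A, a ≠ b → 1 / N ≤ |a - b|) (z : ℝ) {t : ℝ} (ht : 0 ≤ t) :
    ((A.filter fun a => |a - z| ≤ t).card : ℝ) ≤ 2 * t * N + 1 := by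
  have h := card_le_of_separated (A := A.filter fun a => |a - z| ≤ t) (u := z - t) (w := z + t)
    (one_div_pos.2 hN) (by linarith) (fun a ha => by
      have := abs_le.1 (Finset.mem_filter.1 ha).2
      constructor <;> linarith [this.1, this.2]) (fun a ha b hb =>
      hsep a (Finset.mem_filter.1 ha).1 b (Finset.mem_filter.1 hb).1)
  refine h.trans (le_of_eq ?_)
  rw [div_div_eq_mul_div]; ring

theorem abs_sub_le_of_inter_nonempty {x s a r : ℝ}
    (h : (Metric.ball x s ∩ Metric.closedBall a r).Nonempty) : |a - x| ≤ r + s := by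
  obtain ⟨y, hy1, hy2⟩ := h
  rw [Metric.mem_ball, Real.dist_eq] at hy1
  rw [Metric.mem_closedBall, Real.dist_eq, abs_sub_comm] at hy2
  have := abs_sub_le a y x
  linarith

/-- Few points of a separated set are close to a long interval of a short family. -/
theorem card_filter_big_le {A : Finset ℝ} {N r u w η : ℝ} (hN : 0 < N) (hr0 : 0 < r)
    (hr : r ≤ 1 / (2 * N)) (hsep : ∀ a ∈ A, ∀ b ∈ A, a ≠ b → 1 / N ≤ |a - b|)
    (hA : ∀ a ∈ A, Metric.closedBall a r ⊆ Icc u w) {x s : ι → ℝ}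
    (hT : ∀ T : Finset ι, (∀ i ∈ T, (Metric.ball (x i) (s i) ∩ Icc u w).Nonempty) →
        ∑ i ∈ T, 2 * s i ≤ η * (w - u)) [DecidablePred fun a : ℝ =>
      ∃ i, (Metric.ball (x i) (s i) ∩ Metric.closedBall a r).Nonempty ∧ 1 / N ≤ 2 * s i] :
    ((A.filter fun a => ∃ i, (Metric.ball (x i) (s i) ∩ Metric.closedBall a r).Nonempty ∧
      1 / N ≤ 2 * s i).card : ℝ) ≤ 3 * (η * (w - u)) * N := by
  classical
  set B := A.filter fun a => ∃ i, (Metric.ball (x i) (s i) ∩ Metric.closedBall a r).Nonempty ∧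
      1 / N ≤ 2 * s i with hB
  have hex : ∀ a : B, ∃ i, (Metric.ball (x i) (s i) ∩ Metric.closedBall (a : ℝ) r).Nonempty ∧
      1 / N ≤ 2 * s i := fun a => (Finset.mem_filter.1 a.2).2
  choose i hi1 hi2 using hex
  set T := B.attach.image i
  have hsum := hT T (by
    intro j hj
    obtain ⟨a, -, rfl⟩ := Finset.mem_image.1 hj
    obtain ⟨y, hy1, hy2⟩ := hi1 a
    exact ⟨y, hy1, hA a (Finset.mem_filter.1 a.2).1 hy2⟩)
  have h1 : (B.card : ℝ) = ∑ j ∈ T, ((B.attach.filter fun a => i a = j).card : ℝ) := by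
    rw [← Finset.card_attach]
    exact_mod_cast Finset.card_eq_sum_card_image i B.attach
  have h2 : ∀ j ∈ T, ((B.attach.filter fun a => i a = j).card : ℝ) ≤ 2 * s j * (3 * N) := by
    intro j hj
    obtain ⟨a₀, -, rfl⟩ := Finset.mem_image.1 hj
    have hs := hi2 a₀
    have hs0 : 0 < s (i a₀) := by
      have : 0 < 1 / N := by positivity
      linarith
    have h3 : ((B.attach.filter fun a => i a = i a₀).card : ℝ) ≤
        ((A.filter fun a => |a - x (i a₀)| ≤ r + s (i a₀)).card : ℝ) := by
      rw [← Finset.card_map (Function.Embedding.subtype _)]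
      norm_cast
      refine Finset.card_le_card fun b hb => ?_
      obtain ⟨a, ha, rfl⟩ := Finset.mem_map.1 hb
      have hai := (Finset.mem_filter.1 ha).2
      refine Finset.mem_filter.2 ⟨(Finset.mem_filter.1 a.2).1, ?_⟩
      rw [← hai]
      exact abs_sub_le_of_inter_nonempty (hi1 a)
    refine h3.trans ((card_filter_near_le hN hsep _ (by positivity)).trans ?_)
    rw [div_le_iff₀ hN] at hs
    rw [le_div_iff₀ (by positivity)] at hr
    nlinarith
  rw [h1]
  refine (Finset.sum_le_sum h2).trans ?_
  rw [← Finset.sum_mul]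
  calc _ ≤ η * (w - u) * (3 * N) := mul_le_mul_of_nonneg_right hsum (by positivity)
    _ = _ := by ring

/-- The hypotheses on a limsup set of balls `B (a, r k)`, `a ∈ 𝒜 k`, under which its Hausdorff
`f`-measure is infinite. -/
structure IsBallSystem (f : ℝ → ℝ) (𝒜 : ℕ → Set ℝ) (N r : ℕ → ℝ) (c : ℝ) : Prop where
  c_pos : 0 < c
  N_pos : ∀ k, 0 < N k
  N_tendsto : Tendsto N atTop atTop
  N_sum_le : ∀ k, ∑ j ∈ Finset.range k, N j ≤ c / 64 * N k
  r_pos : ∀ k, 0 < r k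
  r_le : ∀ k, r k ≤ 1 / (2 * N k)
  diverges : ¬ Summable fun k => N k * f (r k)
  separated : ∀ u w : ℝ, 0 ≤ u → u < w → w ≤ 1 → ∃ k₁ : ℕ, ∀ k, k₁ ≤ k → ∃ A : Finset ℝ,
    (∀ a ∈ A, a ∈ Icc u w ∧ a ∈ 𝒜 k) ∧
    (∀ a ∈ A, ∀ b ∈ A, a ≠ b → 1 / N k ≤ |a - b|) ∧ c * (w - u) * N k ≤ A.card

variable {f : ℝ → ℝ} {𝒜 : ℕ → Set ℝ} {N r : ℕ → ℝ} {c : ℝ}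

theorem IsBallSystem.r_tendsto (h : IsBallSystem f 𝒜 N r c) : Tendsto r atTop (𝓝[>] 0) := by
  refine tendsto_nhdsWithin_iff.2 ⟨?_, Eventually.of_forall h.r_pos⟩
  refine squeeze_zero (fun k => (h.r_pos k).le) h.r_le ?_
  exact (tendsto_const_nhds (x := (1 : ℝ))).div_atTop (h.N_tendsto.const_mul_atTop two_pos)

/-- Partial sums of a divergent series with nonnegative terms: a first index where they exceed `M`. -/
theorem exists_first_sum_gt {g : ℕ → ℝ} (hg : ∀ k, 0 ≤ g k) (hdiv : ¬ Summable g) (k₁ : ℕ) {M : ℝ} :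
    ∃ k₂, M < ∑ k ∈ Finset.Ico k₁ k₂, g k ∧ ∀ k < k₂, ∑ j ∈ Finset.Ico k₁ k, g j ≤ M := by
  classical
  have hex : ∃ k₂, M < ∑ k ∈ Finset.Ico k₁ k₂, g k := by
    by_contra! hcon
    apply hdiv
    rw [← summable_nat_add_iff k₁]
    refine summable_of_sum_range_le (c := M) (fun k => hg _) fun n => ?_
    have h1 := hcon (k₁ + n)
    rw [Finset.sum_Ico_eq_sum_range] at h1
    simpa [add_comm] using h1
  refine ⟨Nat.find hex, Nat.find_spec hex, fun k hk => ?_⟩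
  exact not_lt.1 (Nat.find_min hex hk)

/-- Few points of a separated set are close to the balls of earlier levels. -/
theorem card_filter_earlier_le {A : ℕ → Finset ℝ} {N r : ℕ → ℝ} {c θ M ℓ : ℝ} {k₁ k : ℕ}
    (hN : ∀ k, 0 < N k) (hℓ : 0 < ℓ) (hr0 : ∀ k, 0 < r k) (hr : ∀ k, r k ≤ 1 / (2 * N k))
    (hgeo : ∑ j ∈ Finset.range k, N j ≤ c / 64 * N k)
    (hsep : ∀ a ∈ A k, ∀ b ∈ A k, a ≠ b → 1 / N k ≤ |a - b|)
    (hcard : ∀ j, k₁ ≤ j → ((A j).card : ℝ) ≤ ℓ * N j) (hθ0 : 0 ≤ θ)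
    (hθ : ∀ j, k₁ ≤ j → r j ≤ θ * f (r j)) (hM : ∑ j ∈ Finset.Ico k₁ k, N j * f (r j) ≤ M)
    (hθM : 2 * (θ * M) ≤ c / 16) :
    (((A k).filter fun a => ∃ j ∈ Finset.Ico k₁ k, ∃ b ∈ A j,
      |a - b| ≤ r k + r j + 1 / N k).card : ℝ) ≤ c / 8 * ℓ * N k := by
  classical
  have hNk := hN k
  have hrN : r k * N k ≤ 1 / 2 := by
    have := hr k
    rw [le_div_iff₀ (by positivity)] at this
    linarith
  have hsub : ((A k).filter fun a => ∃ j ∈ Finset.Ico k₁ k, ∃ b ∈ A j,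
      |a - b| ≤ r k + r j + 1 / N k) ⊆ (Finset.Ico k₁ k).biUnion fun j => (A j).biUnion fun b =>
      (A k).filter fun a => |a - b| ≤ r k + r j + 1 / N k := by
    intro a ha
    obtain ⟨haA, j, hj, b, hb, hab⟩ := Finset.mem_filter.1 ha
    exact Finset.mem_biUnion.2 ⟨j, hj, Finset.mem_biUnion.2 ⟨b, hb, Finset.mem_filter.2 ⟨haA, hab⟩⟩⟩
  have h1 : ∀ j ∈ Finset.Ico k₁ k, (((A j).biUnion fun b =>
      (A k).filter fun a => |a - b| ≤ r k + r j + 1 / N k).card : ℝ) ≤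
      ℓ * N j * (2 * r j * N k + 4) := by
    intro j hj
    have hrj := hr0 j
    calc (((A j).biUnion fun b =>
          (A k).filter fun a => |a - b| ≤ r k + r j + 1 / N k).card : ℝ)
        ≤ ∑ b ∈ A j, (((A k).filter fun a => |a - b| ≤ r k + r j + 1 / N k).card : ℝ) := by
          exact_mod_cast Finset.card_biUnion_le
      _ ≤ ∑ _b ∈ A j, (2 * r j * N k + 4) := by
          refine Finset.sum_le_sum fun b _ => ?_
          have hrk := hr0 k
          refine (card_filter_near_le hNk hsep b (by positivity)).trans ?_
          have : 2 * (r k + r j + 1 / N k) * N k = 2 * (r k * N k) + 2 * r j * N k + 2 := by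
            field_simp
          rw [this]
          linarith
      _ = (A j).card * (2 * r j * N k + 4) := by rw [Finset.sum_const, nsmul_eq_mul]
      _ ≤ _ := mul_le_mul_of_nonneg_right (hcard j (Finset.mem_Ico.1 hj).1) (by positivity)
  have h2 : (((A k).filter fun a => ∃ j ∈ Finset.Ico k₁ k, ∃ b ∈ A j,
      |a - b| ≤ r k + r j + 1 / N k).card : ℝ) ≤
      ∑ j ∈ Finset.Ico k₁ k, ℓ * N j * (2 * r j * N k + 4) := by
    refine le_trans ?_ (Finset.sum_le_sum h1)
    exact_mod_cast (Finset.card_le_card hsub).trans Finset.card_biUnion_le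
  refine h2.trans ?_
  have h3 : ∑ j ∈ Finset.Ico k₁ k, ℓ * N j * (2 * r j * N k + 4) =
      2 * ℓ * N k * ∑ j ∈ Finset.Ico k₁ k, N j * r j + 4 * ℓ * ∑ j ∈ Finset.Ico k₁ k, N j := by
    rw [Finset.mul_sum, Finset.mul_sum, ← Finset.sum_add_distrib]
    exact Finset.sum_congr rfl fun j _ => by ring
  have h4 : ∑ j ∈ Finset.Ico k₁ k, N j * r j ≤ θ * M := by
    refine le_trans ?_ (mul_le_mul_of_nonneg_left hM hθ0)
    rw [Finset.mul_sum]
    refine Finset.sum_le_sum fun j hj => ?_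
    have := mul_le_mul_of_nonneg_left (hθ j (Finset.mem_Ico.1 hj).1) (hN j).le
    linarith
  have h5 : ∑ j ∈ Finset.Ico k₁ k, N j ≤ c / 64 * N k := by
    refine le_trans (Finset.sum_le_sum_of_subset_of_nonneg ?_ fun j _ _ => (hN j).le) hgeo
    intro j hj
    exact Finset.mem_range.2 (Finset.mem_Ico.1 hj).2
  rw [h3]
  have h6 : 2 * ℓ * N k * ∑ j ∈ Finset.Ico k₁ k, N j * r j ≤ 2 * ℓ * N k * (θ * M) :=
    mul_le_mul_of_nonneg_left h4 (by positivity)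
  have h7 : 4 * ℓ * ∑ j ∈ Finset.Ico k₁ k, N j ≤ 4 * ℓ * (c / 64 * N k) :=
    mul_le_mul_of_nonneg_left h5 (by positivity)
  have h8 : ℓ * N k * (2 * (θ * M)) ≤ ℓ * N k * (c / 16) :=
    mul_le_mul_of_nonneg_left hθM (by positivity)
  nlinarith

/-- Finitely many levels of well separated points inside an interval, with the geometric
information needed to estimate the cost of a cover. -/
theorem IsBallSystem.exists_levels (h : IsBallSystem f 𝒜 N r c)
    (hflim : Tendsto (fun r : ℝ => r⁻¹ * f r) (𝓝[>] 0) atTop) {u w : ℝ} (hu : 0 ≤ u) (huw : u < w)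
    (hw : w ≤ 1) (k₀ : ℕ) {θ : ℝ} (hθ : 0 < θ) :
    ∃ k₁, k₀ ≤ k₁ ∧ ∃ A : ℕ → Finset ℝ, ∀ k, k₁ ≤ k →
      (∀ a ∈ A k, a ∈ 𝒜 k ∧ Metric.closedBall a (r k) ⊆ Icc u w) ∧
      (∀ a ∈ A k, ∀ b ∈ A k, a ≠ b → 1 / N k ≤ |a - b|) ∧
      c / 2 * (w - u) * N k ≤ (A k).card ∧ ((A k).card : ℝ) ≤ (w - u) * N k ∧
      r k ≤ θ * f (r k) := by
  obtain ⟨k₁, hk₁⟩ := h.separated (u + (w - u) / 4) (w - (w - u) / 4) (by linarith) (by linarith)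
    (by linarith)
  have hr := h.r_tendsto
  have e1 : ∀ᶠ k in atTop, r k ≤ (w - u) / 4 :=
    (tendsto_nhdsWithin_iff.1 hr).1.eventually_le_const (by linarith)
  have e2 : ∀ᶠ k in atTop, θ⁻¹ ≤ (r k)⁻¹ * f (r k) := (hflim.comp hr).eventually_ge_atTop _
  have e3 : ∀ᶠ k in atTop, 2 / (w - u) ≤ N k := h.N_tendsto.eventually_ge_atTop _
  obtain ⟨k₂, hk₂⟩ := eventually_atTop.1 (e1.and (e2.and e3))
  choose! A hA using hk₁
  refine ⟨max k₀ (max k₁ k₂), le_max_left _ _, A, fun k hk => ?_⟩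
  have hkk₁ : k₁ ≤ k := (le_max_left _ _).trans ((le_max_right _ _).trans hk)
  have hkk₂ : k₂ ≤ k := (le_max_right _ _).trans ((le_max_right _ _).trans hk)
  obtain ⟨hA1, hA2, hA3⟩ := hA k hkk₁
  obtain ⟨hr1, hr2, hr3⟩ := hk₂ k hkk₂
  have hNk := h.N_pos k
  have hrk := h.r_pos k
  refine ⟨fun a ha => ⟨(hA1 a ha).2, ?_⟩, hA2, ?_, ?_, ?_⟩
  · have := (hA1 a ha).1
    rw [Real.closedBall_eq_Icc]
    exact Icc_subset_Icc (by linarith [this.1]) (by linarith [this.2])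
  · refine le_trans (le_of_eq ?_) hA3
    ring
  · have h1 := card_le_of_separated (one_div_pos.2 hNk) (by linarith) (fun a ha => (hA1 a ha).1) hA2
    rw [div_div_eq_mul_div, div_one] at h1
    rw [div_le_iff₀ (by linarith)] at hr3
    nlinarith
  · rw [inv_mul_eq_div, le_div_iff₀ hrk, inv_mul_le_iff₀ hθ] at hr2
    exact hr2

/-- If every ball were almost covered, the points of many levels would each demand cost `f (r k) /
2`. Discarding those near long covering intervals or near earlier levels leaves a positive
proportion, among which no covering interval is charged more than three times. -/
theorem IsBallSystem.exists_ball [Countable ι] (h : IsBallSystem f 𝒜 N r c)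
    (hf0 : ∀ r, 0 < r → 0 < f r) (hfm : MonotoneOn f (Ioi 0))
    (hfa : AntitoneOn (fun r : ℝ => r⁻¹ * f r) (Ioi 0))
    (hflim : Tendsto (fun r : ℝ => r⁻¹ * f r) (𝓝[>] 0) atTop) {x s : ι → ℝ}
    (hs0 : ∀ i, 0 < s i) (hs1 : ∀ i, s i ≤ 1) (hsum : Summable fun i => f (s i)) {O : Set ℝ}
    (hO : IsOpen O) (hO1 : O ⊆ Icc 0 1)
    (hU : volume (O \ ⋃ i, Metric.ball (x i) (s i)) ≠ 0) (k₀ : ℕ) :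
    ∃ k, k₀ ≤ k ∧ ∃ a ∈ 𝒜 k, Metric.closedBall a (r k) ⊆ O ∧
      volume (Metric.closedBall a (r k) \ ⋃ i, Metric.ball (x i) (s i)) ≠ 0 := by
  classical
  by_contra! hcon
  have hf1 := hf0 1 one_pos
  have hc := h.c_pos
  have hss : Summable s := by
    refine Summable.of_nonneg_of_le (fun i => (hs0 i).le) (fun i => ?_) (hsum.mul_left (f 1)⁻¹)
    have h1 := hfa (mem_Ioi.2 (hs0 i)) (mem_Ioi.2 one_pos) (hs1 i)
    simp only [inv_one, one_mul] at h1
    rw [inv_mul_eq_div, le_div_iff₀ (hs0 i)] at h1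
    rw [inv_mul_eq_div, le_div_iff₀ hf1]
    linarith
  obtain ⟨u, w, huw, hI, hT⟩ := exists_interval_small_cover hs0 hss hO hU (η := c / 24) (by positivity)
  have hu : 0 ≤ u := (hO1 (hI (left_mem_Icc.2 huw.le))).1
  have hw : w ≤ 1 := (hO1 (hI (right_mem_Icc.2 huw.le))).2
  set ℓ := w - u with hℓ
  have hℓ0 : 0 < ℓ := by rw [hℓ]; linarith
  set Sf := ∑' i, f (s i)
  have hSf : 0 ≤ Sf := tsum_nonneg fun i => (hf0 _ (hs0 i)).le
  set M := 24 * Sf / (c * ℓ) + 1 with hM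
  have hM0 : 0 < M := by positivity
  -- Summation stops when the series first exceeds `M`. Until then `r j ≤ θ * f (r j)` keeps `∑ N j
  -- * r j` below `θ * M = c / 32`, so the earlier balls block few points.
  set θ := c / (32 * M) with hθ
  have hθ0 : 0 < θ := by positivity
  obtain ⟨k₁, hk₀₁, A, hA⟩ := h.exists_levels hflim hu huw hw k₀ hθ0
  obtain ⟨k₂, hk₂, hk₂'⟩ := exists_first_sum_gt
    (fun k => mul_nonneg (h.N_pos k).le (hf0 _ (h.r_pos k)).le) h.diverges k₁ (M := M)
  set X₁ : ℕ → Finset ℝ := fun k => (A k).filter fun a => ∃ i,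
    (Metric.ball (x i) (s i) ∩ Metric.closedBall a (r k)).Nonempty ∧ 1 / N k ≤ 2 * s i with hX₁
  set X₂ : ℕ → Finset ℝ := fun k => (A k).filter fun a => ∃ j ∈ Finset.Ico k₁ k, ∃ b ∈ A j,
      |a - b| ≤ r k + r j + 1 / N k with hX₂
  set G : ℕ → Finset ℝ := fun k => A k \ (X₁ k ∪ X₂ k) with hG
  have hGcard : ∀ k ∈ Finset.Ico k₁ k₂, c / 4 * ℓ * N k ≤ (G k).card := by
    intro k hk
    rw [Finset.mem_Ico] at hk
    obtain ⟨hA1, hA2, hA3, hA4, hA5⟩ := hA k hk.1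
    have h1 : ((X₁ k).card : ℝ) ≤ 3 * (c / 24 * ℓ) * N k :=
      card_filter_big_le (h.N_pos k) (h.r_pos k) (h.r_le k) hA2 (fun a ha => (hA1 a ha).2) hT
    have h2 : ((X₂ k).card : ℝ) ≤ c / 8 * ℓ * N k :=
      card_filter_earlier_le h.N_pos hℓ0 h.r_pos h.r_le (h.N_sum_le k) hA2
        (fun j hj => (hA j hj).2.2.2.1) hθ0.le (fun j hj => (hA j hj).2.2.2.2) (hk₂' k hk.2) (by
          rw [hθ]; apply le_of_eq; field_simp; norm_num)
    have h3 : ((A k).card : ℝ) ≤ (G k).card + ((X₁ k).card + (X₂ k).card) := by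
      have h4 : (A k).card ≤ (G k).card + ((X₁ k).card + (X₂ k).card) := by
        have h5 := Finset.le_card_sdiff (X₁ k ∪ X₂ k) (A k)
        have h6 := Finset.card_union_le (X₁ k) (X₂ k)
        simp only [hG]
        omega
      exact_mod_cast h4
    linarith
  have hGA : ∀ k, ∀ a ∈ G k, a ∈ A k := fun k a ha => (Finset.mem_sdiff.1 ha).1
  have hcost : ∀ k a, ∃ T : Finset ι, k ∈ Finset.Ico k₁ k₂ → a ∈ G k →
      (∀ i ∈ T, (Metric.ball (x i) (s i) ∩ Metric.closedBall a (r k)).Nonempty) ∧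
      f (r k) / 2 ≤ ∑ i ∈ T, f (s i) := by
    intro k a
    by_cases hka : k ∈ Finset.Ico k₁ k₂ ∧ a ∈ G k
    · obtain ⟨hk, ha⟩ := hka
      have hk1 := (Finset.mem_Ico.1 hk).1
      have ha' := (hA k hk1).1 a (hGA k a ha)
      obtain ⟨T, hT⟩ := exists_finset_cost hf0 hfm hfa hs0 (h.r_pos k)
        (hcon k (hk₀₁.trans hk1) a ha'.1 (ha'.2.trans hI))
      exact ⟨T, fun _ _ => hT⟩
    · exact ⟨∅, fun h1 h2 => absurd ⟨h1, h2⟩ hka⟩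
  choose T hT' using hcost
  set P : Finset (Σ _ : ℕ, ℝ) := (Finset.Ico k₁ k₂).sigma G with hP
  have hsmall : ∀ k ∈ Finset.Ico k₁ k₂, ∀ a ∈ G k, ∀ i ∈ T k a, 2 * s i < 1 / N k := by
    intro k hk a ha i hi
    by_contra! hbig
    refine (Finset.mem_sdiff.1 ha).2 (Finset.mem_union_left _ (Finset.mem_filter.2
      ⟨hGA k a ha, i, (hT' k a hk ha).1 i hi, hbig⟩))
  have hdist : ∀ k ∈ Finset.Ico k₁ k₂, ∀ a ∈ G k, ∀ i ∈ T k a, |a - x i| ≤ r k + s i :=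
    fun k hk a ha i hi => abs_sub_le_of_inter_nonempty ((hT' k a hk ha).1 i hi)
  -- A covering interval shorter than `1 / N k` that serves two levels would bring the later point
  -- close to an earlier ball, and such points were removed.
  have hlevel : ∀ i, ∀ k ∈ Finset.Ico k₁ k₂, ∀ a ∈ G k, i ∈ T k a →
      ∀ j ∈ Finset.Ico k₁ k₂, ∀ b ∈ G j, i ∈ T j b → ¬ j < k := by
    intro i k hk a ha hi j hj b hb hi' hjk
    refine (Finset.mem_sdiff.1 ha).2 (Finset.mem_union_right _ (Finset.mem_filter.2
      ⟨hGA k a ha, j, Finset.mem_Ico.2 ⟨(Finset.mem_Ico.1 hj).1, hjk⟩, b, hGA j b hb, ?_⟩))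
    have h1 := hdist k hk a ha i hi
    have h2 := hdist j hj b hb i hi'
    have h3 := hsmall k hk a ha i hi
    have h4 := abs_sub_le a (x i) b
    rw [abs_sub_comm] at h2
    linarith
  -- Within the one remaining level, the served points lie within `1 / N k` of `x i` and are `1 / N
  -- k`-separated.
  have hmult : ∀ i, (Set.ncard {p : Σ _ : ℕ, ℝ | p ∈ P ∧ i ∈ T p.1 p.2} : ℝ) ≤ 3 := by
    intro i
    by_cases hne : ({p : Σ _ : ℕ, ℝ | p ∈ P ∧ i ∈ T p.1 p.2}).Nonempty
    · obtain ⟨⟨k, a⟩, hp, hi⟩ := hne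
      obtain ⟨hk, ha⟩ := Finset.mem_sigma.1 hp
      have hsub : {p : Σ _ : ℕ, ℝ | p ∈ P ∧ i ∈ T p.1 p.2} ⊆
          (fun b => (⟨k, b⟩ : Σ _ : ℕ, ℝ)) ''
            (((A k).filter fun b => |b - x i| ≤ 1 / N k : Finset ℝ) : Set ℝ) := by
        rintro ⟨j, b⟩ ⟨hp', hi'⟩
        obtain ⟨hj, hb⟩ := Finset.mem_sigma.1 hp'
        have hjk : j = k := le_antisymm (not_lt.1 (hlevel i j hj b hb hi' k hk a ha hi))
          (not_lt.1 (hlevel i k hk a ha hi j hj b hb hi'))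
        simp only at hj hb hi'
        subst hjk
        refine ⟨b, ?_, rfl⟩
        rw [SetLike.mem_coe, Finset.mem_filter]
        refine ⟨hGA j b hb, ?_⟩
        have h1 := hdist j hj b hb i hi'
        have h2 := hsmall j hj b hb i hi'
        have h3 := h.r_le j
        have h4 : 1 / (2 * N j) = 1 / N j / 2 := by field_simp
        linarith
      have hN := h.N_pos k
      have h5 := card_filter_near_le hN (hA k (Finset.mem_Ico.1 hk).1).2.1 (x i)
        (one_div_pos.2 hN).le
      have h6 : 2 * (1 / N k) * N k + 1 = 3 := by field_simp; norm_num
      rw [h6] at h5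
      refine le_trans ?_ h5
      have h7 := Set.ncard_le_ncard hsub ((Finset.finite_toSet _).image _)
      have h8 := h7.trans (Set.ncard_image_le (Finset.finite_toSet _))
      rw [Set.ncard_coe_finset] at h8
      exact_mod_cast h8
    · rw [Set.not_nonempty_iff_eq_empty.1 hne]
      simp
  have hdc := sum_sum_le_mul_sum P (fun p => T p.1 p.2) (fun i => (hf0 _ (hs0 i)).le) hsum hmult
  have hlow : c / 8 * ℓ * ∑ k ∈ Finset.Ico k₁ k₂, N k * f (r k) ≤
      ∑ p ∈ P, ∑ i ∈ T p.1 p.2, f (s i) := by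
    rw [hP, Finset.sum_sigma, Finset.mul_sum]
    refine Finset.sum_le_sum fun k hk => ?_
    have hfk := hf0 _ (h.r_pos k)
    calc c / 8 * ℓ * (N k * f (r k)) = c / 4 * ℓ * N k * (f (r k) / 2) := by ring
      _ ≤ (G k).card * (f (r k) / 2) := mul_le_mul_of_nonneg_right (hGcard k hk) (by positivity)
      _ = ∑ _a ∈ G k, f (r k) / 2 := by rw [Finset.sum_const, nsmul_eq_mul]
      _ ≤ _ := Finset.sum_le_sum fun a ha => (hT' k a hk ha).2
  have hfin : c / 8 * ℓ * M < 3 * Sf :=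
    lt_of_lt_of_le (mul_lt_mul_of_pos_left hk₂ (by positivity)) (hlow.trans hdc)
  have : c / 8 * ℓ * M = 3 * Sf + c / 8 * ℓ := by
    rw [hM]; field_simp; ring
  have : 0 < c / 8 * ℓ := by positivity
  linarith

end BallSystem

/-! ### Nested balls and the lower bound for covers -/

section Nested

open MeasureTheory

variable {ι : Type*} {f : ℝ → ℝ} {𝒜 : ℕ → Set ℝ} {N r : ℕ → ℝ} {c : ℝ}

/-- Removing the centre forces the limit point of the nested balls to differ from every centre. -/
theorem volume_punctured_ball_diff_ne_zero {a ρ : ℝ} {U : Set ℝ}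
    (h : volume (Metric.closedBall a ρ \ U) ≠ 0) : volume ((Metric.ball a ρ \ {a}) \ U) ≠ 0 := by
  intro h0
  apply h
  have hfin : volume ({a - ρ, a, a + ρ} : Set ℝ) = 0 :=
    (Set.toFinite ({a - ρ, a, a + ρ} : Set ℝ)).measure_zero volume
  refine measure_mono_null (t := ((Metric.ball a ρ \ {a}) \ U) ∪ {a - ρ, a, a + ρ}) ?_
    (measure_union_null h0 hfin)
  rintro y ⟨hy, hyU⟩
  by_cases hmem : y ∈ ({a - ρ, a, a + ρ} : Set ℝ)
  · exact Or.inr hmem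
  left
  simp only [mem_insert_iff, mem_singleton_iff, not_or] at hmem
  rw [Real.closedBall_eq_Icc] at hy
  refine ⟨⟨?_, hmem.2.1⟩, hyU⟩
  rw [Real.ball_eq_Ioo]
  exact ⟨lt_of_le_of_ne hy.1 (Ne.symm hmem.1), lt_of_le_of_ne hy.2 hmem.2.2⟩

/-- Iterate `IsBallSystem.exists_ball` in punctured balls. The common point avoids the open union,
since otherwise a late ball would be wholly covered. If the centres formed a finite set, their limit
would be one of them, which puncturing excludes. -/
theorem IsBallSystem.exists_notMem_cover [Countable ι] (h : IsBallSystem f 𝒜 N r c)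
    (hf0 : ∀ r, 0 < r → 0 < f r) (hfm : MonotoneOn f (Ioi 0))
    (hfa : AntitoneOn (fun r : ℝ => r⁻¹ * f r) (Ioi 0))
    (hflim : Tendsto (fun r : ℝ => r⁻¹ * f r) (𝓝[>] 0) atTop) {x s : ι → ℝ}
    (hs0 : ∀ i, 0 < s i) (hs1 : ∀ i, s i ≤ 1) (hsum : Summable fun i => f (s i))
    (hU : volume (⋃ i, Metric.ball (x i) (s i)) < 1) :
    ∃ ξ ∈ Icc (0 : ℝ) 1, ξ ∉ ⋃ i, Metric.ball (x i) (s i) ∧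
      {a | ∃ k, a ∈ 𝒜 k ∧ |ξ - a| ≤ r k}.Infinite := by
  set U := ⋃ i, Metric.ball (x i) (s i) with hUdef
  have hball := fun (O : Set ℝ) (hO : IsOpen O) (hO1 : O ⊆ Icc 0 1) =>
    h.exists_ball hf0 hfm hfa hflim hs0 hs1 hsum hO hO1 (x := x)
  have hstart : volume (Ioo (0 : ℝ) 1 \ U) ≠ 0 := by
    intro h0
    have h1 := measure_le_inter_add_sdiff volume (Ioo (0 : ℝ) 1) U
    rw [h0, add_zero, Real.volume_Ioo, sub_zero, ENNReal.ofReal_one] at h1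
    exact absurd ((h1.trans (measure_mono inter_subset_right))) (not_le.2 hU)
  obtain ⟨k₀, -, a₀, ha₀, hsub₀, hvol₀⟩ := hball _ isOpen_Ioo Ioo_subset_Icc_self hstart 0
  let S := {p : ℕ × ℝ // p.2 ∈ 𝒜 p.1 ∧ Metric.closedBall p.2 (r p.1) ⊆ Icc 0 1 ∧
    volume (Metric.closedBall p.2 (r p.1) \ U) ≠ 0}
  have hnext : ∀ p : S, ∃ q : S, p.1.1 < q.1.1 ∧
      Metric.closedBall q.1.2 (r q.1.1) ⊆ Metric.ball p.1.2 (r p.1.1) \ {p.1.2} := by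
    rintro ⟨⟨k, a⟩, ha, hsub, hvol⟩
    obtain ⟨j, hj, b, hb, hbsub, hbvol⟩ := hball (Metric.ball a (r k) \ {a})
      (Metric.isOpen_ball.sdiff isClosed_singleton)
      (sdiff_subset.trans (Metric.ball_subset_closedBall.trans hsub))
      (volume_punctured_ball_diff_ne_zero hvol) (k + 1)
    exact ⟨⟨⟨j, b⟩, hb, hbsub.trans
      (sdiff_subset.trans (Metric.ball_subset_closedBall.trans hsub)), hbvol⟩, hj, hbsub⟩
  choose next hnext1 hnext2 using hnext
  let p₀ : S := ⟨⟨k₀, a₀⟩, ha₀, hsub₀.trans Ioo_subset_Icc_self, hvol₀⟩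
  let p : ℕ → S := fun n => Nat.rec p₀ (fun _ q => next q) n
  have hp : ∀ n, p (n + 1) = next (p n) := fun n => rfl
  set a : ℕ → ℝ := fun n => (p n).1.2 with ha
  set R : ℕ → ℝ := fun n => r (p n).1.1 with hR
  have hkmono : StrictMono fun n => (p n).1.1 :=
    strictMono_nat_of_lt_succ fun n => by rw [hp]; exact hnext1 _
  have hsubset : ∀ n, Metric.closedBall (a (n + 1)) (R (n + 1)) ⊆ Metric.ball (a n) (R n) \ {a n} := by
    intro n
    simp only [ha, hR, hp]
    exact hnext2 _
  have hRlim : Tendsto R atTop (𝓝 0) :=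
    (tendsto_nhdsWithin_iff.1 h.r_tendsto).1.comp hkmono.tendsto_atTop
  obtain ⟨ξ, hξ⟩ := IsCompact.nonempty_iInter_of_sequence_nonempty_isCompact_isClosed
    (fun n => Metric.closedBall (a n) (R n))
    (fun n => (hsubset n).trans (sdiff_subset.trans Metric.ball_subset_closedBall))
    (fun n => Metric.nonempty_closedBall.2 (h.r_pos _).le) (isCompact_closedBall _ _)
    (fun n => Metric.isClosed_closedBall)
  rw [mem_iInter] at hξ
  have hdist : ∀ n, |ξ - a n| ≤ R n := fun n => by
    have := hξ n
    rwa [Metric.mem_closedBall, Real.dist_eq] at this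
  have halim : Tendsto a atTop (𝓝 ξ) := by
    rw [tendsto_iff_dist_tendsto_zero]
    refine squeeze_zero (fun _ => dist_nonneg) (fun n => ?_) hRlim
    rw [dist_comm, Real.dist_eq]
    exact hdist n
  refine ⟨ξ, (p 0).2.2.1 (hξ 0), ?_, ?_⟩
  · intro hmem
    have hUo : IsOpen U := isOpen_iUnion fun i => Metric.isOpen_ball
    obtain ⟨δ, hδ, hδU⟩ := Metric.isOpen_iff.1 hUo ξ hmem
    obtain ⟨n, hn⟩ := (hRlim.eventually_lt_const (half_pos hδ)).exists
    refine (p n).2.2.2 ?_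
    rw [sdiff_eq_empty.2, measure_empty]
    refine Subset.trans ?_ hδU
    intro y hy
    change y ∈ Metric.closedBall (a n) (R n) at hy
    rw [Metric.mem_closedBall] at hy
    rw [Metric.mem_ball]
    have h1 := dist_triangle_right y ξ (a n)
    have h2 := hξ n
    rw [Metric.mem_closedBall] at h2
    linarith
  · intro hfin
    have hrange : (range a).Finite := hfin.subset (by
      rintro _ ⟨n, rfl⟩
      exact ⟨(p n).1.1, (p n).2.1, hdist n⟩)
    obtain ⟨n, hn⟩ := hrange.isClosed.mem_of_tendsto halim
      (Eventually.of_forall fun n => mem_range_self n)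
    exact (hsubset n (hξ (n + 1))).2 hn.symm

/-- For radii at most `ρ`, length is at most `ρ / f ρ` times cost up to the factor 2. A cheaper
cover would thus have total length below 1, and some point of `E` escapes it. -/
theorem IsBallSystem.le_hausdorffPre (h : IsBallSystem f 𝒜 N r c)
    (hf0 : ∀ r, 0 < r → 0 < f r) (hfm : MonotoneOn f (Ioi 0))
    (hfa : AntitoneOn (fun r : ℝ => r⁻¹ * f r) (Ioi 0))
    (hflim : Tendsto (fun r : ℝ => r⁻¹ * f r) (𝓝[>] 0) atTop) {E : Set ℝ}
    (hE : ∀ ξ ∈ Icc (0 : ℝ) 1, {a | ∃ k, a ∈ 𝒜 k ∧ |ξ - a| ≤ r k}.Infinite → ξ ∈ E) {ρ : ℝ}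
    (hρ : 0 < ρ) (hρ1 : ρ ≤ 1) :
    ENNReal.ofReal (ρ⁻¹ * f ρ / 2) ≤ hausdorffPre f ρ E := by
  refine le_iInf₂ fun S hS => ?_
  by_contra! hlt
  have hfρ := hf0 ρ hρ
  have : Countable S := hS.countable.to_subtype
  have hne : ∑' b : S, ENNReal.ofReal (f b.1.2) ≠ ∞ := ne_top_of_lt hlt
  have hnn : ∀ b : S, 0 ≤ f b.1.2 := fun b => (hf0 _ (hS.radius_pos _ b.2)).le
  have hsum : Summable fun b : S => f b.1.2 := by
    have := ENNReal.summable_toReal hne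
    refine this.congr fun b => ENNReal.toReal_ofReal (hnn b)
  have hvol : volume (⋃ b : S, Metric.ball b.1.1 b.1.2) < 1 := by
    refine lt_of_le_of_lt (measure_iUnion_le _) ?_
    have hle : ∀ b : S, volume (Metric.ball b.1.1 b.1.2) ≤
        ENNReal.ofReal (2 * (ρ / f ρ)) * ENNReal.ofReal (f b.1.2) := by
      intro b
      rw [Real.volume_ball, ← ENNReal.ofReal_mul (by positivity)]
      refine ENNReal.ofReal_le_ofReal ?_
      have hb0 := hS.radius_pos _ b.2
      have h1 := hfa (mem_Ioi.2 hb0) (mem_Ioi.2 hρ) (hS.radius_le _ b.2)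
      simp only at h1
      rw [inv_mul_eq_div, inv_mul_eq_div, div_le_div_iff₀ hρ hb0] at h1
      have h2 : b.1.2 ≤ ρ / f ρ * f b.1.2 := by
        rw [div_mul_eq_mul_div, le_div_iff₀ hfρ]; linarith
      linarith
    refine lt_of_le_of_lt (ENNReal.tsum_le_tsum hle) ?_
    rw [ENNReal.tsum_mul_left]
    have h3 : ENNReal.ofReal (2 * (ρ / f ρ)) * ENNReal.ofReal (ρ⁻¹ * f ρ / 2) = 1 := by
      rw [← ENNReal.ofReal_mul (by positivity), ← ENNReal.ofReal_one]
      congr 1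
      field_simp
    rw [← h3]
    refine ENNReal.mul_lt_mul_right (by simp; positivity) ENNReal.ofReal_ne_top hlt
  obtain ⟨ξ, hξ, hξU, hinf⟩ := h.exists_notMem_cover hf0 hfm hfa hflim
    (fun b : S => hS.radius_pos _ b.2) (fun b => (hS.radius_le _ b.2).trans hρ1) hsum hvol
  apply hξU
  have := hS.subset (hE ξ hξ hinf)
  simp only [mem_iUnion] at this ⊢
  obtain ⟨b, hb, hξb⟩ := this
  exact ⟨⟨b, hb⟩, hξb⟩

theorem hausdorffF_eq_top_of_le {f : ℝ → ℝ}
    (hflim : Tendsto (fun r : ℝ => r⁻¹ * f r) (𝓝[>] 0) atTop) {E : Set ℝ}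
    (h : ∀ ρ : ℝ, 0 < ρ → ρ ≤ 1 → ENNReal.ofReal (ρ⁻¹ * f ρ / 2) ≤ hausdorffPre f ρ E) :
    hausdorffF f E = ∞ := by
  refine ENNReal.eq_top_of_forall_nnreal_le fun M => ?_
  obtain ⟨ρ, hM, hρ⟩ := ((hflim.eventually_ge_atTop (2 * (M : ℝ))).and
    (Ioc_mem_nhdsGT one_pos)).exists
  refine le_trans ?_ (le_iSup₂ (f := fun (ρ : ℝ) (_ : 0 < ρ) => hausdorffPre f ρ E) ρ hρ.1)
  refine le_trans ?_ (h ρ hρ.1 hρ.2)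
  rw [← ENNReal.ofReal_coe_nnreal]
  exact ENNReal.ofReal_le_ofReal (by linarith)

end Nested

/-! ### The divergence case -/

section Divergence

/-- Cauchy condensation along powers of `b`; a base larger than 2 is needed for the rapid growth of
`N`. -/
theorem sum_Ico_pow_le {g : ℕ → ℝ} {b d : ℕ} (hb : 1 ≤ b) (hg0 : ∀ n, 1 ≤ n → 0 ≤ g n)
    (hg : ∀ m n, 1 ≤ m → m ≤ n → g n ≤ g m) (K : ℕ) :
    ∑ n ∈ Finset.Ico 1 (b ^ K), g n * (n : ℝ) ^ d ≤
      (b : ℝ) ^ (d + 1) * ∑ k ∈ Finset.range K, ((b ^ k : ℕ) : ℝ) ^ (d + 1) * g (b ^ k) := by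
  induction K with
  | zero => simp
  | succ K ih =>
    have h1 : 1 ≤ b ^ K := Nat.one_le_pow _ _ hb
    have h2 : b ^ K ≤ b ^ (K + 1) := Nat.pow_le_pow_right hb (Nat.le_succ K)
    rw [← Finset.sum_Ico_consecutive _ h1 h2, Finset.sum_range_succ, mul_add]
    refine add_le_add ih ?_
    have hgK := hg0 _ h1
    calc ∑ n ∈ Finset.Ico (b ^ K) (b ^ (K + 1)), g n * (n : ℝ) ^ d
        ≤ ∑ _n ∈ Finset.Ico (b ^ K) (b ^ (K + 1)), g (b ^ K) * ((b ^ (K + 1) : ℕ) : ℝ) ^ d := by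
          refine Finset.sum_le_sum fun n hn => ?_
          obtain ⟨hn1, hn2⟩ := Finset.mem_Ico.1 hn
          refine mul_le_mul (hg _ _ h1 hn1) ?_ (by positivity) hgK
          exact pow_le_pow_left₀ (by positivity) (by exact_mod_cast hn2.le) _
      _ = ((b ^ (K + 1) - b ^ K : ℕ) : ℝ) * (g (b ^ K) * ((b ^ (K + 1) : ℕ) : ℝ) ^ d) := by
          rw [Finset.sum_const, Nat.card_Ico, nsmul_eq_mul]
      _ ≤ ((b ^ (K + 1) : ℕ) : ℝ) * (g (b ^ K) * ((b ^ (K + 1) : ℕ) : ℝ) ^ d) := by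
          refine mul_le_mul_of_nonneg_right ?_ (by positivity)
          exact_mod_cast Nat.sub_le _ _
      _ = _ := by push_cast; ring

theorem summable_of_summable_condensed {g : ℕ → ℝ} {b d : ℕ} (hb : 2 ≤ b)
    (hg0 : ∀ n, 1 ≤ n → 0 ≤ g n) (hg : ∀ m n, 1 ≤ m → m ≤ n → g n ≤ g m)
    (h : Summable fun k => ((b ^ k : ℕ) : ℝ) ^ (d + 1) * g (b ^ k)) :
    Summable fun n : ℕ => g (n + 1) * ((n + 1 : ℕ) : ℝ) ^ d := by
  have hnn : ∀ k, 0 ≤ ((b ^ k : ℕ) : ℝ) ^ (d + 1) * g (b ^ k) := fun k =>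
    mul_nonneg (by positivity) (hg0 _ (Nat.one_le_pow _ _ (by omega)))
  refine summable_of_sum_range_le (c := (b : ℝ) ^ (d + 1) *
    ∑' k, ((b ^ k : ℕ) : ℝ) ^ (d + 1) * g (b ^ k)) (fun n => ?_) fun m => ?_
  · exact mul_nonneg (hg0 _ (by omega)) (by positivity)
  · have h1 : ∑ n ∈ Finset.range m, g (n + 1) * ((n + 1 : ℕ) : ℝ) ^ d =
        ∑ n ∈ Finset.Ico 1 (m + 1), g n * (n : ℝ) ^ d := by
      rw [Finset.sum_Ico_eq_sum_range]
      simp [add_comm]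
    rw [h1]
    have hm : m + 1 ≤ b ^ m := Nat.lt_pow_self (by omega)
    refine le_trans (Finset.sum_le_sum_of_subset_of_nonneg (Finset.Ico_subset_Ico_right hm)
      fun n hn _ => ?_) ((sum_Ico_pow_le (by omega) hg0 hg m).trans ?_)
    · exact mul_nonneg (hg0 _ (Finset.mem_Ico.1 hn).1) (by positivity)
    · exact mul_le_mul_of_nonneg_left (h.sum_le_tsum _ fun k _ => hnn k) (by positivity)

/-- The balls around algebraic numbers of height at most `b ^ k` form a ball system. -/
theorem exists_isBallSystem {d : ℕ} (hd : 1 ≤ d) {f ψ : ℝ → ℝ} (hf : IsDimensionFunction f)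
    (hflim : Tendsto (fun r : ℝ => r⁻¹ * f r) (𝓝[>] 0) atTop)
    (hfa : AntitoneOn (fun r : ℝ => r⁻¹ * f r) (Ioi 0)) (hψ : IsApproximatingFunction ψ)
    (hdiv : ¬ Summable (fun r : ℕ => f (ψ ((r + 1 : ℕ) : ℝ)) * ((r + 1 : ℕ) : ℝ) ^ d)) :
    ∃ (b : ℕ) (N r : ℕ → ℝ) (c : ℝ), 2 ≤ b ∧ (∀ k, r k < ψ ((b ^ k : ℕ) : ℝ)) ∧
      IsBallSystem f (fun k => {a | a ∈ algNumbers ℝ d ∧ algHeight a ≤ b ^ k}) N r c := by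
  obtain ⟨c, hc, hsep⟩ := exists_separated_algNumbers hd
  -- The base exceeds `64 / c + 1`, so the geometric sum of earlier `N j` is at most `c / 64 * N k`.
  obtain ⟨b', hb'⟩ := exists_nat_gt (64 / c + 1)
  set b := max b' 2 with hb
  have hb2 : 2 ≤ b := le_max_right _ _
  have hbR : (2 : ℝ) ≤ b := by exact_mod_cast hb2
  have hbc : 64 / c + 1 ≤ b := hb'.le.trans (by exact_mod_cast le_max_left _ _)
  have hpow : ∀ k, 1 ≤ b ^ k := fun k => Nat.one_le_pow _ _ (by omega)
  have hpow0 : ∀ k, (0 : ℝ) < ((b ^ k : ℕ) : ℝ) := fun k => by exact_mod_cast hpow k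
  set N : ℕ → ℝ := fun k => ((b ^ k : ℕ) : ℝ) ^ (d + 1) with hN
  have hN0 : ∀ k, 0 < N k := fun k => pow_pos (hpow0 k) _
  -- The cap keeps balls shorter than the spacing; halving `t` then gives the strict inequality `r k
  -- < ψ (b ^ k)`.
  set t : ℕ → ℝ := fun k => min (ψ ((b ^ k : ℕ) : ℝ)) (1 / N k) with ht
  have hψ0 : ∀ k, 0 < ψ ((b ^ k : ℕ) : ℝ) := fun k => hψ.pos _ (hpow0 k)
  have ht0 : ∀ k, 0 < t k := fun k => lt_min (hψ0 k) (one_div_pos.2 (hN0 k))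
  have hNlim : Tendsto N atTop atTop := by
    refine (tendsto_pow_atTop (by omega : d + 1 ≠ 0)).comp ?_
    refine tendsto_natCast_atTop_atTop.comp ?_
    exact tendsto_pow_atTop_atTop_of_one_lt (by omega)
  refine ⟨b, N, fun k => t k / 2, c, hb2, fun k => ?_, ?_⟩
  · have := min_le_left (ψ ((b ^ k : ℕ) : ℝ)) (1 / N k)
    have h2 := ht0 k
    have h3 : t k ≤ ψ ((b ^ k : ℕ) : ℝ) := this
    linarith
  refine ⟨hc, hN0, hNlim, ?_, fun k => half_pos (ht0 k), ?_, ?_, ?_⟩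
  · intro k
    set B : ℝ := (b : ℝ) ^ (d + 1) with hB
    have hNB : ∀ j, N j = B ^ j := fun j => by
      simp only [hN, hB]; push_cast; rw [← pow_mul, ← pow_mul, mul_comm]
    have hBb : (b : ℝ) ≤ B := le_self_pow₀ (by linarith) (by omega)
    simp only [hNB]
    have h1 := geom_sum_mul B k
    have hS : 0 ≤ ∑ j ∈ Finset.range k, B ^ j :=
      Finset.sum_nonneg fun j _ => pow_nonneg (by linarith) j
    have h2 : (∑ j ∈ Finset.range k, B ^ j) * (64 / c) ≤ B ^ k := by
      have := mul_le_mul_of_nonneg_left (show 64 / c ≤ B - 1 by linarith) hS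
      linarith
    rw [mul_div_assoc', div_le_iff₀ hc] at h2
    linarith
  · intro k
    have h3 : t k ≤ 1 / N k := min_le_right _ _
    have h4 : 1 / (2 * N k) = 1 / N k / 2 := by
      have := hN0 k
      field_simp
    linarith
  · intro hsum
    apply hdiv
    have hhalf : ∀ k, f (t k) / 2 ≤ f (t k / 2) := by
      intro k
      have h1 := hfa (mem_Ioi.2 (half_pos (ht0 k))) (mem_Ioi.2 (ht0 k)) (half_le_self (ht0 k).le)
      simp only at h1
      have h2 := ht0 k
      rw [inv_mul_eq_div, inv_mul_eq_div, div_le_div_iff₀ h2 (half_pos h2)] at h1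
      nlinarith
    have hsum2 : Summable fun k => N k * f (t k) := by
      refine Summable.of_nonneg_of_le (fun k => mul_nonneg (hN0 k).le (hf.pos _ (ht0 k)).le)
        (fun k => ?_) (hsum.mul_left 2)
      have := mul_le_mul_of_nonneg_left (hhalf k) (hN0 k).le
      linarith
    have hinv : Tendsto (fun k => 1 / N k) atTop (𝓝[>] 0) := by
      refine tendsto_nhdsWithin_iff.2 ⟨?_, Eventually.of_forall fun k => one_div_pos.2 (hN0 k)⟩
      exact tendsto_const_nhds.div_atTop hNlim
    -- The cap does not spoil divergence: where it is active and `k` is large, the term is `N k * f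
    -- (1 / N k) ≥ 1`. In a convergent series it is therefore eventually inactive.
    have e1 : ∀ᶠ k in atTop, 1 ≤ (1 / N k)⁻¹ * f (1 / N k) :=
      (hflim.comp hinv).eventually_ge_atTop 1
    have e2 : ∀ᶠ k in atTop, N k * f (t k) < 1 :=
      hsum2.tendsto_atTop_zero.eventually_lt_const one_pos
    have e3 : ∀ᶠ k in atTop, N k * f (t k) = N k * f (ψ ((b ^ k : ℕ) : ℝ)) := by
      filter_upwards [e1, e2] with k h1 h2
      rcases min_choice (ψ ((b ^ k : ℕ) : ℝ)) (1 / N k) with h | h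
      · simp only [ht]; rw [h]
      · exfalso
        have h3 : t k = 1 / N k := h
        rw [h3] at h2
        rw [one_div, inv_inv] at h1
        rw [one_div] at h2
        linarith
    obtain ⟨k₀, hk₀⟩ := eventually_atTop.1 e3
    have hsum3 : Summable fun k => N k * f (ψ ((b ^ k : ℕ) : ℝ)) := by
      rw [← summable_nat_add_iff k₀] at hsum2 ⊢
      exact hsum2.congr fun k => hk₀ _ (Nat.le_add_left _ _)
    have hpos : ∀ n : ℕ, 1 ≤ n → (0 : ℝ) < n := fun n hn => by exact_mod_cast hn
    refine summable_of_summable_condensed (g := fun n : ℕ => f (ψ (n : ℝ))) hb2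
      (fun n hn => (hf.pos _ (hψ.pos _ (hpos n hn))).le) (fun m n hm hmn => ?_) hsum3
    have hn := hpos n (hm.trans hmn)
    exact hf.monotoneOn (mem_Ioi.2 (hψ.pos _ hn)) (mem_Ioi.2 (hψ.pos _ (hpos m hm)))
      (hψ.antitoneOn (mem_Ioi.2 (hpos m hm)) (mem_Ioi.2 hn) (by exact_mod_cast hmn))
  · intro u w hu huw hw
    obtain ⟨X₀, hX₀⟩ := hsep u w hu huw hw
    refine ⟨X₀, fun k hk => ?_⟩
    obtain ⟨A, hA1, hA2, hA3⟩ := hX₀ (b ^ k) (hk.trans (Nat.lt_pow_self (by omega)).le)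
    exact ⟨A, hA1, hA2, hA3⟩

theorem hausdorffF_algApprox_eq_top (𝕜 : Type*) [RCLike 𝕜] {d : ℕ} (hd : 1 ≤ d) {f ψ : ℝ → ℝ}
    (hf : IsDimensionFunction f)
    (hflim : Tendsto (fun r : ℝ => r⁻¹ * f r) (𝓝[>] 0) atTop)
    (hfa : AntitoneOn (fun r : ℝ => r⁻¹ * f r) (Ioi 0)) (hψ : IsApproximatingFunction ψ)
    (hdiv : ¬ Summable (fun r : ℕ => f (ψ ((r + 1 : ℕ) : ℝ)) * ((r + 1 : ℕ) : ℝ) ^ d)) :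
    hausdorffF f (algApprox 𝕜 d ψ) = ∞ := by
  obtain ⟨b, N, r, c, hb, hr, hsys⟩ := exists_isBallSystem hd hf hflim hfa hψ hdiv
  refine hausdorffF_eq_top_of_le hflim fun ρ hρ hρ1 => ?_
  refine hsys.le_hausdorffPre hf.pos hf.monotoneOn hfa hflim (fun ξ hξ hinf => ?_) hρ hρ1
  refine ⟨hξ, ?_⟩
  refine (hinf.image (f := fun a : ℝ => (a : 𝕜)) RCLike.ofReal_injective.injOn).mono ?_
  rintro _ ⟨a, ⟨k, ⟨ha, hak⟩, hξa⟩, rfl⟩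
  refine ⟨ofReal_mem_algNumbers 𝕜 ha, ?_⟩
  simp only
  rw [← RCLike.ofReal_sub, RCLike.norm_ofReal, algHeight_ofReal]
  have h1 : (0 : ℝ) < algHeight a := by exact_mod_cast one_le_algHeight a
  have h2 : ((algHeight a : ℕ) : ℝ) ≤ ((b ^ k : ℕ) : ℝ) := by exact_mod_cast hak
  exact lt_of_le_of_lt hξa ((hr k).trans_le
    (hψ.antitoneOn (mem_Ioi.2 h1) (mem_Ioi.2 (h1.trans_le h2)) h2))

end Divergence

/-! ### The convergence case -/

section Convergence

variable (𝕜 : Type*) [RCLike 𝕜]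

/-- The balls with real centres that cover the points close to algebraic numbers of height `n`. -/
def heightCover (d : ℕ) (ψ : ℝ → ℝ) (n : ℕ) : Set (ℝ × ℝ) :=
  (fun a : 𝕜 => (RCLike.re a, ψ n)) '' {a : 𝕜 | a ∈ algNumbers 𝕜 d ∧ algHeight a = n}

theorem tsum_heightCover_le (d : ℕ) (f ψ : ℝ → ℝ) (n : ℕ) :
    ∑' b : heightCover 𝕜 d ψ n, ENNReal.ofReal (f b.1.2) ≤
      ((((d + 1) * (2 * (2 * n + 1) ^ d)) * d : ℕ) : ℝ≥0∞) * ENNReal.ofReal (f (ψ n)) := by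
  have hfin := finite_algNumbers_height_eq (K := 𝕜) d n
  have hfin2 : (heightCover 𝕜 d ψ n).Finite := hfin.image _
  have := hfin2.fintype
  have h1 : ∀ b : heightCover 𝕜 d ψ n, ENNReal.ofReal (f b.1.2) = ENNReal.ofReal (f (ψ n)) := by
    rintro ⟨_, a, -, rfl⟩
    rfl
  simp only [h1]
  rw [tsum_fintype, Finset.sum_const, nsmul_eq_mul, Finset.card_univ, ← Nat.card_eq_fintype_card,
    Nat.card_coe_set_eq]
  gcongr
  exact (Set.ncard_image_le hfin).trans (ncard_algNumbers_height_eq_le d n)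

/-- The terms tend to 0, and `f` is monotone and positive at `ρ`, so `ψ` cannot stay above `ρ`. This
makes the covers admissible. -/
theorem exists_forall_lt_of_summable {d : ℕ} {f ψ : ℝ → ℝ} (hf : IsDimensionFunction f)
    (hψ : IsApproximatingFunction ψ)
    (hsum : Summable (fun r : ℕ => f (ψ ((r + 1 : ℕ) : ℝ)) * ((r + 1 : ℕ) : ℝ) ^ d)) {ρ : ℝ}
    (hρ : 0 < ρ) : ∃ n₀ : ℕ, ∀ n : ℕ, n₀ ≤ n → ψ ((n + 1 : ℕ) : ℝ) ≤ ρ := by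
  obtain ⟨n₀, hn₀⟩ := eventually_atTop.1
    (hsum.tendsto_atTop_zero.eventually_lt_const (hf.pos ρ hρ))
  refine ⟨n₀, fun n hn => ?_⟩
  by_contra! hlt
  have h1 := hn₀ n hn
  have hn1 : (1 : ℝ) ≤ ((n + 1 : ℕ) : ℝ) := by push_cast; linarith [(Nat.cast_nonneg n : (0 : ℝ) ≤ n)]
  have hψn : 0 < ψ ((n + 1 : ℕ) : ℝ) := hψ.pos _ (by linarith)
  have h2 := hf.monotoneOn (mem_Ioi.2 hρ) (mem_Ioi.2 hψn) hlt.le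
  have h3 : f (ψ ((n + 1 : ℕ) : ℝ)) ≤ f (ψ ((n + 1 : ℕ) : ℝ)) * ((n + 1 : ℕ) : ℝ) ^ d :=
    le_mul_of_one_le_right (hf.pos _ hψn).le (one_le_pow₀ hn1)
  linarith

theorem hausdorffF_algApprox_eq_zero {d : ℕ} {f ψ : ℝ → ℝ} (hf : IsDimensionFunction f)
    (hψ : IsApproximatingFunction ψ)
    (hsum : Summable (fun r : ℕ => f (ψ ((r + 1 : ℕ) : ℝ)) * ((r + 1 : ℕ) : ℝ) ^ d)) :
    hausdorffF f (algApprox 𝕜 d ψ) = 0 := by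
  rw [hausdorffF]
  simp only [ENNReal.iSup_eq_zero]
  intro ρ hρ
  obtain ⟨n₀, hn₀⟩ := exists_forall_lt_of_summable hf hψ hsum hρ
  have hpos : ∀ n : ℕ, 0 < ψ ((n + 1 : ℕ) : ℝ) := fun n => hψ.pos _ (by positivity)
  set C : ℝ := ((d + 1) * (2 * 3 ^ d)) * d with hC
  set G : ℕ → ℝ≥0∞ := fun n =>
    ENNReal.ofReal (C * (f (ψ ((n + 1 : ℕ) : ℝ)) * ((n + 1 : ℕ) : ℝ) ^ d)) with hG
  have hGsum : ∑' n, G n ≠ ∞ := (hsum.mul_left C).tsum_ofReal_ne_top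
  have hcost : ∀ n : ℕ, ∑' b : heightCover 𝕜 d ψ (n + 1), ENNReal.ofReal (f b.1.2) ≤ G n := by
    intro n
    refine (tsum_heightCover_le 𝕜 d f ψ (n + 1)).trans ?_
    rw [hG, ← ENNReal.ofReal_natCast, ← ENNReal.ofReal_mul (by positivity)]
    refine ENNReal.ofReal_le_ofReal ?_
    have h1 : ((2 * (n + 1) + 1 : ℕ) : ℝ) ^ d ≤ (3 * ((n + 1 : ℕ) : ℝ)) ^ d := by
      refine pow_le_pow_left₀ (by positivity) ?_ d
      push_cast; linarith [(Nat.cast_nonneg n : (0 : ℝ) ≤ n)]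
    have hfn := (hf.pos _ (hpos n)).le
    rw [mul_pow] at h1
    calc (((d + 1) * (2 * (2 * (n + 1) + 1) ^ d) * d : ℕ) : ℝ) * f (ψ ((n + 1 : ℕ) : ℝ))
        = (((d : ℝ) + 1) * (2 * ((2 * (n + 1) + 1 : ℕ) : ℝ) ^ d) * d) * f (ψ ((n + 1 : ℕ) : ℝ)) := by
          push_cast; ring
      _ ≤ (((d : ℝ) + 1) * (2 * (3 ^ d * ((n + 1 : ℕ) : ℝ) ^ d)) * d) * f (ψ ((n + 1 : ℕ) : ℝ)) := by
          gcongr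
      _ = _ := by rw [hC]; ring
  have hbound : ∀ m : ℕ, n₀ ≤ m → hausdorffPre f ρ (algApprox 𝕜 d ψ) ≤ ∑' k, G (k + m) := by
    intro m hm
    have hcov : IsBallCover ρ (algApprox 𝕜 d ψ) (⋃ k : ℕ, heightCover 𝕜 d ψ (k + m + 1)) := by
      refine ⟨?_, ?_, ?_, ?_⟩
      · exact countable_iUnion fun k => ((finite_algNumbers_height_eq d _).image _).countable
      · intro b hb
        obtain ⟨k, a, -, rfl⟩ := mem_iUnion.1 hb
        exact hpos (k + m)
      · intro b hb
        obtain ⟨k, a, -, rfl⟩ := mem_iUnion.1 hb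
        exact hn₀ (k + m) (hm.trans (Nat.le_add_left _ _))
      · rintro ξ ⟨-, hinf⟩
        obtain ⟨a, ⟨ha, hξa⟩, hnot⟩ := (hinf.sdiff (finite_algNumbers_height_le (K := 𝕜) d m)).nonempty
        have hlt : m < algHeight a := by
          by_contra! hle
          exact hnot ⟨ha, hle⟩
        simp only [mem_iUnion]
        obtain ⟨k, hk⟩ : ∃ k, algHeight a = k + m + 1 := ⟨algHeight a - (m + 1), by omega⟩
        refine ⟨(RCLike.re a, ψ ((k + m + 1 : ℕ) : ℝ)), ⟨k, a, ⟨ha, hk⟩, rfl⟩, ?_⟩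
        rw [Metric.mem_ball, Real.dist_eq]
        rw [hk] at hξa
        -- Since `ξ` is real, passing to the real part of `a` does not increase the distance.
        refine lt_of_le_of_lt ?_ hξa
        have := RCLike.abs_re_le_norm ((ξ : 𝕜) - a)
        rwa [map_sub, RCLike.ofReal_re] at this
    refine (iInf₂_le _ hcov).trans ?_
    refine (ENNReal.tsum_iUnion_le_tsum (fun b : ℝ × ℝ => ENNReal.ofReal (f b.2)) _).trans ?_
    exact ENNReal.tsum_le_tsum fun k => hcost (k + m)
  have htail := ENNReal.tendsto_sum_nat_add G hGsum
  exact le_antisymm (ge_of_tendsto htail (eventually_atTop.2 ⟨n₀, hbound⟩)) zero_le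

end Convergence

/-! ### Comparison with Mathlib's Hausdorff measure -/

section PowerMeasure

open MeasureTheory

theorem ediam_ball_le_ofReal (x r : ℝ) : Metric.ediam (Metric.ball x r) ≤ ENNReal.ofReal (2 * r) := by
  rw [Real.ball_eq_Ioo, Real.ediam_Ioo]
  exact ENNReal.ofReal_le_ofReal (by linarith)

theorem hausdorffMeasure_eq_zero_of_hausdorffF_eq_zero {s : ℝ} (hs : 0 < s) {E : Set ℝ}
    (h : hausdorffF (fun r : ℝ => r ^ s) E = 0) : μH[s] E = 0 := by
  have hcov : ∀ n : ℕ, ∃ S : Set (ℝ × ℝ), IsBallCover (1 / ((n : ℝ) + 1)) E S ∧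
      ∑' b : S, ENNReal.ofReal (b.1.2 ^ s) < ENNReal.ofReal (1 / ((n : ℝ) + 1)) := by
    intro n
    have hn : (0 : ℝ) < 1 / ((n : ℝ) + 1) := by positivity
    have h1 : hausdorffPre (fun r : ℝ => r ^ s) (1 / ((n : ℝ) + 1)) E = 0 := by
      rw [hausdorffF] at h
      simp only [ENNReal.iSup_eq_zero] at h
      exact h _ hn
    have h2 := h1.trans_lt (ENNReal.ofReal_pos.2 hn)
    rw [hausdorffPre] at h2
    simp only [iInf_lt_iff] at h2
    obtain ⟨S, hS, hlt⟩ := h2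
    exact ⟨S, hS, hlt⟩
  choose S hS hlt using hcov
  have hcount : ∀ n, Countable (S n) := fun n => (hS n).countable.to_subtype
  have hlim : Tendsto (fun n : ℕ => ENNReal.ofReal (1 / ((n : ℝ) + 1))) atTop (𝓝 0) := by
    simpa using ENNReal.tendsto_ofReal tendsto_one_div_add_atTop_nhds_zero_nat
  have hle := Measure.hausdorffMeasure_le_liminf_tsum s E (l := atTop)
    (fun n : ℕ => 2 * ENNReal.ofReal (1 / ((n : ℝ) + 1)))
    (by simpa using ENNReal.Tendsto.const_mul hlim (Or.inr ENNReal.ofNat_ne_top))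
    (fun n (b : S n) => Metric.ball b.1.1 b.1.2)
    (Eventually.of_forall fun n b => by
      refine (ediam_ball_le_ofReal _ _).trans ?_
      rw [ENNReal.ofReal_mul zero_le_two, ENNReal.ofReal_ofNat]
      gcongr
      exact (hS n).radius_le b.1 b.2)
    (Eventually.of_forall fun n => by
      have := (hS n).subset
      rwa [biUnion_eq_iUnion] at this)
  have hbound : ∀ n, ∑' b : S n, Metric.ediam (Metric.ball b.1.1 b.1.2) ^ s ≤
      2 ^ s * ENNReal.ofReal (1 / ((n : ℝ) + 1)) := by
    intro n
    calc ∑' b : S n, Metric.ediam (Metric.ball b.1.1 b.1.2) ^ s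
        ≤ ∑' b : S n, 2 ^ s * ENNReal.ofReal (b.1.2 ^ s) := by
          refine ENNReal.tsum_le_tsum fun b => ?_
          refine (ENNReal.rpow_le_rpow (ediam_ball_le_ofReal _ _) hs.le).trans ?_
          rw [ENNReal.ofReal_mul zero_le_two, ENNReal.mul_rpow_of_nonneg _ _ hs.le,
            ENNReal.ofReal_rpow_of_pos ((hS n).radius_pos b.1 b.2), ENNReal.ofReal_ofNat]
      _ = 2 ^ s * ∑' b : S n, ENNReal.ofReal (b.1.2 ^ s) := ENNReal.tsum_mul_left
      _ ≤ _ := by gcongr; exact (hlt n).le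
  have hlim2 : Tendsto (fun n : ℕ => (2 : ℝ≥0∞) ^ s * ENNReal.ofReal (1 / ((n : ℝ) + 1))) atTop
      (𝓝 0) := by
    simpa using ENNReal.Tendsto.const_mul hlim
      (Or.inr (ENNReal.rpow_ne_top_of_nonneg hs.le ENNReal.ofNat_ne_top))
  refine le_antisymm (hle.trans ?_) zero_le
  rw [← hlim2.liminf_eq]
  exact liminf_le_liminf (Eventually.of_forall hbound)

/-- A nonempty set of diameter `a` lies in a ball of radius `a + δ` about one of its points, where
`δ > 0` is needed because `a` may vanish. For `s ≤ 1` subadditivity of the power separates off the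
summable error `δ ^ s`. -/
theorem hausdorffF_eq_zero_of_hausdorffMeasure_eq_zero {s : ℝ} (hs : 0 < s) (hs1 : s ≤ 1)
    {E : Set ℝ} (h : μH[s] E = 0) : hausdorffF (fun r : ℝ => r ^ s) E = 0 := by
  rw [hausdorffF]
  simp only [ENNReal.iSup_eq_zero]
  intro ρ hρ
  have hρ2 : 0 < ρ / 2 := half_pos hρ
  refine le_antisymm (ENNReal.le_of_forall_pos_le_add fun ε hε _ => ?_) zero_le
  have hε2 : (ε : ℝ≥0∞) / 2 ≠ 0 := (ENNReal.half_pos (by exact_mod_cast hε.ne')).ne'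
  rw [zero_add, ← ENNReal.add_halves (ε : ℝ≥0∞)]
  rw [Measure.hausdorffMeasure_apply] at h
  simp only [ENNReal.iSup_eq_zero] at h
  have h2 := (h _ (ENNReal.ofReal_pos.2 hρ2)).trans_lt (pos_iff_ne_zero.2 hε2)
  simp only [iInf_lt_iff] at h2
  obtain ⟨t, hcov, hdiam, hsum⟩ := h2
  obtain ⟨ε', hε', hεsum⟩ := ENNReal.exists_pos_sum_of_countable hε2 ℕ
  have hy : ∀ n, ∃ y : ℝ, (t n).Nonempty → y ∈ t n := fun n => by
    by_cases hn : (t n).Nonempty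
    · exact ⟨hn.some, fun _ => hn.some_mem⟩
    · exact ⟨0, fun hn' => absurd hn' hn⟩
  choose y hy using hy
  set δ : ℕ → ℝ := fun n => min (ρ / 2) ((ε' n : ℝ) ^ (1 / s)) with hδ
  have hδ0 : ∀ n, 0 < δ n := fun n => lt_min hρ2 (Real.rpow_pos_of_pos (by exact_mod_cast hε' n) _)
  have hδs : ∀ n, δ n ^ s ≤ ε' n := fun n => by
    calc δ n ^ s ≤ ((ε' n : ℝ) ^ (1 / s)) ^ s :=
          Real.rpow_le_rpow (hδ0 n).le (min_le_right _ _) hs.le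
      _ = ε' n := by
          rw [← Real.rpow_mul (ε' n).coe_nonneg, one_div_mul_cancel hs.ne', Real.rpow_one]
  have htop : ∀ n, Metric.ediam (t n) ≠ ∞ := fun n =>
    ((hdiam n).trans_lt ENNReal.ofReal_lt_top).ne
  set a : ℕ → ℝ := fun n => (Metric.ediam (t n)).toReal with ha
  have ha0 : ∀ n, 0 ≤ a n := fun n => ENNReal.toReal_nonneg
  have ha2 : ∀ n, a n ≤ ρ / 2 := fun n => ENNReal.toReal_le_of_le_ofReal hρ2.le (hdiam n)
  have hB : IsBallCover ρ E (⋃ n, {(y n, a n + δ n)}) := by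
    refine ⟨countable_iUnion fun n => countable_singleton _, ?_, ?_, ?_⟩
    · intro b hb
      obtain ⟨n, rfl⟩ := mem_iUnion.1 hb
      exact add_pos_of_nonneg_of_pos (ha0 n) (hδ0 n)
    · intro b hb
      obtain ⟨n, rfl⟩ := mem_iUnion.1 hb
      have := ha2 n
      have := min_le_left (ρ / 2) ((ε' n : ℝ) ^ (1 / s))
      simp only [hδ]
      linarith
    · intro x hx
      obtain ⟨n, hn⟩ := mem_iUnion.1 (hcov hx)
      refine mem_iUnion₂.2 ⟨(y n, a n + δ n), mem_iUnion.2 ⟨n, rfl⟩, ?_⟩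
      rw [Metric.mem_ball, dist_edist]
      have h3 := ENNReal.toReal_mono (htop n) (Metric.edist_le_ediam_of_mem hn (hy n ⟨x, hn⟩))
      have := hδ0 n
      simp only [ha]
      linarith
  refine (iInf₂_le _ hB).trans ?_
  refine (ENNReal.tsum_iUnion_le_tsum (fun b : ℝ × ℝ => ENNReal.ofReal (b.2 ^ s)) _).trans ?_
  refine (tsum_congr fun n => tsum_singleton (y n, a n + δ n)
    (fun b : ℝ × ℝ => ENNReal.ofReal (b.2 ^ s))).le.trans ?_
  calc ∑' n, ENNReal.ofReal ((a n + δ n) ^ s)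
      ≤ ∑' n, ((⨆ (_ : (t n).Nonempty), Metric.ediam (t n) ^ s) + (ε' n : ℝ≥0∞)) := by
        refine ENNReal.tsum_le_tsum fun n => ?_
        refine (ENNReal.ofReal_le_ofReal
          (Real.rpow_add_le_add_rpow (ha0 n) (hδ0 n).le hs.le hs1)).trans ?_
        rw [ENNReal.ofReal_add (Real.rpow_nonneg (ha0 n) _) (Real.rpow_nonneg (hδ0 n).le _)]
        gcongr
        · rw [← ENNReal.ofReal_rpow_of_nonneg (ha0 n) hs.le, ENNReal.ofReal_toReal (htop n)]
          by_cases hn : (t n).Nonempty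
          · exact le_iSup (fun _ : (t n).Nonempty => Metric.ediam (t n) ^ s) hn
          · rw [not_nonempty_iff_eq_empty.1 hn, Metric.ediam_empty, ENNReal.zero_rpow_of_pos hs]
            exact zero_le
        · exact (ENNReal.ofReal_le_ofReal (hδs n)).trans_eq (ENNReal.ofReal_coe_nnreal)
    _ = _ := ENNReal.tsum_add
    _ ≤ _ := by gcongr

end PowerMeasure

/-! ### Power functions and Hausdorff dimension -/

section Powers

theorem isDimensionFunction_rpow {s : ℝ} (hs : 0 < s) :
    IsDimensionFunction fun r : ℝ => r ^ s where
  pos _ hr := Real.rpow_pos_of_pos hr s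
  monotoneOn _ hx _ _ hxy := Real.rpow_le_rpow (le_of_lt hx) hxy hs.le
  continuousOn := (Real.continuous_rpow_const hs.le).continuousOn
  tendsto_zero := by
    have := ((Real.continuous_rpow_const hs.le).tendsto 0).mono_left
      (nhdsWithin_le_nhds (s := Ioi 0))
    rwa [Real.zero_rpow hs.ne'] at this

theorem inv_mul_rpow_eq {r : ℝ} (hr : 0 < r) (s : ℝ) : r⁻¹ * r ^ s = r ^ (-(1 - s)) := by
  rw [← Real.rpow_neg_one, ← Real.rpow_add hr]
  ring_nf

theorem tendsto_inv_mul_rpow_atTop {s : ℝ} (hs : s < 1) :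
    Tendsto (fun r : ℝ => r⁻¹ * r ^ s) (𝓝[>] 0) atTop := by
  refine (tendsto_rpow_neg_nhdsGT_zero (by linarith : -(1 - s) < 0)).congr' ?_
  filter_upwards [self_mem_nhdsWithin] with r hr
  exact (inv_mul_rpow_eq hr s).symm

theorem antitoneOn_inv_mul_rpow {s : ℝ} (hs : s ≤ 1) :
    AntitoneOn (fun r : ℝ => r⁻¹ * r ^ s) (Ioi 0) := by
  intro x hx y hy hxy
  simp only [inv_mul_rpow_eq hx, inv_mul_rpow_eq hy]
  exact Real.rpow_le_rpow_of_nonpos hx hxy (by linarith)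

theorem isApproximatingFunction_powerApprox (d : ℕ) {τ : ℝ} (hτ : 0 ≤ τ) :
    IsApproximatingFunction (powerApprox d τ) where
  pos _ hr := Real.rpow_pos_of_pos hr _
  antitoneOn _ hx _ _ hxy := Real.rpow_le_rpow_of_nonpos hx hxy (by
    have : 0 ≤ ((d : ℝ) + 1) * τ := by positivity
    linarith)

theorem summable_powerApprox_iff (d : ℕ) (τ s : ℝ) :
    Summable (fun r : ℕ => powerApprox d τ ((r + 1 : ℕ) : ℝ) ^ s * ((r + 1 : ℕ) : ℝ) ^ d) ↔
      1 < τ * s := by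
  have h1 : ∀ r : ℕ, powerApprox d τ ((r + 1 : ℕ) : ℝ) ^ s * ((r + 1 : ℕ) : ℝ) ^ d =
      ((r + 1 : ℕ) : ℝ) ^ (d - ((d : ℝ) + 1) * (τ * s)) := by
    intro r
    have hr : (0 : ℝ) < ((r + 1 : ℕ) : ℝ) := by positivity
    rw [powerApprox, ← Real.rpow_mul hr.le, ← Real.rpow_natCast _ d, ← Real.rpow_add hr]
    congr 1
    ring
  simp only [h1]
  rw [summable_nat_add_iff (f := fun r : ℕ => (r : ℝ) ^ (d - ((d : ℝ) + 1) * (τ * s))) 1,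
    Real.summable_nat_rpow]
  have hd : (0 : ℝ) < (d : ℝ) + 1 := by positivity
  constructor
  · intro h
    by_contra! h2
    have := mul_le_mul_of_nonneg_left h2 hd.le
    linarith
  · intro h
    have := mul_lt_mul_of_pos_left h hd
    linarith

theorem algApprox_powerApprox_anti (𝕜 : Type*) [RCLike 𝕜] (d : ℕ) {τ τ' : ℝ} (h : τ ≤ τ') :
    algApprox 𝕜 d (powerApprox d τ') ⊆ algApprox 𝕜 d (powerApprox d τ) := by
  rintro ξ ⟨hξ, hinf⟩
  refine ⟨hξ, hinf.mono ?_⟩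
  rintro a ⟨ha, hlt⟩
  refine ⟨ha, hlt.trans_le ?_⟩
  refine Real.rpow_le_rpow_of_exponent_le (by exact_mod_cast one_le_algHeight a) ?_
  have : ((d : ℝ) + 1) * τ ≤ ((d : ℝ) + 1) * τ' := by gcongr
  linarith

theorem hausdorffF_algApprox_powerApprox (𝕜 : Type*) [RCLike 𝕜] {d : ℕ} (hd : 1 ≤ d) {τ : ℝ}
    (hτ : 1 < τ) :
    hausdorffF (fun r : ℝ => r ^ (1 / τ)) (algApprox 𝕜 d (powerApprox d τ)) = ∞ := by
  have h0 : 0 < τ := by linarith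
  have h1 : 1 / τ < 1 := (div_lt_one h0).2 hτ
  refine hausdorffF_algApprox_eq_top 𝕜 hd (isDimensionFunction_rpow (one_div_pos.2 h0))
    (tendsto_inv_mul_rpow_atTop h1) (antitoneOn_inv_mul_rpow h1.le)
    (isApproximatingFunction_powerApprox d h0.le) ?_
  rw [summable_powerApprox_iff, mul_one_div_cancel h0.ne']
  exact lt_irrefl 1

theorem le_dimH_algApprox (𝕜 : Type*) [RCLike 𝕜] {d : ℕ} (hd : 1 ≤ d) {τ : ℝ} (hτ : 1 < τ) :
    ENNReal.ofReal (1 / τ) ≤ dimH (algApprox 𝕜 d (powerApprox d τ)) := by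
  have h0 : 0 < τ := by linarith
  have h1 : 1 / τ < 1 := (div_lt_one h0).2 hτ
  refine le_dimH_of_hausdorffMeasure_ne_zero fun h => ?_
  rw [Real.coe_toNNReal _ (one_div_pos.2 h0).le] at h
  have h2 := hausdorffF_eq_zero_of_hausdorffMeasure_eq_zero (one_div_pos.2 h0) h1.le h
  rw [hausdorffF_algApprox_powerApprox 𝕜 hd hτ] at h2
  exact ENNReal.top_ne_zero h2

theorem dimH_algApprox_le (𝕜 : Type*) [RCLike 𝕜] (d : ℕ) {τ : ℝ} (hτ : 0 < τ) :
    dimH (algApprox 𝕜 d (powerApprox d τ)) ≤ ENNReal.ofReal (1 / τ) := by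
  refine dimH_le fun s hs => ?_
  by_contra! hlt
  have h1 : 1 / τ < s := by
    rwa [ENNReal.ofReal, ENNReal.coe_lt_coe, Real.toNNReal_lt_iff_lt_coe (one_div_pos.2 hτ).le]
      at hlt
  have h2 : 1 < τ * s := by
    have := mul_lt_mul_of_pos_left h1 hτ
    rwa [mul_one_div_cancel hτ.ne'] at this
  have hs0 : (0 : ℝ) < s := (one_div_pos.2 hτ).trans h1
  have h3 := hausdorffMeasure_eq_zero_of_hausdorffF_eq_zero hs0
    (hausdorffF_algApprox_eq_zero 𝕜 (isDimensionFunction_rpow hs0)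
      (isApproximatingFunction_powerApprox d hτ.le) ((summable_powerApprox_iff d τ s).2 h2))
  rw [h3] at hs
  exact ENNReal.zero_ne_top hs

theorem dimH_algApprox_powerApprox (𝕜 : Type*) [RCLike 𝕜] {d : ℕ} (hd : 1 ≤ d) {τ : ℝ}
    (hτ : 1 ≤ τ) : dimH (algApprox 𝕜 d (powerApprox d τ)) = ENNReal.ofReal (1 / τ) := by
  have h0 : 0 < τ := by linarith
  refine le_antisymm (dimH_algApprox_le 𝕜 d h0) ?_
  -- At `τ = 1` the divergence theorem does not apply, since `f r / r` is constant. The lower bounds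
  -- for exponents above `τ`, whose sets are smaller, pass to the limit.
  have hlim : Tendsto (fun x : ℝ => ENNReal.ofReal (1 / x)) (𝓝[>] τ)
      (𝓝 (ENNReal.ofReal (1 / τ))) := by
    refine ENNReal.tendsto_ofReal (Tendsto.mono_left ?_ nhdsWithin_le_nhds)
    exact tendsto_const_nhds.div tendsto_id h0.ne'
  refine le_of_tendsto hlim ?_
  filter_upwards [self_mem_nhdsWithin] with x hx
  exact (le_dimH_algApprox 𝕜 hd (hτ.trans_lt hx)).trans
    (dimH_mono (algApprox_powerApprox_anti 𝕜 d (le_of_lt hx)))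

end Powers

theorem theoremA2 (𝕜 : Type*) [RCLike 𝕜] (d : ℕ) (hd : 1 ≤ d) :
    (∀ f ψ : ℝ → ℝ, IsDimensionFunction f →
      Tendsto (fun r : ℝ => r⁻¹ * f r) (𝓝[>] 0) atTop →
      AntitoneOn (fun r : ℝ => r⁻¹ * f r) (Ioi 0) →
      IsApproximatingFunction ψ →
      ((Summable (fun r : ℕ => f (ψ ((r + 1 : ℕ) : ℝ)) * ((r + 1 : ℕ) : ℝ) ^ d) →
          hausdorffF f (algApprox 𝕜 d ψ) = 0) ∧
        (¬ Summable (fun r : ℕ => f (ψ ((r + 1 : ℕ) : ℝ)) * ((r + 1 : ℕ) : ℝ) ^ d) →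
          hausdorffF f (algApprox 𝕜 d ψ) = ∞))) ∧
    (∀ τ : ℝ, 1 ≤ τ → dimH (algApprox 𝕜 d (powerApprox d τ)) = ENNReal.ofReal (1 / τ)) ∧
    (∀ τ : ℝ, 1 < τ →
      hausdorffF (fun r : ℝ => r ^ (1 / τ)) (algApprox 𝕜 d (powerApprox d τ)) = ∞) :=
  ⟨fun _ _ hf hflim hfa hψ => ⟨hausdorffF_algApprox_eq_zero 𝕜 hf hψ,
    hausdorffF_algApprox_eq_top 𝕜 hd hf hflim hfa hψ⟩,
    fun _ hτ => dimH_algApprox_powerApprox 𝕜 hd hτ,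
    fun _ hτ => hausdorffF_algApprox_powerApprox 𝕜 hd hτ⟩
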